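/- Let $N\ge 2$, $\nu>0$, $\alpha\ge 1+\frac N2$, $s\ge 3+N$ and $T>0$. Let $g_1:(0,\infty)\to[1,\infty)$ be non-decreasing with $$\int_e^\infty \frac{d\tau}{g_1^2(\tau)\,\ln(\tau)\,\tau}=\infty .$$ For a measurable $m_1:\mathbb R^N\to\mathbb R$ let $\mathcal L_1$ be the Fourier multiplier $\widehat{\mathcal L_1 f}(\xi)=m_1(\xi)\hat f(\xi)$, where $\xi$ is the angular frequency, i.e. $\partial_j$ has the symbol $i\xi_j$, and suppose that for some $R>0$ $$m_1(\xi)\ \ge\ \frac{|\xi|^\alpha}{g_1(|\xi|)}\qquad\text{for all } |\xi|\ge R. \tag{$*$}$$ Consider on $\mathbb R^N$ the magnetohydrodynamics system with zero diffusivity $$\partial_t u+(u\cdot\nabla)u-(b\cdot\nabla)b+\nabla\pi+\nu\mathcal L_1^2u=0,\qquad \partial_t b+(u\cdot\nabla)b-(b\cdot\nabla)u=0,\qquad \nabla\cdot u=\nabla\cdot b=0 .$$ A solution on a time interval $I$ (equal to $[0,T]$ or to $[0,T')$) is a pair of real vector fields $u,b\in C(I;H^s)$, divergence free on $I$, such that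 at each interior time $t$ of $I$ the time derivatives exist in $L^2$, $\mathcal L_1^2u(t)\in L^2$, $\nabla\pi(t)\in L^2$ with $\pi(t)\in C^1$, and the equations hold in $L^2$. Write $\|\mathcal L_1\nabla u\|_{L^2}^2=\sum_j\|\mathcal L_1\partial_ju\|_{L^2}^2$. 1. Every solution $(u,b)$ on $[0,T]$ satisfies $$\sup_{t\in[0,T]}\left(\|\nabla u(t)\|_{L^2}^2+\|\nabla b(t)\|_{L^2}^2\right)+\int_0^T\|\mathcal L_1\nabla u(t)\|_{L^2}^2\,dt<\infty .$$ 2. (The a priori bound.) Suppose moreover that $g_1(r)=O(r^p)$ as $r\to\infty$ for some $p<\alpha-\frac N2$; this holds in particular if $g_1$ grows at most logarithmically. Then for all $R>0$ and $K\ge0$ there is a constant $C$, depending only on $N,\nu,\alpha,g_1,s,T,R,K$, such that for every measurable $m_1$ satisfying $(*)$ with this $R$, every $T'\in(0,T]$ and every solution $(u,b)$ on $[0,T')$ with $\|u(0)\|_{H^s}^2+\|b(0)\|_{H^s}^2\le K$, $$\sup_{t\in[0,T')}\left(\|\nabla u(t)\|_{L^2}^2+\|\nabla b(t)\|_{L^2}^2\right)+\int_0^{T'}\|\mathcal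 L_1\nabla u(t)\|_{L^2}^2\,dt\le C .$$ -/

import Mathlib

open MeasureTheory Set Filter Topology Asymptotics
open scoped ENNReal NNReal FourierTransform

noncomputable section

namespace MHD

/-- Physical and frequency space `ℝᴺ` with its Euclidean norm. -/
abbrev Sp (N : ℕ) : Type := EuclideanSpace ℝ (Fin N)

/-- The complex vectors `ℂᴺ`, in which Fourier transforms of vector fields take their values. -/
abbrev CSp (N : ℕ) : Type := EuclideanSpace ℂ (Fin N)

/-- The `j`-th standard basis vector of `ℝᴺ`. -/
def basisVec {N : ℕ} (j : Fin N) : Sp N := EuclideanSpace.single j 1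

/-- A real vector field, seen as a complex one. -/
def complexify {N : ℕ} (v : Sp N → Sp N) : Sp N → CSp N :=
  fun x => WithLp.toLp 2 (fun i => ((v x i : ℝ) : ℂ))

/-- The partial derivative `∂ⱼ v`. -/
def partialDeriv {N : ℕ} (j : Fin N) (v : Sp N → Sp N) : Sp N → Sp N :=
  fun x => fderiv ℝ v x (basisVec j)

/-- The divergence `∇ · v`. -/
def div {N : ℕ} (v : Sp N → Sp N) (x : Sp N) : ℝ := ∑ i, partialDeriv i v x i

/-- The convective term `(v · ∇) w`. -/
def convect {N : ℕ} (v w : Sp N → Sp N) : Sp N → Sp N := fun x => fderiv ℝ w x (v x)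

/-- Square integrability of a vector field. -/
def IsL2 {N : ℕ} (v : Sp N → Sp N) : Prop := MemLp (complexify v) 2 (volume : Measure (Sp N))

open Classical in
/-- The class in `L²(ℝᴺ; ℂᴺ)` of a square integrable vector field
(and `0`, by convention, for a field that is not square integrable). -/
def toL2 {N : ℕ} (v : Sp N → Sp N) : Lp (CSp N) 2 (volume : Measure (Sp N)) :=
  if h : IsL2 v then MemLp.toLp (complexify v) h else 0

/-- `‖v‖²_{Hˢ} = ∫ (1 + |ξ|²)ˢ |v̂(ξ)|² dξ` for a square integrable field `v`. Mathlib's (unitary)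
Fourier transform has the kernel `exp (- 2 π i x · ξ)`, so that its variable `ξ` stands for the
angular frequency `2 π ξ`; thus `∂ⱼ` has the symbol `i (2 π ξ)ⱼ`. -/
def sobolevNormSq {N : ℕ} (s : ℝ) (v : Sp N → Sp N) : ℝ≥0∞ :=
  ∫⁻ ξ : Sp N, ENNReal.ofReal ((1 + ‖(2 * Real.pi) • ξ‖ ^ 2) ^ s) * ‖(𝓕 (toL2 v)) ξ‖ₑ ^ 2

/-- `h = m(D) f` in `L²`: the Fourier multiplier with the real symbol `m` (a function of the
angular frequency) sends `f` to `h`. -/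
def IsMultiplierImage {N : ℕ} (m : Sp N → ℝ) (f h : Lp (CSp N) 2 (volume : Measure (Sp N))) :
    Prop :=
  ∀ᵐ ξ : Sp N, (𝓕 h) ξ = ((m ((2 * Real.pi) • ξ) : ℝ) : ℂ) • (𝓕 f) ξ

/-- `‖∇ v‖²_{L²} = ∑ⱼ ‖∂ⱼ v‖²_{L²}`. -/
def gradNormSq {N : ℕ} (v : Sp N → Sp N) : ℝ≥0∞ :=
  ∑ j, ∫⁻ x : Sp N, ‖partialDeriv j v x‖ₑ ^ 2

/-- `‖m(D) ∇ v‖²_{L²} = ∑ⱼ ‖m(D) ∂ⱼ v‖²_{L²}` for a field with square integrable first derivatives,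
computed on the Fourier side; it is `∞` if `m(D) ∇ v` is not square integrable. -/
def multGradNormSq {N : ℕ} (m : Sp N → ℝ) (v : Sp N → Sp N) : ℝ≥0∞ :=
  ∑ j, ∫⁻ ξ : Sp N, ‖((m ((2 * Real.pi) • ξ) : ℝ) : ℂ) • (𝓕 (toL2 (partialDeriv j v))) ξ‖ₑ ^ 2

/-- `v ∈ C(I; Hˢ)`. Each `v t` is the twice continuously differentiable representative of its class;
for `s > 2 + N / 2` one exists by Sobolev embedding. -/
structure IsContinuousInSobolev {N : ℕ} (s : ℝ) (I : Set ℝ) (v : ℝ → Sp N → Sp N) : Prop where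
  contDiff : ∀ t ∈ I, ContDiff ℝ 2 (v t)
  isL2 : ∀ t ∈ I, IsL2 (v t)
  sobolev : ∀ t ∈ I, sobolevNormSq s (v t) < ⊤
  continuous : ∀ t₀ ∈ I, Tendsto (fun t => sobolevNormSq s (v t - v t₀)) (𝓝[I] t₀) (𝓝 0)

/-- `(u, b)` solves, on the time interval `I`, the MHD system with viscosity `ν`, dissipation
`m(D)²` and zero diffusivity

`∂ₜ u + (u · ∇) u - (b · ∇) b + ∇ π + ν m(D)² u = 0`,
`∂ₜ b + (u · ∇) b - (b · ∇) u = 0`, `∇ · u = ∇ · b = 0`,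

in the class `C(I; Hˢ)`. For `t` inside `I` the time derivatives exist in `L²`, the field `m(D)² u`
(the one called `Lu` below) is in `L²`, and the equations hold in `L²`. -/
structure IsSolution {N : ℕ} (ν : ℝ) (m : Sp N → ℝ) (s : ℝ) (I : Set ℝ)
    (u b : ℝ → Sp N → Sp N) : Prop where
  u_sobolev : IsContinuousInSobolev s I u
  b_sobolev : IsContinuousInSobolev s I b
  u_div : ∀ t ∈ I, ∀ x, div (u t) x = 0
  b_div : ∀ t ∈ I, ∀ x, div (b t) x = 0
  momentum : ∀ t ∈ interior I,
    ∃ (P : Sp N → ℝ) (Lu : Lp (CSp N) 2 (volume : Measure (Sp N))),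
      ContDiff ℝ 1 P ∧ IsL2 (gradient P) ∧
      IsMultiplierImage (fun ξ => m ξ ^ 2) (toL2 (u t)) Lu ∧
      HasDerivAt (fun τ => toL2 (u τ))
        (-toL2 (convect (u t) (u t)) + toL2 (convect (b t) (b t)) - toL2 (gradient P)
          - (ν : ℂ) • Lu) t
  induction_eq : ∀ t ∈ interior I,
    HasDerivAt (fun τ => toL2 (b τ))
      (-toL2 (convect (u t) (b t)) + toL2 (convect (b t) (u t))) t

/-- The lower bound `m(ξ) ≥ |ξ|^α / g(|ξ|)` for all `|ξ| ≥ R`. -/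
def LowerBoundFrom {N : ℕ} (α : ℝ) (g : ℝ → ℝ) (R : ℝ) (m : Sp N → ℝ) : Prop :=
  ∀ ξ : Sp N, R ≤ ‖ξ‖ → ‖ξ‖ ^ α / g ‖ξ‖ ≤ m ξ

/-- `sup_{t ∈ I} (‖∇u(t)‖²_{L²} + ‖∇b(t)‖²_{L²}) + ∫_I ‖m(D) ∇u(t)‖²_{L²} dt`, in `[0, ∞]`. -/
def energyH1 {N : ℕ} (m : Sp N → ℝ) (I : Set ℝ) (u b : ℝ → Sp N → Sp N) : ℝ≥0∞ :=
  (⨆ t ∈ I, (gradNormSq (u t) + gradNormSq (b t))) + ∫⁻ t in I, multGradNormSq m (u t)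

end MHD

end

namespace MHD
open scoped SchwartzMap InnerProductSpace ContDiff

/-! ### Fourier inversion on L¹ ∩ L². -/

section Fourier
variable {E F : Type*} [NormedAddCommGroup E] [InnerProductSpace ℝ E] [FiniteDimensional ℝ E]
  [MeasurableSpace E] [BorelSpace E] [NormedAddCommGroup F] [InnerProductSpace ℂ F]
  [CompleteSpace F]

/-! Write X = ‖∇u‖² + ‖∇b‖², D = ‖L₁u‖², M = ‖L₁∇u‖² and Λ = ∫ |ξ| |û(ξ)| dξ, with ξ the angular
frequency.

On a closed interval the solution is bounded in Hˢ by compactness, hence so are X and Λ, and the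
dissipation integral is read off the balance of X (`IsSolution.energyH1_lt_top`). The work lies in
the a priori bound.

Pair the equations with -Δu and -Δb. The pressure disappears because its transform is parallel to ξ
and û is orthogonal to ξ. The cubic terms with second derivatives cancel, since u and b are
divergence free, and each remaining one has a factor ∇u (`abs_nonlinear_le`). As sup |∇u| ≤ NΛ, this
gives X' + 2νM ≤ 6NΛX (`IsSolution.hasDerivAt_gradSq`). The same cancellations in L² give the
balance E' = -2νD of E = ‖u‖² + ‖b‖², so ∫ D dt is bounded by the data.

Now split Λ by frequency (`freqL1_split`). Bounded frequencies cost ‖u‖. Between them and a cut-off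
Y, the condition α ≥ 1 + N/2 leads to the critical integral of |ξ|^(-N), so that the cost is g(Y) (D
log Y)^(1/2). Above Y, the power bound on g leaves a margin δ > 0 and the cost is Y^(-δ) M^(1/2).
Take Y = (e + X)^κ with 2δκ ≥ 1: the high frequencies are absorbed by νM (`absorb`), and there
remains X' + νM ≤ C (1 + D) g(Y)² log Y (e + X).

Since Y'/Y = κX'/(e + X), this says φ(Y) Y' ≤ κC (1 + D), where φ(τ) = 1/(g(τ)² τ log τ) is the
density whose integral diverges. The integral of 1 + D is bounded by the data, so `osgood` bounds Y,
hence X, and one more integration bounds ∫ M dt.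

The rest makes this rigorous in the given class: time derivatives exist only in L², P is only C¹ and
need not be integrable, and φ may jump. `HasMoments` records what Sobolev embedding provides for
moving between fields, their L² classes and their transforms. -/

theorem integral_smul_fourierInv_eq_flip {f : E → ℂ} {h : E → F} (hf : Integrable f)
    (hh : Integrable h) :
    ∫ x, (𝓕⁻ f) x • h x = ∫ x, f x • (𝓕⁻ h) x := by
  have e1 : 𝓕⁻ f = VectorFourier.fourierIntegral Real.fourierChar volume (-innerₗ E) f := by
    ext x; simp [Real.fourierInv_eq, VectorFourier.fourierIntegral]
  have e2 : 𝓕⁻ h = VectorFourier.fourierIntegral Real.fourierChar volume (-innerₗ E).flip h := by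
    ext x; simp [Real.fourierInv_eq, VectorFourier.fourierIntegral, real_inner_comm]
  rw [e1, e2]
  refine VectorFourier.integral_fourierIntegral_smul_eq_flip Real.continuous_fourierChar ?_ hf hh
  have : Continuous fun p : E × E => -⟪p.1, p.2⟫_ℝ := continuous_inner.neg
  simpa using this

/-- The inverse Fourier transform on `L²` is given by the integral formula on `L¹ ∩ L²`. -/
theorem fourierInv_Lp_ae_eq (H : Lp F 2 (volume : Measure E)) (hH : Integrable H) :
    ((𝓕⁻ H : Lp F 2 (volume : Measure E)) : E → F) =ᵐ[volume] 𝓕⁻ (H : E → F) := by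
  have hcont : Continuous (𝓕⁻ (H : E → F)) := by
    rw [Real.fourierInv_eq_fourier_comp_neg]
    exact VectorFourier.fourierIntegral_continuous Real.continuous_fourierChar continuous_inner hH.comp_neg
  -- The L² transform agrees with that of tempered distributions, so both sides can be compared on
  -- test functions, where the transform moves to the other factor.
  refine ae_eq_of_integral_contDiff_smul_eq ((Lp.memLp _).locallyIntegrable (by norm_num))
    hcont.locallyIntegrable fun g hg hgc => ?_
  have hg₁ : HasCompactSupport (Complex.ofRealCLM ∘ g) := hgc.comp_left rfl
  have hg₂ : ContDiff ℝ ((⊤ : ℕ∞) : WithTop ℕ∞) (Complex.ofRealCLM ∘ g) :=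
    Complex.ofRealCLM.contDiff.comp hg
  set G : 𝓢(E, ℂ) := hg₁.toSchwartzMap hg₂ with hG
  have hGx : ∀ x, G x = (g x : ℂ) := fun x => by simp [hG]
  have h1 := congrArg (fun T : 𝓢'(E, F) => T G) (Lp.fourierInv_toTemperedDistribution_eq H)
  simp only [TemperedDistribution.fourierInv_apply, Lp.toTemperedDistribution_apply, hGx] at h1
  calc ∫ x, g x • (𝓕⁻ H : Lp F 2 (volume : Measure E)) x
      = ∫ x, (g x : ℂ) • (𝓕⁻ H : Lp F 2 (volume : Measure E)) x := by simp
    _ = ∫ x, (𝓕⁻ (G : E → ℂ)) x • H x := by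
        rw [← h1, SchwartzMap.fourierInv_coe]
    _ = ∫ x, G x • (𝓕⁻ (H : E → F)) x := integral_smul_fourierInv_eq_flip G.integrable hH
    _ = _ := by simp [hGx]
end Fourier

/-! ### Derivatives of vector fields on the Fourier side. -/

section Fields
variable {N : ℕ}

/-- The inclusion of `ℝᴺ` in `ℂᴺ`. -/
def inclusion : Sp N →ₗᵢ[ℝ] CSp N where
  toFun x := WithLp.toLp 2 fun i => ((x i : ℝ) : ℂ)
  map_add' x y := by ext i; simp
  map_smul' c x := by ext i; simp
  norm_map' x := by simp [EuclideanSpace.norm_eq]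

theorem complexify_apply (v : Sp N → Sp N) (x : Sp N) : complexify v x = inclusion (v x) := rfl

theorem inclusion_apply (x : Sp N) (i : Fin N) : inclusion x i = (x i : ℂ) := rfl

theorem inner_inclusion (x y : Sp N) : ⟪inclusion x, inclusion y⟫_ℂ = ((⟪x, y⟫_ℝ : ℝ) : ℂ) := by
  simp [PiLp.inner_apply, inclusion_apply]

theorem isL2_iff {v : Sp N → Sp N} : IsL2 v ↔ MemLp v 2 volume :=
  (inclusion (N := N)).lipschitz.memLp_comp_iff_of_antilipschitz (inclusion (N := N)).antilipschitz
    (map_zero _)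

theorem toL2_coe {v : Sp N → Sp N} (hv : IsL2 v) : (toL2 v : Sp N → CSp N) =ᵐ[volume] complexify v := by
  rw [toL2, dif_pos hv]; exact hv.coeFn_toLp

theorem toL2_eq_of_ae {v : Sp N → Sp N} (f : Lp (CSp N) 2 (volume : Measure (Sp N)))
    (h : complexify v =ᵐ[volume] f) : IsL2 v ∧ toL2 v = f := by
  have hv : IsL2 v := (memLp_congr_ae h).2 (Lp.memLp f)
  exact ⟨hv, Lp.ext ((toL2_coe hv).trans h)⟩

/-- The Fourier transform of a square integrable vector field. -/
noncomputable abbrev hat (v : Sp N → Sp N) : Sp N → CSp N :=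
  ((𝓕 (toL2 v) : Lp (CSp N) 2 (volume : Measure (Sp N))) : Sp N → CSp N)

/-- Both sides are continuous and agree almost everywhere, so inversion holds at every point and can
be differentiated. -/
theorem complexify_eq_fourierInv {v : Sp N → Sp N} (hc : Continuous v) (hv : IsL2 v)
    (hi : Integrable (hat v)) : complexify v = 𝓕⁻ (hat v) := by
  have hcont : Continuous (𝓕⁻ (hat v)) := by
    rw [Real.fourierInv_eq_fourier_comp_neg]
    exact VectorFourier.fourierIntegral_continuous Real.continuous_fourierChar continuous_inner
      hi.comp_neg
  have hc' : Continuous (complexify v) := (inclusion (N := N)).continuous.comp hc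
  refine (Continuous.ae_eq_iff_eq volume hc' hcont).1 ?_
  refine (toL2_coe hv).symm.trans (Filter.EventuallyEq.trans ?_ (fourierInv_Lp_ae_eq _ hi))
  rw [FourierTransform.fourierInv_fourier_eq]

theorem complexify_partialDeriv {v : Sp N → Sp N} (hd : Differentiable ℝ v) (j : Fin N) (x : Sp N) :
    complexify (partialDeriv j v) x = fderiv ℝ (complexify v) x (basisVec j) := by
  have : HasFDerivAt (complexify v)
      ((inclusion (N := N)).toContinuousLinearMap.comp (fderiv ℝ v x)) x :=
    (inclusion (N := N)).toContinuousLinearMap.hasFDerivAt.comp x (hd x).hasFDerivAt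
  rw [this.fderiv]; rfl

theorem fderiv_fourierInv_apply {h : Sp N → CSp N} (hi : Integrable h)
    (hi' : Integrable fun ξ => ‖ξ‖ * ‖h ξ‖) (j : Fin N) (x : Sp N) :
    fderiv ℝ (𝓕⁻ h) x (basisVec j) =
      𝓕⁻ (fun ξ => ((2 * Real.pi * ξ j : ℝ) * Complex.I) • h ξ) x := by
  have e : (𝓕⁻ h) = 𝓕 fun ξ => h (-ξ) := Real.fourierInv_eq_fourier_comp_neg h
  have hm : Integrable fun ξ => ‖ξ‖ * ‖h (-ξ)‖ := by simpa using hi'.comp_neg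
  rw [e, Real.fderiv_fourier hi.comp_neg hm, Real.fourierInv_eq_fourier_comp_neg]
  have hs : Integrable (VectorFourier.fourierSMulRight (innerSL ℝ) fun ξ => h (-ξ)) := by
    refine (hm.const_mul (2 * Real.pi)).mono
      hi.comp_neg.1.fourierSMulRight (.of_forall fun ξ => ?_)
    refine (VectorFourier.norm_fourierSMulRight_le _ _ _).trans ?_
    have h1 : ‖(innerSL ℝ : Sp N →L[ℝ] Sp N →L[ℝ] ℝ)‖ ≤ 1 := norm_innerSL_le ℝ
    rw [Real.norm_of_nonneg (by positivity)]
    calc 2 * Real.pi * ‖(innerSL ℝ : Sp N →L[ℝ] Sp N →L[ℝ] ℝ)‖ * ‖ξ‖ * ‖h (-ξ)‖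
        ≤ 2 * Real.pi * 1 * ‖ξ‖ * ‖h (-ξ)‖ := by gcongr
      _ = _ := by ring
  refine (Real.fourier_continuousLinearMap_apply hs).trans ?_
  refine Real.fourier_congr_ae (.of_forall fun ξ => ?_) x
  have h1 : (innerSL ℝ ξ) (basisVec j) = ξ j := by
    simp [basisVec, EuclideanSpace.inner_single_right]
  simp only [VectorFourier.fourierSMulRight_apply, h1,
    PiLp.neg_apply, neg_smul]
  rw [← Complex.coe_smul (ξ j), smul_smul, ← neg_smul]
  congr 1
  push_cast
  ring

/-- Differentiate the pointwise inversion formula under the integral. The new density is again in L¹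
∩ L², so its inverse transform represents the L² class of the derivative, and the supremum is at
most the L¹ norm of the density. -/
theorem partialDeriv_fourier {v : Sp N → Sp N} (hd : ContDiff ℝ 1 v) (hv : IsL2 v)
    (hi : Integrable (hat v)) (hi' : Integrable fun ξ => ‖ξ‖ * ‖hat v ξ‖)
    (h2 : MemLp (fun ξ => ‖ξ‖ * ‖hat v ξ‖) 2 volume) (j : Fin N) :
    IsL2 (partialDeriv j v) ∧
      (hat (partialDeriv j v) =ᵐ[volume] fun ξ => ((2 * Real.pi * ξ j : ℝ) * Complex.I) • hat v ξ) ∧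
      ∀ x, ‖partialDeriv j v x‖ ≤ ∫ ξ, ‖((2 * Real.pi * ξ j : ℝ) * Complex.I) • hat v ξ‖ := by
  set h : Sp N → CSp N := fun ξ => ((2 * Real.pi * ξ j : ℝ) * Complex.I) • hat v ξ with hh
  have hmeas : AEStronglyMeasurable h volume := by
    have hc : Continuous fun ξ : Sp N => ((2 * Real.pi * ξ j : ℝ) : ℂ) * Complex.I := by fun_prop
    exact hc.aestronglyMeasurable.smul hi.1
  have hle : ∀ ξ, ‖h ξ‖ ≤ 2 * Real.pi * (‖ξ‖ * ‖hat v ξ‖) := fun ξ => by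
    have := PiLp.norm_apply_le ξ j
    rw [hh, norm_smul, ← mul_assoc]
    gcongr
    simpa [abs_of_pos Real.pi_pos] using mul_le_mul_of_nonneg_left this Real.two_pi_pos.le
  have hint : Integrable h := (hi'.const_mul (2 * Real.pi)).mono' hmeas (.of_forall hle)
  have hL2 : MemLp h 2 volume := by
    refine (h2.const_mul (2 * Real.pi)).mono hmeas (.of_forall fun ξ => (hle ξ).trans (le_abs_self _))
  have hpd : complexify (partialDeriv j v) = 𝓕⁻ h := by
    ext1 x
    rw [complexify_partialDeriv (hd.differentiable one_ne_zero),
      complexify_eq_fourierInv hd.continuous hv hi, fderiv_fourierInv_apply hi hi']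
  have hae : (hL2.toLp h : Sp N → CSp N) =ᵐ[volume] h := hL2.coeFn_toLp
  have hfe : 𝓕⁻ (hL2.toLp h : Sp N → CSp N) = 𝓕⁻ h := by
    ext1 x; exact Real.fourierInv_congr_ae hae x
  have := fourierInv_Lp_ae_eq (hL2.toLp h) ((integrable_congr hae).2 hint)
  obtain ⟨h3, h4⟩ := toL2_eq_of_ae (v := partialDeriv j v) (𝓕⁻ (hL2.toLp h)) (by
    rw [hpd, ← hfe]; exact this.symm)
  refine ⟨h3, ?_, fun x => ?_⟩
  · rw [hat, h4, FourierTransform.fourier_fourierInv_eq]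
    exact hae
  · rw [← (inclusion (N := N)).norm_map, ← complexify_apply, hpd, Real.fourierInv_eq_fourier_neg]
    exact VectorFourier.norm_fourierIntegral_le_integral_norm _ _ _ _ _

/-- A `C^k` square integrable field whose Fourier transform has absolute moments of order `k`,
both in `L¹` and in `L²`. -/
structure HasMoments (k : ℕ) (v : Sp N → Sp N) : Prop where
  contDiff : ContDiff ℝ k v
  isL2 : IsL2 v
  integrable : Integrable fun ξ => (1 + ‖ξ‖) ^ k * ‖hat v ξ‖
  memLp : MemLp (fun ξ => (1 + ‖ξ‖) ^ k * ‖hat v ξ‖) 2 volume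

theorem hat_aestronglyMeasurable (v : Sp N → Sp N) : AEStronglyMeasurable (hat v) volume :=
  Lp.aestronglyMeasurable _

theorem HasMoments.integrable_of_le {k : ℕ} {v : Sp N → Sp N} (hv : HasMoments k v)
    {f : Sp N → ℝ} (hf : AEStronglyMeasurable f volume) {C : ℝ}
    (h : ∀ ξ, |f ξ| ≤ C * ((1 + ‖ξ‖) ^ k * ‖hat v ξ‖)) : Integrable f :=
  (hv.integrable.const_mul C).mono' hf (.of_forall h)

theorem HasMoments.memLp_of_le {k : ℕ} {v : Sp N → Sp N} (hv : HasMoments k v)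
    {f : Sp N → ℝ} (hf : AEStronglyMeasurable f volume) {C : ℝ}
    (h : ∀ ξ, |f ξ| ≤ C * ((1 + ‖ξ‖) ^ k * ‖hat v ξ‖)) : MemLp f 2 volume :=
  (hv.memLp.const_mul C).mono hf (.of_forall fun ξ => (h ξ).trans (le_abs_self _))

theorem HasMoments.mono {k l : ℕ} {v : Sp N → Sp N} (hv : HasMoments k v) (h : l ≤ k) :
    HasMoments l v := by
  have hm : AEStronglyMeasurable (fun ξ => (1 + ‖ξ‖) ^ l * ‖hat v ξ‖) volume :=
    (Continuous.aestronglyMeasurable (by fun_prop)).mul (hat_aestronglyMeasurable v).norm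
  have hle : ∀ ξ : Sp N, |(1 + ‖ξ‖) ^ l * ‖hat v ξ‖| ≤ 1 * ((1 + ‖ξ‖) ^ k * ‖hat v ξ‖) := fun ξ => by
    rw [abs_of_nonneg (by positivity), one_mul]
    gcongr
    simp
  exact ⟨hv.contDiff.of_le (by exact_mod_cast h), hv.isL2, hv.integrable_of_le hm hle,
    hv.memLp_of_le hm hle⟩

theorem HasMoments.integrable_hat {k : ℕ} {v : Sp N → Sp N} (hv : HasMoments k v) :
    Integrable (hat v) := by
  have := (hv.mono (Nat.zero_le k)).integrable
  simp only [pow_zero, one_mul] at this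
  exact (integrable_norm_iff (hat_aestronglyMeasurable v)).1 this

theorem HasMoments.partialDeriv_fourier {k : ℕ} {v : Sp N → Sp N} (hv : HasMoments (k + 1) v)
    (j : Fin N) : IsL2 (partialDeriv j v) ∧
      (hat (partialDeriv j v) =ᵐ[volume] fun ξ => ((2 * Real.pi * ξ j : ℝ) * Complex.I) • hat v ξ) ∧
      ∀ x, ‖partialDeriv j v x‖ ≤ ∫ ξ, ‖((2 * Real.pi * ξ j : ℝ) * Complex.I) • hat v ξ‖ := by
  have hv1 : HasMoments 1 v := hv.mono (by omega)
  have hm : AEStronglyMeasurable (fun ξ => ‖ξ‖ * ‖hat v ξ‖) volume :=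
    (Continuous.aestronglyMeasurable (by fun_prop)).mul (hat_aestronglyMeasurable v).norm
  have hle : ∀ ξ : Sp N, |‖ξ‖ * ‖hat v ξ‖| ≤ 1 * ((1 + ‖ξ‖) ^ 1 * ‖hat v ξ‖) := fun ξ => by
    rw [abs_of_nonneg (by positivity), one_mul, pow_one]
    gcongr
    linarith
  exact MHD.partialDeriv_fourier hv1.contDiff hv1.isL2 hv1.integrable_hat
    (hv1.integrable_of_le hm hle) (hv1.memLp_of_le hm hle) j

theorem HasMoments.partialDeriv {k : ℕ} {v : Sp N → Sp N} (hv : HasMoments (k + 1) v)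
    (j : Fin N) : HasMoments k (partialDeriv j v) := by
  obtain ⟨h1, h2, -⟩ := hv.partialDeriv_fourier j
  have hae : (fun ξ => (1 + ‖ξ‖) ^ k * ‖((2 * Real.pi * ξ j : ℝ) * Complex.I) • hat v ξ‖) =ᵐ[volume]
      fun ξ => (1 + ‖ξ‖) ^ k * ‖hat (MHD.partialDeriv j v) ξ‖ := by
    filter_upwards [h2] with ξ hξ
    rw [hξ]
  have hc : Continuous fun ξ : Sp N => ((2 * Real.pi * ξ j : ℝ) : ℂ) * Complex.I := by fun_prop
  have hm : AEStronglyMeasurable (fun ξ => (1 + ‖ξ‖) ^ k *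
      ‖((2 * Real.pi * ξ j : ℝ) * Complex.I) • hat v ξ‖) volume :=
    (Continuous.aestronglyMeasurable (by fun_prop)).mul
      (hc.aestronglyMeasurable.smul (hat_aestronglyMeasurable v)).norm
  have hle : ∀ ξ : Sp N, |(1 + ‖ξ‖) ^ k * ‖((2 * Real.pi * ξ j : ℝ) * Complex.I) • hat v ξ‖| ≤
      2 * Real.pi * ((1 + ‖ξ‖) ^ (k + 1) * ‖hat v ξ‖) := fun ξ => by
    rw [abs_of_nonneg (by positivity), norm_smul]
    have h3 : ‖((2 * Real.pi * ξ j : ℝ) : ℂ) * Complex.I‖ ≤ 2 * Real.pi * (1 + ‖ξ‖) := by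
      have := (PiLp.norm_apply_le ξ j).trans (le_add_of_nonneg_left zero_le_one)
      simpa [abs_of_pos Real.pi_pos] using mul_le_mul_of_nonneg_left this Real.two_pi_pos.le
    calc _ ≤ (1 + ‖ξ‖) ^ k * (2 * Real.pi * (1 + ‖ξ‖) * ‖hat v ξ‖) := by gcongr
      _ = _ := by ring
  refine ⟨?_, h1, (integrable_congr hae).1 (hv.integrable_of_le hm hle),
    (memLp_congr_ae hae).1 (hv.memLp_of_le hm hle)⟩
  have h4 : ContDiff ℝ k (fderiv ℝ v) := hv.contDiff.fderiv_right (by norm_cast)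
  exact h4.clm_apply contDiff_const

theorem HasMoments.norm_le {k : ℕ} {v : Sp N → Sp N} (hv : HasMoments k v) (x : Sp N) :
    ‖v x‖ ≤ ∫ ξ, ‖hat v ξ‖ := by
  rw [← (inclusion (N := N)).norm_map, ← complexify_apply,
    complexify_eq_fourierInv hv.contDiff.continuous hv.isL2 hv.integrable_hat,
    Real.fourierInv_eq_fourier_neg]
  exact VectorFourier.norm_fourierIntegral_le_integral_norm _ _ _ _ _

end Fields
end MHD

namespace MHD
open scoped SchwartzMap InnerProductSpace ContDiff

/-! ### Integration by parts and the nonlinear terms. -/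

section Physical
variable {N : ℕ}

theorem HasMoments.memLp_two {k : ℕ} {v : Sp N → Sp N} (hv : HasMoments k v) : MemLp v 2 volume :=
  isL2_iff.1 hv.isL2

theorem inner_toL2 {v w : Sp N → Sp N} (hv : IsL2 v) (hw : IsL2 w) :
    ⟪toL2 v, toL2 w⟫_ℂ = ((∫ x, ⟪v x, w x⟫_ℝ : ℝ) : ℂ) := by
  rw [L2.inner_def, ← integral_complex_ofReal]
  refine integral_congr_ae ?_
  filter_upwards [toL2_coe hv, toL2_coe hw] with x h1 h2
  rw [h1, h2, complexify_apply, complexify_apply, inner_inclusion]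

theorem integrable_inner_of_memLp {v w : Sp N → Sp N} (hv : MemLp v 2 volume)
    (hw : MemLp w 2 volume) : Integrable fun x => ⟪v x, w x⟫_ℝ := by
  have h := L2.integrable_inner (𝕜 := ℝ) (hv.toLp v) (hw.toLp w)
  refine (integrable_congr ?_).1 h
  filter_upwards [hv.coeFn_toLp, hw.coeFn_toLp] with x h1 h2
  rw [h1, h2]

theorem sum_smul_basisVec (y : Sp N) : ∑ j, y j • basisVec j = y := by
  have := (EuclideanSpace.basisFun (Fin N) ℝ).sum_repr y
  simpa [basisVec] using this

theorem convect_eq_sum (v w : Sp N → Sp N) (x : Sp N) :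
    convect v w x = ∑ j, v x j • partialDeriv j w x := by
  conv_lhs => rw [convect, ← sum_smul_basisVec (v x)]
  simp [partialDeriv]

/-- The pointwise Hilbert-Schmidt norm `|∇ w|(x)`. -/
noncomputable def gradNorm (w : Sp N → Sp N) (x : Sp N) : ℝ := √(∑ k, ‖partialDeriv k w x‖ ^ 2)

theorem gradNorm_nonneg (w : Sp N → Sp N) (x : Sp N) : 0 ≤ gradNorm w x := Real.sqrt_nonneg _

theorem norm_convect_le (v w : Sp N → Sp N) (x : Sp N) :
    ‖convect v w x‖ ≤ ‖v x‖ * gradNorm w x := by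
  rw [convect_eq_sum]
  calc ‖∑ j, v x j • partialDeriv j w x‖ ≤ ∑ j, ‖v x j‖ * ‖partialDeriv j w x‖ := by
        refine (norm_sum_le _ _).trans (Finset.sum_le_sum fun j _ => (norm_smul _ _).le)
    _ ≤ √(∑ j, ‖v x j‖ ^ 2) * √(∑ j, ‖partialDeriv j w x‖ ^ 2) :=
        Real.sum_mul_le_sqrt_mul_sqrt _ _ _
    _ = _ := by rw [EuclideanSpace.norm_eq, gradNorm]

theorem HasMoments.memLp_gradNorm {k : ℕ} {w : Sp N → Sp N} (hw : HasMoments (k + 1) w) :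
    MemLp (gradNorm w) 2 volume := by
  have hc : Continuous (gradNorm w) := by
    refine Real.continuous_sqrt.comp (continuous_finsetSum _ fun j _ => ?_)
    exact ((hw.partialDeriv j).contDiff.continuous.norm).pow 2
  refine MemLp.mono (g := fun x => ∑ j, ‖MHD.partialDeriv j w x‖)
    (memLp_finsetSum _ fun (j : Fin N) _ => (hw.partialDeriv j).memLp_two.norm) hc.aestronglyMeasurable
    (.of_forall fun x => ?_)
  rw [Real.norm_of_nonneg (gradNorm_nonneg _ _), Real.norm_of_nonneg (by positivity)]
  refine Real.sqrt_le_iff.2 ⟨by positivity, ?_⟩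
  exact Finset.sum_sq_le_sq_sum_of_nonneg fun i _ => norm_nonneg _

theorem continuous_convect {v w : Sp N → Sp N} (hv : Continuous v) (hw : ContDiff ℝ 1 w) :
    Continuous (convect v w) := (hw.continuous_fderiv one_ne_zero).clm_apply hv

theorem HasMoments.memLp_convect {k l : ℕ} {v w : Sp N → Sp N} (hv : HasMoments k v)
    (hw : HasMoments (l + 1) w) : MemLp (convect v w) 2 volume := by
  refine (hw.memLp_gradNorm.const_mul (∫ ξ, ‖hat v ξ‖)).mono
    (continuous_convect hv.contDiff.continuous
      (hw.mono (Nat.le_add_left 1 l)).contDiff).aestronglyMeasurable (.of_forall fun x => ?_)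
  refine (norm_convect_le v w x).trans (le_trans ?_ (le_abs_self _))
  exact mul_le_mul_of_nonneg_right (hv.norm_le x) (gradNorm_nonneg _ _)

theorem HasMoments.isL2_convect {k l : ℕ} {v w : Sp N → Sp N} (hv : HasMoments k v)
    (hw : HasMoments (l + 1) w) : IsL2 (convect v w) := isL2_iff.2 (hv.memLp_convect hw)

theorem integral_fderiv_apply_eq_zero {F : Sp N → ℝ} (hd : Differentiable ℝ F)
    (hi : Integrable F) (y : Sp N) (hi' : Integrable fun x => fderiv ℝ F x y) :
    ∫ x, fderiv ℝ F x y = 0 := by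
  have := integral_mul_fderiv_eq_neg_fderiv_mul_of_integrable (μ := (volume : Measure (Sp N)))
    (f := fun _ => (1 : ℝ)) (g := F) (v := y) (by simp) (by simpa using hi') (by simpa using hi)
    (fun x _ => by fun_prop) (fun x _ => hd x)
  simpa using this

/-- The integrand is the divergence of (a · c) v because div v = 0. This flux and its derivatives
are integrable: one factor is bounded and the other two are square integrable. -/
theorem integral_convect_add_eq_zero {v a c : Sp N → Sp N} (hv : HasMoments 1 v)
    (hdiv : ∀ x, div v x = 0) (ha : HasMoments 1 a) (hc : HasMoments 1 c) :
    (∫ x, ⟪convect v a x, c x⟫_ℝ) + ∫ x, ⟪a x, convect v c x⟫_ℝ = 0 := by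
  have hda := ha.contDiff.differentiable (by simp)
  have hdc := hc.contDiff.differentiable (by simp)
  have hdv := hv.contDiff.differentiable (by simp)
  have I0 := integrable_inner_of_memLp ha.memLp_two hc.memLp_two
  have I1 := integrable_inner_of_memLp (hv.memLp_convect ha) hc.memLp_two
  have I2 := integrable_inner_of_memLp ha.memLp_two (hv.memLp_convect hc)
  have I1' : ∀ j, Integrable fun x => ⟪partialDeriv j a x, c x⟫_ℝ := fun j =>
    integrable_inner_of_memLp (ha.partialDeriv j).memLp_two hc.memLp_two
  have I2' : ∀ j, Integrable fun x => ⟪a x, partialDeriv j c x⟫_ℝ := fun j =>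
    integrable_inner_of_memLp ha.memLp_two (hc.partialDeriv j).memLp_two
  have bdd : ∀ {w : Sp N → Sp N} {h : Sp N → ℝ} (j : Fin N), HasMoments 0 w → Integrable h →
      Integrable fun x => w x j * h x := fun {w h} j hw hh => by
    refine hh.bdd_mul (c := ∫ ξ, ‖hat w ξ‖) ?_ (.of_forall fun x => ?_)
    · have := hw.contDiff.continuous
      exact Continuous.aestronglyMeasurable (by fun_prop)
    · exact (PiLp.norm_apply_le (w x) j).trans (hw.norm_le x)
  set F : Fin N → Sp N → ℝ := fun j x => v x j * ⟪a x, c x⟫_ℝ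
  have hF : ∀ j x, HasFDerivAt (F j) (fderiv ℝ (F j) x) x ∧ fderiv ℝ (F j) x (basisVec j) =
      v x j * ⟪partialDeriv j a x, c x⟫_ℝ + v x j * ⟪a x, partialDeriv j c x⟫_ℝ
        + partialDeriv j v x j * ⟪a x, c x⟫_ℝ := fun j x => by
    have e1 := (EuclideanSpace.proj (𝕜 := ℝ) j).hasFDerivAt.comp x (hdv x).hasFDerivAt
    have e := e1.mul ((hda x).hasFDerivAt.inner ℝ (hdc x).hasFDerivAt)
    refine ⟨e.differentiableAt.hasFDerivAt, ?_⟩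
    rw [show fderiv ℝ (F j) x = _ from e.fderiv]
    simp [partialDeriv]
    ring
  have hz : ∀ j, ∫ x, fderiv ℝ (F j) x (basisVec j) = 0 := fun j => by
    refine integral_fderiv_apply_eq_zero (fun x => (hF j x).1.differentiableAt)
      (bdd j (hv.mono (by simp)) I0) _ ?_
    simp only [(hF j _).2]
    exact ((bdd j (hv.mono (by simp)) (I1' j)).add (bdd j (hv.mono (by simp)) (I2' j))).add
      (bdd j (hv.partialDeriv j) I0)
  have hI : ∀ j, Integrable fun x => fderiv ℝ (F j) x (basisVec j) := fun j => by
    simp only [(hF j _).2]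
    exact ((bdd j (hv.mono (by simp)) (I1' j)).add (bdd j (hv.mono (by simp)) (I2' j))).add
      (bdd j (hv.partialDeriv j) I0)
  rw [← integral_add I1 I2]
  calc _ = ∫ x, ∑ j, fderiv ℝ (F j) x (basisVec j) := by
        refine integral_congr_ae (.of_forall fun x => ?_)
        simp only [(hF _ _).2, Finset.sum_add_distrib, ← Finset.sum_mul]
        have : ∑ i, partialDeriv i v x i = 0 := hdiv x
        rw [this, convect_eq_sum, convect_eq_sum, sum_inner, inner_sum]
        simp [inner_smul_left, inner_smul_right]
    _ = 0 := by rw [integral_finsetSum _ fun j _ => hI j]; simp [hz]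

/-- The Laplacian of a vector field. -/
noncomputable def lap (w : Sp N → Sp N) (x : Sp N) : Sp N := ∑ k, partialDeriv k (partialDeriv k w) x

theorem HasMoments.memLp_lap {w : Sp N → Sp N} (hw : HasMoments 2 w) : MemLp (lap w) 2 volume :=
  memLp_finsetSum _ fun k _ => ((hw.partialDeriv k).partialDeriv k).memLp_two

/-- Only one derivative is asked of `f`, since the lemma is also applied to convective terms. -/
theorem integral_inner_lap {f z : Sp N → Sp N} (hf : ContDiff ℝ 1 f) (hf2 : MemLp f 2 volume)
    (hf' : ∀ k, MemLp (partialDeriv k f) 2 volume) (hz : HasMoments 2 z) :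
    ∫ x, ⟪f x, lap z x⟫_ℝ = -∫ x, ∑ k, ⟪partialDeriv k f x, partialDeriv k z x⟫_ℝ := by
  have h1 : ∀ k, Integrable fun x => ⟪f x, partialDeriv k (partialDeriv k z) x⟫_ℝ := fun k =>
    integrable_inner_of_memLp hf2 ((hz.partialDeriv k).partialDeriv k).memLp_two
  have h2 : ∀ k, Integrable fun x => ⟪partialDeriv k f x, partialDeriv k z x⟫_ℝ := fun k =>
    integrable_inner_of_memLp (hf' k) (hz.partialDeriv k).memLp_two
  simp only [lap, inner_sum]
  rw [integral_finsetSum _ fun k _ => h1 k, integral_finsetSum _ fun k _ => h2 k,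
    ← Finset.sum_neg_distrib]
  refine Finset.sum_congr rfl fun k _ => ?_
  exact integral_bilinear_fderiv_right_eq_neg_left_of_integrable (B := innerSL ℝ) (h2 k) (h1 k)
    (integrable_inner_of_memLp hf2 (hz.partialDeriv k).memLp_two)
    (fun x _ => hf.differentiable one_ne_zero x)
    (fun x _ => (hz.partialDeriv k).contDiff.differentiable (by simp) x)

theorem partialDeriv_convect {v w : Sp N → Sp N} (hv : ContDiff ℝ 1 v) (hw : ContDiff ℝ 2 w)
    (k : Fin N) (x : Sp N) : partialDeriv k (convect v w) x =
      convect (partialDeriv k v) w x + convect v (partialDeriv k w) x := by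
  have hw' : ContDiff ℝ 1 (fderiv ℝ w) := hw.fderiv_right (by norm_num)
  have hd : HasFDerivAt (fderiv ℝ w) (fderiv ℝ (fderiv ℝ w) x) x :=
    (hw'.differentiable one_ne_zero x).hasFDerivAt
  have e := hd.clm_apply (hv.differentiable one_ne_zero x).hasFDerivAt
  have e2 := hd.clm_apply (hasFDerivAt_const (basisVec k) x)
  have sym : IsSymmSndFDerivAt ℝ w x := hw.contDiffAt.isSymmSndFDerivAt (by simp)
  have e3 : fderiv ℝ (partialDeriv k w) x = _ := e2.fderiv
  have e4 : fderiv ℝ (convect v w) x = _ := e.fderiv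
  simp only [partialDeriv, e4]
  simp only [convect, e3]
  simp [sym.eq (basisVec k) (v x), partialDeriv]

/-- The density of `∑ₖ ((∂ₖ v · ∇) w) · ∂ₖ z`. -/
noncomputable def stretch (v w z : Sp N → Sp N) (x : Sp N) : ℝ :=
  ∑ k, ⟪convect (partialDeriv k v) w x, partialDeriv k z x⟫_ℝ

theorem abs_stretch_le (v w z : Sp N → Sp N) (x : Sp N) :
    |stretch v w z x| ≤ gradNorm v x * gradNorm w x * gradNorm z x := by
  calc |stretch v w z x| ≤ ∑ k, (‖partialDeriv k v x‖ * ‖partialDeriv k z x‖) * gradNorm w x := by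
        refine (Finset.abs_sum_le_sum_abs _ _).trans (Finset.sum_le_sum fun k _ => ?_)
        refine (abs_real_inner_le_norm _ _).trans ?_
        calc _ ≤ (‖partialDeriv k v x‖ * gradNorm w x) * ‖partialDeriv k z x‖ := by
              gcongr; exact norm_convect_le _ _ _
          _ = _ := by ring
    _ ≤ (gradNorm v x * gradNorm z x) * gradNorm w x := by
        rw [← Finset.sum_mul]
        gcongr
        · exact gradNorm_nonneg _ _
        · exact Real.sum_mul_le_sqrt_mul_sqrt _ _ _
    _ = _ := by ring

theorem HasMoments.integrable_stretch {v w z : Sp N → Sp N} (hv : HasMoments 2 v)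
    (hw : HasMoments 2 w) (hz : HasMoments 2 z) : Integrable (stretch v w z) :=
  integrable_finsetSum _ fun k _ => integrable_inner_of_memLp
    ((hv.partialDeriv k).memLp_convect hw) (hz.partialDeriv k).memLp_two

/-- `∑ₖ ∫ ((v · ∇) ∂ₖ w) · ∂ₖ z`. -/
noncomputable def transport (v w z : Sp N → Sp N) : ℝ :=
  ∫ x, ∑ k, ⟪convect v (partialDeriv k w) x, partialDeriv k z x⟫_ℝ

/-- One derivative of the Laplacian moves to the convective term and falls either on `v` or on ∇w.
The first part involves first derivatives alone; the second contains second derivatives of `w` and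
can only be removed by cancellation. -/
theorem integral_convect_lap {v w z : Sp N → Sp N} (hv : HasMoments 2 v)
    (hw : HasMoments 2 w) (hz : HasMoments 2 z) :
    ∫ x, ⟪convect v w x, lap z x⟫_ℝ = -(∫ x, stretch v w z x) - transport v w z := by
  have hv1 : HasMoments 1 v := hv.mono one_le_two
  have e : ∀ k x, partialDeriv k (convect v w) x =
      convect (partialDeriv k v) w x + convect v (partialDeriv k w) x :=
    partialDeriv_convect hv1.contDiff hw.contDiff
  have hc : ContDiff ℝ 1 (convect v w) :=
    (hw.contDiff.fderiv_right (m := 1) (by norm_num)).clm_apply hv1.contDiff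
  rw [integral_inner_lap hc (hv.memLp_convect hw) (fun k => ?_) hz]
  · simp only [e, inner_add_left, Finset.sum_add_distrib]
    rw [transport, ← neg_add', ← integral_add (hv.integrable_stretch hw hz)]
    · rfl
    · exact integrable_finsetSum _ fun k _ => integrable_inner_of_memLp
        (hv.memLp_convect (hw.partialDeriv k)) (hz.partialDeriv k).memLp_two
  · have : partialDeriv k (convect v w) =
      convect (partialDeriv k v) w + convect v (partialDeriv k w) := funext (e k)
    rw [this]
    exact ((hv.partialDeriv k).memLp_convect hw).add (hv.memLp_convect (hw.partialDeriv k))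

/-- Transport by a divergence free field is antisymmetric; apply this to each pair ∂ₖw, ∂ₖz. -/
theorem transport_add_eq_zero {v w z : Sp N → Sp N} (hv : HasMoments 2 v)
    (hdiv : ∀ x, div v x = 0) (hw : HasMoments 2 w) (hz : HasMoments 2 z) :
    transport v w z + transport v z w = 0 := by
  have I : ∀ {w z : Sp N → Sp N} (k : Fin N), HasMoments 2 w → HasMoments 2 z →
      Integrable fun x => ⟪convect v (partialDeriv k w) x, partialDeriv k z x⟫_ℝ :=
    fun k hw hz => integrable_inner_of_memLp
        (hv.memLp_convect (hw.partialDeriv k)) (hz.partialDeriv k).memLp_two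
  rw [transport, transport, integral_finsetSum _ fun k _ => I k hw hz,
    integral_finsetSum _ fun k _ => I k hz hw, ← Finset.sum_add_distrib]
  refine Finset.sum_eq_zero fun k _ => ?_
  have := integral_convect_add_eq_zero (hv.mono one_le_two) hdiv (hw.partialDeriv k)
    (hz.partialDeriv k)
  simpa only [real_inner_comm] using this

/-- The square of `‖∇ v‖_{L²}` as a real number. -/
noncomputable def gradSq (v : Sp N → Sp N) : ℝ := ∫ x, gradNorm v x ^ 2

/-- The nonlinear terms of the equation for `‖∇ u‖² + ‖∇ b‖²` lose no derivative. -/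
theorem abs_nonlinear_le {u b : Sp N → Sp N} (hu : HasMoments 2 u) (hb : HasMoments 2 b)
    (hdu : ∀ x, div u x = 0) (hdb : ∀ x, div b x = 0) {B : ℝ} (hB : ∀ x, gradNorm u x ≤ B) :
    |(∫ x, ⟪convect u u x, lap u x⟫_ℝ) - (∫ x, ⟪convect b b x, lap u x⟫_ℝ)
      + (∫ x, ⟪convect u b x, lap b x⟫_ℝ) - ∫ x, ⟪convect b u x, lap b x⟫_ℝ|
      ≤ 3 * B * (gradSq u + gradSq b) := by
  have iu := hu.memLp_gradNorm.integrable_sq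
  have ib := hb.memLp_gradNorm.integrable_sq
  have bound : ∀ {f : Sp N → ℝ} {v : Sp N → Sp N}, Integrable (fun x => gradNorm v x ^ 2) →
      (∀ x, |f x| ≤ B * gradNorm v x ^ 2) → |∫ x, f x| ≤ B * gradSq v := fun {f v} hi h => by
    rw [gradSq, ← integral_const_mul]
    exact norm_integral_le_of_norm_le (f := f) (hi.const_mul B) (.of_forall h)
  -- Each of the four stretching terms has a factor ∇u, to which the bound `B` is applied; no
  -- supremum of ∇b is needed.
  have b1 : |∫ x, stretch u u u x| ≤ B * gradSq u := bound iu fun x => by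
    refine (abs_stretch_le _ _ _ x).trans ?_
    nlinarith [mul_le_mul_of_nonneg_right (hB x) (sq_nonneg (gradNorm u x))]
  have b2 : |∫ x, stretch b b u x| ≤ B * gradSq b := bound ib fun x => by
    refine (abs_stretch_le _ _ _ x).trans ?_
    nlinarith [mul_le_mul_of_nonneg_right (hB x) (sq_nonneg (gradNorm b x))]
  have b3 : |∫ x, stretch u b b x| ≤ B * gradSq b := bound ib fun x => by
    refine (abs_stretch_le _ _ _ x).trans ?_
    nlinarith [mul_le_mul_of_nonneg_right (hB x) (sq_nonneg (gradNorm b x))]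
  have b4 : |∫ x, stretch b u b x| ≤ B * gradSq b := bound ib fun x => by
    refine (abs_stretch_le _ _ _ x).trans ?_
    nlinarith [mul_le_mul_of_nonneg_right (hB x) (sq_nonneg (gradNorm b x))]
  have hpos : 0 ≤ B * gradSq u := (abs_nonneg _).trans b1
  rw [integral_convect_lap hu hu hu, integral_convect_lap hb hb hu, integral_convect_lap hu hb hb,
    integral_convect_lap hb hu hb]
  -- `t1` and `t3` are self-cancellations. In `t2` the Lorentz force term of the momentum equation
  -- cancels against the stretching term of the induction equation.
  have t1 := transport_add_eq_zero hu hdu hu hu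
  have t2 := transport_add_eq_zero hb hdb hb hu
  have t3 := transport_add_eq_zero hu hdu hb hb
  rw [abs_le] at *
  constructor <;> linarith [b1.1, b1.2, b2.1, b2.2, b3.1, b3.2, b4.1, b4.2]

end Physical
end MHD

namespace MHD
open scoped SchwartzMap InnerProductSpace ContDiff LineDeriv ComplexConjugate

/-! ### The pressure gradient is orthogonal to divergence free fields. -/

section Pressure
variable {N : ℕ}

/-- As `p` is only C¹, the vanishing of the curl of ∇p is expressed weakly: both sides become minus
the integral of `p` against a mixed second derivative of `φ`, which is symmetric. -/
theorem integral_fderiv_mul_fderiv_symm_of_hasCompactSupport {φ p : Sp N → ℂ} (hφ : ContDiff ℝ 2 φ)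
    (hc : HasCompactSupport φ) (hp : ContDiff ℝ 1 p) (y z : Sp N) :
    ∫ x, fderiv ℝ φ x y * fderiv ℝ p x z = ∫ x, fderiv ℝ φ x z * fderiv ℝ p x y := by
  have h1 : ∀ w, ContDiff ℝ 1 fun x => fderiv ℝ φ x w := fun w =>
    (hφ.fderiv_right (m := 1) (by norm_num)).clm_apply contDiff_const
  have hs : ∀ w, HasCompactSupport fun x => fderiv ℝ φ x w := fun w => hc.fderiv_apply ℝ w
  have key : ∀ y z : Sp N, ∫ x, fderiv ℝ φ x y * fderiv ℝ p x z =
      -∫ x, fderiv ℝ (fun x => fderiv ℝ φ x y) x z * p x := fun y z => by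
    have hp' : Continuous fun x => fderiv ℝ p x z :=
      (hp.continuous_fderiv one_ne_zero).clm_apply continuous_const
    have hd : Continuous fun x => fderiv ℝ (fun x => fderiv ℝ φ x y) x z :=
      ((h1 y).continuous_fderiv one_ne_zero).clm_apply continuous_const
    refine integral_mul_fderiv_eq_neg_fderiv_mul_of_integrable ?_ ?_ ?_
      (fun x _ => (h1 y).differentiable one_ne_zero x) (fun x _ => hp.differentiable one_ne_zero x)
    · exact (hd.mul hp.continuous).integrable_of_hasCompactSupport
        (((hs y).fderiv_apply ℝ z).mul_right)
    · exact ((h1 y).continuous.mul hp').integrable_of_hasCompactSupport ((hs y).mul_right)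
    · exact ((h1 y).continuous.mul hp.continuous).integrable_of_hasCompactSupport ((hs y).mul_right)
  rw [key y z, key z y]
  congr 2
  ext x
  have hd : HasFDerivAt (fderiv ℝ φ) (fderiv ℝ (fderiv ℝ φ) x) x :=
    ((hφ.fderiv_right (m := 1) (by norm_num)).differentiable one_ne_zero x).hasFDerivAt
  have sym : IsSymmSndFDerivAt ℝ φ x := hφ.contDiffAt.isSymmSndFDerivAt (by simp)
  have e : ∀ w, fderiv ℝ (fun x => fderiv ℝ φ x w) x = _ := fun w =>
    (hd.clm_apply (hasFDerivAt_const w x)).fderiv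
  rw [e, e]
  simp [sym.eq y z]

/-- Smooth cut-off functions increasing to `1`. -/
theorem exists_cutoff (N : ℕ) : ∃ (χ : ℕ → Sp N → ℂ) (C : ℝ), (∀ n, ContDiff ℝ 2 (χ n)) ∧
    (∀ n, HasCompactSupport (χ n)) ∧ (∀ n x, ‖χ n x‖ ≤ 1) ∧
    (∀ n x w, ‖fderiv ℝ (χ n) x w‖ ≤ C * ‖w‖) ∧ (∀ x, Tendsto (fun n => χ n x) atTop (𝓝 1)) ∧
    ∀ x w, Tendsto (fun n => fderiv ℝ (χ n) x w) atTop (𝓝 0) := by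
  obtain ⟨f, hf, hfc, hfle, hf0⟩ : ∃ f : Sp N → ℂ, ContDiff ℝ 2 f ∧ HasCompactSupport f ∧
      (∀ x, ‖f x‖ ≤ 1) ∧ f 0 = 1 := by
    let f : ContDiffBump (0 : Sp N) := ⟨1, 2, one_pos, one_lt_two⟩
    refine ⟨fun x => ((f x : ℝ) : ℂ), Complex.ofRealCLM.contDiff.comp f.contDiff,
      f.hasCompactSupport.comp_left (g := Complex.ofReal) Complex.ofReal_zero, fun x => ?_, ?_⟩
    · rw [Complex.norm_real, Real.norm_of_nonneg f.nonneg]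
      exact f.le_one
    · have h3 : f 0 = 1 := f.one_of_mem_closedBall (by simp [f.rIn_pos.le])
      simp [h3]
  have hf' : Differentiable ℝ f := hf.differentiable two_ne_zero
  obtain ⟨C, hC⟩ : ∃ C, ∀ x, ‖fderiv ℝ f x‖ ≤ C :=
    (hfc.fderiv ℝ).exists_bound_of_continuous (hf.continuous_fderiv two_ne_zero)
  have hC0 : 0 ≤ C := (norm_nonneg _).trans (hC 0)
  have hχd : ∀ (n : ℕ) x w, fderiv ℝ (fun x => f ((n + 1 : ℝ)⁻¹ • x)) x w =
      (n + 1 : ℝ)⁻¹ • fderiv ℝ f ((n + 1 : ℝ)⁻¹ • x) w := fun n x w => by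
    have := (hf' ((n + 1 : ℝ)⁻¹ • x)).hasFDerivAt.comp x
      ((hasFDerivAt_id x).const_smul (n + 1 : ℝ)⁻¹)
    rw [show fderiv ℝ (fun x => f ((n + 1 : ℝ)⁻¹ • x)) x = _ from this.fderiv]
    simp
  have hχd0 : ∀ (n : ℕ) x w, ‖fderiv ℝ (fun x => f ((n + 1 : ℝ)⁻¹ • x)) x w‖ ≤
      (n + 1 : ℝ)⁻¹ * (C * ‖w‖) := fun n x w => by
    rw [hχd, norm_smul, Real.norm_of_nonneg (by positivity)]
    gcongr
    exact (ContinuousLinearMap.le_opNorm _ _).trans (by gcongr; exact hC _)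
  have hinv : Tendsto (fun n : ℕ => (n + 1 : ℝ)⁻¹) atTop (𝓝 0) := by
    simpa using tendsto_one_div_add_atTop_nhds_zero_nat (𝕜 := ℝ)
  -- The cut-offs are dilations of one bump function, so their gradients are bounded by C/(n + 1).
  refine ⟨fun n x => f ((n + 1 : ℝ)⁻¹ • x), C, fun n => hf.comp (contDiff_const_smul _), fun n => ?_,
    fun n x => hfle _, fun n x w => ?_, fun x => ?_, fun x w => ?_⟩
  · exact hfc.comp_homeomorph (Homeomorph.smulOfNeZero ((n + 1 : ℝ)⁻¹) (by positivity))
  · refine (hχd0 n x w).trans (mul_le_of_le_one_left (by positivity) ?_)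
    exact inv_le_one_of_one_le₀ (by simp)
  · have h1 : Tendsto (fun n : ℕ => (n + 1 : ℝ)⁻¹ • x) atTop (𝓝 0) := by
      simpa using hinv.smul_const x
    simpa [hf0, Function.comp_def] using (hf.continuous.tendsto 0).comp h1
  · refine squeeze_zero_norm (fun n => hχd0 n x w) ?_
    simpa using hinv.mul_const (C * ‖w‖)

/-- A gradient with square integrable components is weakly curl free against test functions
that need not have compact support. -/
theorem integral_fderiv_mul_fderiv_symm {φ p : Sp N → ℂ} (hφ : ContDiff ℝ 2 φ)
    (hp : ContDiff ℝ 1 p) (hφ0 : MemLp φ 2 volume)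
    (hφ1 : ∀ y, MemLp (fun x => fderiv ℝ φ x y) 2 volume)
    (hp1 : ∀ y, MemLp (fun x => fderiv ℝ p x y) 2 volume) (y z : Sp N) :
    ∫ x, fderiv ℝ φ x y * fderiv ℝ p x z = ∫ x, fderiv ℝ φ x z * fderiv ℝ p x y := by
  obtain ⟨χ, C, hχ, hχc, hχle, hχdle, hχ1, hχd1⟩ := exists_cutoff N
  have hprod : ∀ n x w, fderiv ℝ (fun x => χ n x * φ x) x w =
      χ n x * fderiv ℝ φ x w + φ x * fderiv ℝ (χ n) x w := fun n x w => by
    rw [fderiv_fun_mul ((hχ n).differentiable two_ne_zero x) (hφ.differentiable two_ne_zero x)]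
    simp
  have lim : ∀ y z : Sp N, Tendsto
      (fun n => ∫ x, fderiv ℝ (fun x => χ n x * φ x) x y * fderiv ℝ p x z) atTop
      (𝓝 (∫ x, fderiv ℝ φ x y * fderiv ℝ p x z)) := fun y z => by
    have i1 : Integrable fun x => fderiv ℝ φ x y * fderiv ℝ p x z := (hφ1 y).integrable_mul (hp1 z)
    have i2 : Integrable fun x => φ x * fderiv ℝ p x z := hφ0.integrable_mul (hp1 z)
    -- Only ∇p, not `p`, is square integrable. The cut-off therefore multiplies `φ`, and its
    -- gradient meets the integrable product of `φ` and ∇p.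
    refine tendsto_integral_of_dominated_convergence
      (fun x => ‖fderiv ℝ φ x y * fderiv ℝ p x z‖ + (C * ‖y‖) * ‖φ x * fderiv ℝ p x z‖)
      (fun n => ?_) (i1.norm.add (i2.norm.const_mul _)) (fun n => .of_forall fun x => ?_)
      (.of_forall fun x => ?_)
    · have : ContDiff ℝ 2 fun x => χ n x * φ x := (hχ n).mul hφ
      exact (((this.continuous_fderiv two_ne_zero).clm_apply continuous_const).mul
        ((hp.continuous_fderiv one_ne_zero).clm_apply continuous_const)).aestronglyMeasurable
    · rw [hprod, add_mul]
      refine (norm_add_le _ _).trans (add_le_add ?_ ?_)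
      · rw [mul_assoc, norm_mul]
        exact mul_le_of_le_one_left (norm_nonneg _) (hχle n x)
      · calc _ = ‖fderiv ℝ (χ n) x y‖ * ‖φ x * fderiv ℝ p x z‖ := by
              simp only [norm_mul]; ring
          _ ≤ _ := by gcongr; exact hχdle n x y
    · simp only [hprod]
      have := (((hχ1 x).mul_const (fderiv ℝ φ x y)).add ((hχd1 x y).const_mul (φ x))).mul_const
        (fderiv ℝ p x z)
      simpa using this
  refine tendsto_nhds_unique (lim y z) ?_
  simp_rw [fun n => integral_fderiv_mul_fderiv_symm_of_hasCompactSupport ((hχ n).mul hφ)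
    ((hχc n).mul_right) hp y z]
  exact lim z y

/-- Duality between an `L²` function and its Fourier transform. -/
theorem integral_smul_fourier {f : Lp (CSp N) 2 (volume : Measure (Sp N))} (ψ : 𝓢(Sp N, ℂ)) :
    ∫ ξ, ψ ξ • (𝓕 f : Lp (CSp N) 2 (volume : Measure (Sp N))) ξ = ∫ x, (𝓕 ψ) x • f x := by
  have h1 := congrArg (fun T : 𝓢'(Sp N, CSp N) => T ψ) (Lp.fourier_toTemperedDistribution_eq f)
  simpa only [TemperedDistribution.fourier_apply, Lp.toTemperedDistribution_apply] using h1.symm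

theorem integrable_schwartz_smul (f : Lp (CSp N) 2 (volume : Measure (Sp N))) (ψ : 𝓢(Sp N, ℂ)) :
    Integrable fun x => ψ x • f x :=
  memLp_one_iff_integrable.1 ((Lp.memLp f).smul (ψ.memLp 2 volume))

theorem euclidean_integral_apply {f : Sp N → CSp N} (hf : Integrable f) (i : Fin N) :
    (∫ x, f x) i = ∫ x, f x i :=
  ((EuclideanSpace.proj (𝕜 := ℂ) i).integral_comp_comm hf).symm

theorem ae_eq_zero_of_integral_schwartz {f : Sp N → ℂ} (hf : LocallyIntegrable f)
    (h : ∀ ψ : 𝓢(Sp N, ℂ), ∫ x, ψ x * f x = 0) : f =ᵐ[volume] 0 := by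
  refine ae_eq_zero_of_integral_contDiff_smul_eq_zero hf fun g hg hgc => ?_
  have hg₁ : HasCompactSupport (Complex.ofRealCLM ∘ g) := hgc.comp_left rfl
  have hg₂ : ContDiff ℝ ((⊤ : ℕ∞) : WithTop ℕ∞) (Complex.ofRealCLM ∘ g) :=
    Complex.ofRealCLM.contDiff.comp hg
  simpa using h (hg₁.toSchwartzMap hg₂)

/-- By duality with Schwartz functions the sum of the transforms of ∂ᵢuᵢ is tested on the physical
side, where it is the divergence; the constant 2πi is then divided out. -/
theorem hat_div {u : Sp N → Sp N} (hu : HasMoments 1 u) (hdiv : ∀ x, div u x = 0) :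
    ∀ᵐ ξ, ∑ i, (ξ i : ℂ) * hat u ξ i = 0 := by
  have hae : ∀ᵐ ξ, ∀ i, hat (partialDeriv i u) ξ = ((2 * Real.pi * ξ i : ℝ) * Complex.I) • hat u ξ :=
    ae_all_iff.2 fun i => (hu.partialDeriv_fourier i).2.1
  have hmem : ∀ i, MemLp (fun ξ => hat (partialDeriv i u) ξ i) 2 volume := fun i =>
    (Lp.memLp _).continuousLinearMap_comp (EuclideanSpace.proj (𝕜 := ℂ) i)
  have hz : (fun ξ => ∑ i, hat (partialDeriv i u) ξ i) =ᵐ[volume] 0 := by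
    refine ae_eq_zero_of_integral_schwartz
      ((memLp_finsetSum _ fun i _ => hmem i).locallyIntegrable (by norm_num)) fun ψ => ?_
    have e : ∀ i, ∫ ξ, ψ ξ * hat (partialDeriv i u) ξ i =
        ∫ x, (𝓕 ψ : 𝓢(Sp N, ℂ)) x * ((partialDeriv i u x i : ℝ) : ℂ) := fun i => by
      have h := congrArg (fun y : CSp N => y i) (integral_smul_fourier (f := toL2 (partialDeriv i u)) ψ)
      simp only at h
      rw [euclidean_integral_apply (integrable_schwartz_smul _ _),
        euclidean_integral_apply (integrable_schwartz_smul _ _)] at h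
      refine h.trans (integral_congr_ae ?_)
      filter_upwards [toL2_coe (hu.partialDeriv i).isL2] with x hx
      rw [hx]; rfl
    have i1 : ∀ i, Integrable fun ξ => ψ ξ * hat (partialDeriv i u) ξ i := fun i =>
      MemLp.integrable_mul (p := 2) (q := 2) (ψ.memLp 2 volume) (hmem i)
    have i2 : ∀ i, Integrable fun x => (𝓕 ψ : 𝓢(Sp N, ℂ)) x * ((partialDeriv i u x i : ℝ) : ℂ) := fun i => by
      refine MemLp.integrable_mul (p := 2) (q := 2) ((𝓕 ψ : 𝓢(Sp N, ℂ)).memLp 2 volume) ?_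
      exact (hu.partialDeriv i).isL2.continuousLinearMap_comp (EuclideanSpace.proj (𝕜 := ℂ) i)
    simp only [Finset.mul_sum]
    rw [integral_finsetSum _ fun i _ => i1 i]
    simp only [e]
    rw [← integral_finsetSum _ fun i _ => i2 i]
    refine integral_eq_zero_of_ae (.of_forall fun x => ?_)
    simp only [← Finset.mul_sum]
    have : ∑ i, partialDeriv i u x i = 0 := hdiv x
    rw [← Complex.ofReal_sum, this]
    simp
  filter_upwards [hz, hae] with ξ h1 h2
  simp only [h2, PiLp.smul_apply, smul_eq_mul, Pi.zero_apply] at h1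
  have h3 : (2 * Real.pi * Complex.I) * ∑ i, (ξ i : ℂ) * hat u ξ i = 0 := by
    rw [← h1, Finset.mul_sum]
    refine Finset.sum_congr rfl fun i _ => ?_
    push_cast; ring
  exact (mul_eq_zero.1 h3).resolve_left (by simp [Real.pi_ne_zero])

theorem gradient_apply {P : Sp N → ℝ} (x : Sp N) (i : Fin N) :
    gradient P x i = fderiv ℝ P x (basisVec i) := by
  have : ⟪gradient P x, basisVec i⟫_ℝ = fderiv ℝ P x (basisVec i) := by
    rw [gradient, InnerProductSpace.toDual_symm_apply]
  rw [← this, basisVec, EuclideanSpace.inner_single_right]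
  simp

/-- `P` may have no L² transform, so the symbol of the gradient cannot be applied to it. Instead
multiplication of a test function by ξⱼ becomes ∂ⱼ of its transform, and the weak symmetry of
`integral_fderiv_mul_fderiv_symm` exchanges the indices. -/
theorem hat_gradient {P : Sp N → ℝ} (hP : ContDiff ℝ 1 P) (hL : IsL2 (gradient P)) (i j : Fin N) :
    ∀ᵐ ξ, (ξ j : ℂ) * hat (gradient P) ξ i = (ξ i : ℂ) * hat (gradient P) ξ j := by
  set f := toL2 (gradient P)
  let p : Sp N → ℂ := fun x => ((P x : ℝ) : ℂ)
  have hp : ContDiff ℝ 1 p := Complex.ofRealCLM.contDiff.comp hP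
  have hpd : ∀ x k, fderiv ℝ p x (basisVec k) = ((gradient P x k : ℝ) : ℂ) := fun x k => by
    have := Complex.ofRealCLM.hasFDerivAt.comp x (hP.differentiable one_ne_zero x).hasFDerivAt
    rw [show fderiv ℝ p x = _ from this.fderiv, gradient_apply]
    rfl
  have hpb : ∀ k, MemLp (fun x => fderiv ℝ p x (basisVec k)) 2 volume := fun k => by
    simp only [hpd]
    exact hL.continuousLinearMap_comp (EuclideanSpace.proj (𝕜 := ℂ) k)
  have hp1 : ∀ y, MemLp (fun x => fderiv ℝ p x y) 2 volume := fun y => by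
    have : (fun x => fderiv ℝ p x y) = fun x => ∑ k, (y k : ℂ) * fderiv ℝ p x (basisVec k) := by
      ext x
      conv_lhs => rw [← sum_smul_basisVec y]
      simp
    rw [this]
    exact memLp_finsetSum _ fun k _ => (hpb k).const_mul _
  have hcoe : ∀ᵐ x, ∀ k, f x k = fderiv ℝ p x (basisVec k) := by
    filter_upwards [toL2_coe hL] with x hx k
    rw [hx, hpd]; rfl
  have key : ∀ (ψ : 𝓢(Sp N, ℂ)) (i j : Fin N),
      -(2 * Real.pi * Complex.I) * ∫ ξ, ψ ξ * ((ξ j : ℂ) * hat (gradient P) ξ i) =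
      ∫ x, fderiv ℝ (𝓕 ψ : 𝓢(Sp N, ℂ)) x (basisVec j) * fderiv ℝ p x (basisVec i) := by
    intro ψ i j
    -- `Θ` is chosen so that its Fourier transform is ∂ⱼ of the transform of `ψ`.
    set Θ : 𝓢(Sp N, ℂ) := -(2 * Real.pi * Complex.I) •
      SchwartzMap.smulLeftCLM ℂ (inner ℝ · (basisVec j : Sp N)) ψ with hΘ
    have hΘx : ∀ ξ, Θ ξ = -(2 * Real.pi * Complex.I) * ((ξ j : ℂ) * ψ ξ) := fun ξ => by
      have : (inner ℝ · (basisVec j : Sp N)).HasTemperateGrowth := by fun_prop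
      have h2 : ⟪ξ, (basisVec j : Sp N)⟫_ℝ = ξ j := by
        simp [basisVec, EuclideanSpace.inner_single_right]
      rw [hΘ, smul_apply, SchwartzMap.smulLeftCLM_apply_apply this, h2]
      simp
    have h := congrArg (fun y : CSp N => y i) (integral_smul_fourier (f := f) Θ)
    simp only at h
    rw [euclidean_integral_apply (integrable_schwartz_smul _ _),
      euclidean_integral_apply (integrable_schwartz_smul _ _),
      hΘ, ← SchwartzMap.lineDerivOp_fourier_eq, ← hΘ] at h
    rw [← integral_const_mul]
    refine Eq.trans (integral_congr_ae (.of_forall fun ξ => ?_)) (h.trans (integral_congr_ae ?_))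
    · simp only [hΘx, PiLp.smul_apply, smul_eq_mul]
      ring
    · filter_upwards [hcoe] with x hx
      rw [PiLp.smul_apply, hx, SchwartzMap.lineDerivOp_apply_eq_fderiv, smul_eq_mul]
  have hmem : ∀ i, MemLp (fun ξ => hat (gradient P) ξ i) 2 volume := fun i =>
    (Lp.memLp _).continuousLinearMap_comp (EuclideanSpace.proj (𝕜 := ℂ) i)
  have hloc : ∀ i j, LocallyIntegrable fun ξ : Sp N => (ξ j : ℂ) * hat (gradient P) ξ i := fun i j =>
    ((hmem i).locallyIntegrable (by norm_num)).continuous_mul (by fun_prop)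
  have hint : ∀ (ψ : 𝓢(Sp N, ℂ)) (i j : Fin N),
      Integrable fun ξ => ψ ξ * ((ξ j : ℂ) * hat (gradient P) ξ i) := fun ψ i j => by
    have h1 := ((SchwartzMap.smulLeftCLM ℂ (inner ℝ · (basisVec j : Sp N)) ψ).memLp 2
      volume).integrable_mul (hmem i)
    refine (integrable_congr (.of_forall fun ξ => ?_)).1 h1
    have : (inner ℝ · (basisVec j : Sp N)).HasTemperateGrowth := by fun_prop
    have h2 : ⟪ξ, (basisVec j : Sp N)⟫_ℝ = ξ j := by
      simp [basisVec, EuclideanSpace.inner_single_right]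
    simp only [Pi.mul_apply]
    rw [SchwartzMap.smulLeftCLM_apply_apply this, h2, Complex.real_smul]
    ring
  have hz : (fun ξ : Sp N => (ξ j : ℂ) * hat (gradient P) ξ i - (ξ i : ℂ) * hat (gradient P) ξ j)
      =ᵐ[volume] 0 := by
    refine ae_eq_zero_of_integral_schwartz ((hloc i j).sub (hloc j i)) fun ψ => ?_
    simp only [mul_sub]
    rw [integral_sub (hint ψ i j) (hint ψ j i), sub_eq_zero]
    have hc : -(2 * Real.pi * Complex.I) ≠ 0 := by simp [Real.pi_ne_zero]
    refine mul_left_cancel₀ hc ?_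
    rw [key, key]
    refine integral_fderiv_mul_fderiv_symm ((𝓕 ψ : 𝓢(Sp N, ℂ)).smooth 2) hp
      ((𝓕 ψ : 𝓢(Sp N, ℂ)).memLp 2 volume) (fun y => ?_) hp1 _ _
    exact (∂_{y} (𝓕 ψ : 𝓢(Sp N, ℂ))).memLp 2 volume
  filter_upwards [hz] with ξ h
  exact sub_eq_zero.1 h

/-- The transform of ∇P is parallel to ξ and that of `u` is orthogonal to ξ. To avoid dividing by a
coordinate, the inner product is multiplied by |ξ|², which is nonzero almost everywhere because N ≠
0. -/
theorem inner_hat_gradient {u : Sp N → Sp N} (hu : HasMoments 1 u) (hdiv : ∀ x, div u x = 0)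
    {P : Sp N → ℝ} (hP : ContDiff ℝ 1 P) (hL : IsL2 (gradient P)) (hN : N ≠ 0) :
    ∀ᵐ ξ, ⟪hat u ξ, hat (gradient P) ξ⟫_ℂ = 0 := by
  have h0 : ∀ᵐ ξ : Sp N, ξ ≠ 0 := by
    have : NeZero N := ⟨hN⟩
    have : Nontrivial (Sp N) := inferInstance
    exact Measure.ae_ne volume 0
  have h1 : ∀ᵐ ξ, ∀ i j, (ξ j : ℂ) * hat (gradient P) ξ i = (ξ i : ℂ) * hat (gradient P) ξ j :=
    ae_all_iff.2 fun i => ae_all_iff.2 fun j => hat_gradient hP hL i j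
  filter_upwards [h0, h1, hat_div hu hdiv] with ξ h0 h1 h2
  have h3 : ((‖ξ‖ ^ 2 : ℝ) : ℂ) * ⟪hat u ξ, hat (gradient P) ξ⟫_ℂ = 0 := by
    rw [EuclideanSpace.real_norm_sq_eq, PiLp.inner_apply]
    calc ((∑ j, ξ j ^ 2 : ℝ) : ℂ) * ∑ i, ⟪hat u ξ i, hat (gradient P) ξ i⟫_ℂ
        = ∑ i, ∑ j, (ξ j : ℂ) * conj (hat u ξ i) * ((ξ j : ℂ) * hat (gradient P) ξ i) := by
          push_cast
          rw [Finset.sum_mul_sum, Finset.sum_comm]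
          refine Finset.sum_congr rfl fun i _ => Finset.sum_congr rfl fun j _ => ?_
          rw [RCLike.inner_apply]
          ring
      _ = ∑ j, (ξ j : ℂ) * hat (gradient P) ξ j * conj (∑ i, (ξ i : ℂ) * hat u ξ i) := by
          rw [Finset.sum_comm]
          refine Finset.sum_congr rfl fun j _ => ?_
          rw [map_sum, Finset.mul_sum]
          refine Finset.sum_congr rfl fun i _ => ?_
          rw [h1 i j, map_mul, Complex.conj_ofReal]
          ring
      _ = 0 := by simp [h2]
  exact (mul_eq_zero.1 h3).resolve_left (by simpa using h0)

end Pressure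
end MHD

namespace MHD
open scoped SchwartzMap InnerProductSpace ContDiff

/-! ### Sobolev norms and the embedding into fields with Fourier moments. -/

section Sobolev
variable {N : ℕ}

theorem toL2_sub {v w : Sp N → Sp N} (hv : IsL2 v) (hw : IsL2 w) :
    toL2 (v - w) = toL2 v - toL2 w := by
  refine (toL2_eq_of_ae (v := v - w) _ ?_).2
  filter_upwards [Lp.coeFn_sub (toL2 v) (toL2 w), toL2_coe hv, toL2_coe hw] with x h1 h2 h3
  rw [h1, Pi.sub_apply, h2, h3]
  simp only [complexify_apply, Pi.sub_apply, map_sub]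

theorem toL2_finsetSum {ι : Type*} (s : Finset ι) {v : ι → Sp N → Sp N} (hv : ∀ i ∈ s, IsL2 (v i)) :
    toL2 (fun x => ∑ i ∈ s, v i x) = ∑ i ∈ s, toL2 (v i) := by
  refine (toL2_eq_of_ae (v := fun x => ∑ i ∈ s, v i x) _ ?_).2
  have h2 : ∀ᵐ x, ∀ i ∈ s, toL2 (v i) x = complexify (v i) x :=
    (ae_ball_iff s.countable_toSet).2 fun i hi => toL2_coe (hv i hi)
  filter_upwards [Lp.coeFn_finsetSum s (fun i => toL2 (v i)), h2] with x h1 h2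
  rw [h1, Finset.sum_apply, Finset.sum_congr rfl h2]
  simp only [complexify_apply, map_sum]

theorem hat_sub {v w : Sp N → Sp N} (hv : IsL2 v) (hw : IsL2 w) :
    hat (v - w) =ᵐ[volume] fun ξ => hat v ξ - hat w ξ := by
  have h : (𝓕 (toL2 v - toL2 w) : Lp (CSp N) 2 (volume : Measure (Sp N))) =
    𝓕 (toL2 v) - 𝓕 (toL2 w) := map_sub (Lp.fourierTransformₗᵢ (Sp N) (CSp N)) _ _
  rw [hat, toL2_sub hv hw, h]
  exact Lp.coeFn_sub _ _

theorem HasMoments.isL2_lap {w : Sp N → Sp N} (hw : HasMoments 2 w) : IsL2 (lap w) :=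
  isL2_iff.2 hw.memLp_lap

theorem HasMoments.hat_lap {w : Sp N → Sp N} (hw : HasMoments 2 w) :
    hat (lap w) =ᵐ[volume] fun ξ => (-(‖(2 * Real.pi) • ξ‖ ^ 2 : ℝ) : ℂ) • hat w ξ := by
  have h0 : (𝓕 (toL2 (lap w)) : Lp (CSp N) 2 (volume : Measure (Sp N))) =
      ∑ k, 𝓕 (toL2 (MHD.partialDeriv k (MHD.partialDeriv k w))) := by
    rw [show toL2 (lap w) = _ from toL2_finsetSum Finset.univ
      fun k _ => ((hw.partialDeriv k).partialDeriv k).isL2]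
    exact map_sum (Lp.fourierTransformₗᵢ (Sp N) (CSp N)) _ _
  have h1 : ∀ᵐ ξ, ∀ k, hat (MHD.partialDeriv k w) ξ = ((2 * Real.pi * ξ k : ℝ) * Complex.I) • hat w ξ :=
    ae_all_iff.2 fun k => (hw.partialDeriv_fourier k).2.1
  have h2 : ∀ᵐ ξ, ∀ k, hat (MHD.partialDeriv k (MHD.partialDeriv k w)) ξ =
      ((2 * Real.pi * ξ k : ℝ) * Complex.I) • hat (MHD.partialDeriv k w) ξ :=
    ae_all_iff.2 fun k => ((hw.partialDeriv k).partialDeriv_fourier k).2.1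
  have h3 := Lp.coeFn_finsetSum Finset.univ
    (fun k => (𝓕 (toL2 (MHD.partialDeriv k (MHD.partialDeriv k w))) : Lp (CSp N) 2 (volume : Measure (Sp N))))
  rw [hat, h0]
  filter_upwards [h1, h2, h3] with ξ h1 h2 h3
  rw [h3, Finset.sum_apply]
  simp only [h2, h1, smul_smul]
  rw [← Finset.sum_smul, norm_smul, Real.norm_of_nonneg Real.two_pi_pos.le, mul_pow,
    EuclideanSpace.real_norm_sq_eq]
  congr 1
  push_cast
  rw [Finset.mul_sum, ← Finset.sum_neg_distrib]
  refine Finset.sum_congr rfl fun k _ => ?_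
  linear_combination (2 * Real.pi * ξ k : ℂ) ^ 2 * Complex.I_sq

/-- The Japanese bracket of the angular frequency. -/
noncomputable def weight (s : ℝ) (ξ : Sp N) : ℝ := (1 + ‖(2 * Real.pi) • ξ‖ ^ 2) ^ s

theorem continuous_weight (s : ℝ) : Continuous (weight (N := N) s) := by
  refine Continuous.rpow_const (by fun_prop) fun ξ => Or.inl (by positivity)

theorem weight_pos (s : ℝ) (ξ : Sp N) : 0 < weight s ξ := Real.rpow_pos_of_pos (by positivity) _

theorem one_le_bracket (ξ : Sp N) : 1 ≤ 1 + ‖(2 * Real.pi) • ξ‖ ^ 2 := by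
  linarith [sq_nonneg ‖(2 * Real.pi) • ξ‖]

theorem half_sq_le_bracket (ξ : Sp N) : (1 + ‖ξ‖) ^ 2 / 2 ≤ 1 + ‖(2 * Real.pi) • ξ‖ ^ 2 := by
  have h : ‖ξ‖ ≤ ‖(2 * Real.pi) • ξ‖ := by
    rw [norm_smul, Real.norm_of_nonneg Real.two_pi_pos.le]
    exact le_mul_of_one_le_left (norm_nonneg _) (by linarith [Real.pi_gt_three])
  nlinarith [sq_nonneg (1 - ‖ξ‖), mul_self_le_mul_self (norm_nonneg ξ) h]

theorem sobolevNormSq_eq (s : ℝ) (v : Sp N → Sp N) :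
    sobolevNormSq s v = ∫⁻ ξ, ENNReal.ofReal (weight s ξ) * ‖hat v ξ‖ₑ ^ 2 := rfl

/-- Weighted `L²` integrals of the Fourier transform are controlled by Sobolev norms. -/
theorem lintegral_le_sobolevNormSq {s : ℝ} {v : Sp N → Sp N} {f : Sp N → ℝ≥0∞}
    (h : ∀ ξ, f ξ ≤ ENNReal.ofReal (weight s ξ)) :
    ∫⁻ ξ, f ξ * ‖hat v ξ‖ₑ ^ 2 ≤ sobolevNormSq s v := by
  rw [sobolevNormSq_eq]
  gcongr with ξ
  exact h ξ

theorem one_le_weight {s : ℝ} (hs : 0 ≤ s) (ξ : Sp N) : 1 ≤ weight s ξ :=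
  Real.one_le_rpow (one_le_bracket ξ) hs

theorem norm_sq_le_weight {s : ℝ} (hs : 1 ≤ s) (ξ : Sp N) : ‖(2 * Real.pi) • ξ‖ ^ 2 ≤ weight s ξ := by
  have h1 : weight 1 ξ ≤ weight s ξ := Real.rpow_le_rpow_of_exponent_le (one_le_bracket ξ) hs
  rw [weight, Real.rpow_one] at h1
  linarith

theorem norm_pow_four_le_weight {s : ℝ} (hs : 2 ≤ s) (ξ : Sp N) :
    (‖(2 * Real.pi) • ξ‖ ^ 2) ^ 2 ≤ weight s ξ := by
  have h1 : weight 2 ξ ≤ weight s ξ := Real.rpow_le_rpow_of_exponent_le (one_le_bracket ξ) hs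
  have h2 : weight 2 ξ = (1 + ‖(2 * Real.pi) • ξ‖ ^ 2) ^ 2 := by
    rw [weight]; exact Real.rpow_natCast _ 2
  rw [h2] at h1
  nlinarith [sq_nonneg ‖(2 * Real.pi) • ξ‖]

/-- Cauchy-Schwarz inequality for lower Lebesgue integrals. -/
theorem lintegral_mul_sq_le {α : Type*} [MeasurableSpace α] {μ : Measure α} {f g : α → ℝ≥0∞}
    (hf : AEMeasurable f μ) (hg : AEMeasurable g μ) :
    (∫⁻ x, f x * g x ∂μ) ^ 2 ≤ (∫⁻ x, f x ^ 2 ∂μ) * ∫⁻ x, g x ^ 2 ∂μ := by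
  have h := ENNReal.lintegral_mul_le_Lp_mul_Lq μ Real.HolderConjugate.two_two hf hg
  simp only [Pi.mul_apply, ENNReal.rpow_two] at h
  calc _ ≤ ((∫⁻ x, f x ^ 2 ∂μ) ^ (1 / (2 : ℝ)) * (∫⁻ x, g x ^ 2 ∂μ) ^ (1 / (2 : ℝ))) ^ 2 := by gcongr
    _ = _ := by
      rw [mul_pow, ← ENNReal.rpow_two, ← ENNReal.rpow_two, ← ENNReal.rpow_mul, ← ENNReal.rpow_mul]
      norm_num

theorem hat_enorm_aemeasurable (v : Sp N → Sp N) : AEMeasurable (fun ξ => ‖hat v ξ‖ₑ) volume :=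
  (hat_aestronglyMeasurable v).enorm

/-- Powers of the weight are summable enough for the Sobolev embedding. -/
theorem lintegral_pow_div_weight_lt_top {s : ℝ} (hs : 3 + (N : ℝ) ≤ s) :
    ∫⁻ ξ : Sp N, ENNReal.ofReal ((1 + ‖ξ‖) ^ 4 / weight s ξ) < ⊤ := by
  -- From s ≥ 3 + N one gets 2s - 4 ≥ 2N + 2 > N, beyond the threshold of integrability.
  have hi : Integrable (fun ξ : Sp N => (2 : ℝ) ^ s * (1 + ‖ξ‖) ^ (-(2 * s - 4))) := by
    refine (integrable_one_add_norm ?_).const_mul _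
    simp only [finrank_euclideanSpace, Fintype.card_fin]
    have : (0 : ℝ) ≤ N := Nat.cast_nonneg N
    linarith
  refine lt_of_le_of_lt (lintegral_mono fun ξ => ENNReal.ofReal_le_ofReal ?_) hi.lintegral_lt_top
  have h0 : (0 : ℝ) < 1 + ‖ξ‖ := by positivity
  have h1 : ((1 + ‖ξ‖) ^ 2 / 2) ^ s ≤ weight s ξ :=
    Real.rpow_le_rpow (by positivity) (half_sq_le_bracket ξ) (by
      have : (0 : ℝ) ≤ N := Nat.cast_nonneg N
      linarith)
  rw [Real.div_rpow (by positivity) (by positivity), ← Real.rpow_natCast, ← Real.rpow_mul h0.le] at h1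
  rw [div_le_iff₀ (weight_pos s ξ)]
  calc (1 + ‖ξ‖) ^ 4 = (2 : ℝ) ^ s * (1 + ‖ξ‖) ^ (-(2 * s - 4)) *
        ((1 + ‖ξ‖) ^ (((2 : ℕ) : ℝ) * s) / 2 ^ s) := by
        have h2 : (0 : ℝ) < 2 ^ s := by positivity
        have h3 : (1 + ‖ξ‖) ^ (-(2 * s - 4)) * (1 + ‖ξ‖) ^ (((2 : ℕ) : ℝ) * s) = (1 + ‖ξ‖) ^ 4 := by
          rw [← Real.rpow_add h0, ← Real.rpow_natCast]
          congr 1; push_cast; ring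
        rw [← h3]; field_simp
    _ ≤ _ := by gcongr

/-- Cauchy-Schwarz, after multiplying and dividing by the square root of the weight. -/
theorem sobolev_L1_bound (s : ℝ) (v : Sp N → Sp N) :
    (∫⁻ ξ, ENNReal.ofReal ((1 + ‖ξ‖) ^ 2) * ‖hat v ξ‖ₑ) ^ 2 ≤
      (∫⁻ ξ : Sp N, ENNReal.ofReal ((1 + ‖ξ‖) ^ 4 / weight s ξ)) * sobolevNormSq s v := by
  have hw : Continuous fun ξ : Sp N => √(weight s ξ) := (continuous_weight s).sqrt
  have hw0 : ∀ ξ : Sp N, 0 < √(weight s ξ) := fun ξ => Real.sqrt_pos.2 (weight_pos s ξ)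
  have hm1 : AEMeasurable (fun ξ : Sp N => ENNReal.ofReal ((1 + ‖ξ‖) ^ 2 / √(weight s ξ))) volume := by
    have : Continuous fun ξ : Sp N => (1 + ‖ξ‖) ^ 2 / √(weight s ξ) :=
      Continuous.div (by fun_prop) hw fun ξ => (hw0 ξ).ne'
    exact this.measurable.ennreal_ofReal.aemeasurable
  have hm2 : AEMeasurable (fun ξ : Sp N => ENNReal.ofReal √(weight s ξ) * ‖hat v ξ‖ₑ) volume :=
    hw.measurable.ennreal_ofReal.aemeasurable.mul (hat_enorm_aemeasurable v)
  have := lintegral_mul_sq_le hm1 hm2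
  refine le_trans (le_of_eq ?_) (this.trans (le_of_eq ?_))
  · congr 1
    refine lintegral_congr fun ξ => ?_
    rw [← mul_assoc, ← ENNReal.ofReal_mul (by positivity), div_mul_cancel₀ _ (hw0 ξ).ne']
  · congr 1
    · refine lintegral_congr fun ξ => ?_
      rw [← ENNReal.ofReal_pow (by positivity), div_pow, Real.sq_sqrt (weight_pos s ξ).le]
      ring_nf
    · rw [sobolevNormSq_eq]
      refine lintegral_congr fun ξ => ?_
      rw [mul_pow, ← ENNReal.ofReal_pow (by positivity), Real.sq_sqrt (weight_pos s ξ).le]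

/-- The L¹ moment is `sobolev_L1_bound`; the L² moment only needs s ≥ 2, as (1 + |ξ|)⁴ is at most
four times the weight. -/
theorem hasMoments_of_sobolev {s : ℝ} (hs : 3 + (N : ℝ) ≤ s) {v : Sp N → Sp N}
    (hc : ContDiff ℝ 2 v) (hv : IsL2 v) (hf : sobolevNormSq s v < ⊤) : HasMoments 2 v := by
  have hm : AEStronglyMeasurable (fun ξ => (1 + ‖ξ‖) ^ 2 * ‖hat v ξ‖) volume :=
    (Continuous.aestronglyMeasurable (by fun_prop)).mul (hat_aestronglyMeasurable v).norm
  have hs0 : 0 ≤ s := by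
    have : (0 : ℝ) ≤ N := Nat.cast_nonneg N
    linarith
  have he : ∀ ξ, ‖(1 + ‖ξ‖) ^ 2 * ‖hat v ξ‖‖ₑ = ENNReal.ofReal ((1 + ‖ξ‖) ^ 2) * ‖hat v ξ‖ₑ := fun ξ => by
    rw [enorm_mul, enorm_norm, Real.enorm_of_nonneg (by positivity)]
  refine ⟨hc, hv, ⟨hm, ?_⟩, hm, ?_⟩
  · rw [HasFiniteIntegral]
    simp only [he]
    have h1 := (sobolev_L1_bound s v).trans_lt
      (ENNReal.mul_lt_top (lintegral_pow_div_weight_lt_top hs) hf)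
    exact (ENNReal.pow_lt_top_iff.1 h1).resolve_right two_ne_zero
  · rw [eLpNorm_lt_top_iff_lintegral_rpow_enorm_lt_top two_ne_zero ENNReal.ofNat_ne_top]
    simp only [he, ENNReal.toReal_ofNat, ENNReal.rpow_two, mul_pow]
    have h4 : ∀ ξ : Sp N, ENNReal.ofReal ((1 + ‖ξ‖) ^ 2) ^ 2 ≤ 4 * ENNReal.ofReal (weight s ξ) := fun ξ => by
      rw [← ENNReal.ofReal_pow (by positivity), show (4 : ℝ≥0∞) = ENNReal.ofReal 4 by simp,
        ← ENNReal.ofReal_mul (by norm_num)]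
      refine ENNReal.ofReal_le_ofReal ?_
      have h1 : weight 2 ξ ≤ weight s ξ := Real.rpow_le_rpow_of_exponent_le (one_le_bracket ξ) (by
        have : (0 : ℝ) ≤ N := Nat.cast_nonneg N
        linarith)
      have h2 : weight 2 ξ = (1 + ‖(2 * Real.pi) • ξ‖ ^ 2) ^ 2 := by
        rw [weight]; exact Real.rpow_natCast _ 2
      have h3 := half_sq_le_bracket ξ
      nlinarith [sq_nonneg (1 + ‖ξ‖)]
    calc _ ≤ ∫⁻ ξ, 4 * (ENNReal.ofReal (weight s ξ) * ‖hat v ξ‖ₑ ^ 2) := by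
          refine lintegral_mono fun ξ => ?_
          simp only
          rw [← mul_assoc]
          gcongr
          exact h4 ξ
      _ = 4 * sobolevNormSq s v := by rw [lintegral_const_mul' _ _ (by simp)]; rfl
      _ < ⊤ := ENNReal.mul_lt_top (by simp) hf

end Sobolev
end MHD

namespace MHD
open scoped SchwartzMap InnerProductSpace ContDiff

/-! ### Energies and dissipation rates as L² inner products. -/

section Energy
variable {N : ℕ}

/-- `∫ |ξ| |v̂(ξ)| dξ`, with `ξ` the angular frequency. -/
noncomputable def freqL1 (v : Sp N → Sp N) : ℝ≥0∞ := ∫⁻ ξ, ‖(2 * Real.pi) • ξ‖ₑ * ‖hat v ξ‖ₑ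

/-- `‖m(D) v‖²`. -/
noncomputable def dissip (m : Sp N → ℝ) (v : Sp N → Sp N) : ℝ≥0∞ :=
  ∫⁻ ξ, ‖m ((2 * Real.pi) • ξ)‖ₑ ^ 2 * ‖hat v ξ‖ₑ ^ 2

theorem freqL1_le (v : Sp N → Sp N) :
    freqL1 v ≤ ENNReal.ofReal (2 * Real.pi) * ∫⁻ ξ, ENNReal.ofReal ((1 + ‖ξ‖) ^ 2) * ‖hat v ξ‖ₑ := by
  rw [← lintegral_const_mul' _ _ ENNReal.ofReal_ne_top]
  refine lintegral_mono fun ξ => ?_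
  simp only
  rw [← mul_assoc, ← ENNReal.ofReal_mul Real.two_pi_pos.le]
  gcongr
  rw [← ofReal_norm, norm_smul, Real.norm_of_nonneg Real.two_pi_pos.le]
  refine ENNReal.ofReal_le_ofReal (mul_le_mul_of_nonneg_left ?_ Real.two_pi_pos.le)
  nlinarith [norm_nonneg ξ]

theorem freqL1_sq_le (s : ℝ) (v : Sp N → Sp N) : freqL1 v ^ 2 ≤ ENNReal.ofReal (2 * Real.pi) ^ 2 *
    ((∫⁻ ξ : Sp N, ENNReal.ofReal ((1 + ‖ξ‖) ^ 4 / weight s ξ)) * sobolevNormSq s v) := by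
  calc freqL1 v ^ 2 ≤ (ENNReal.ofReal (2 * Real.pi) *
        ∫⁻ ξ, ENNReal.ofReal ((1 + ‖ξ‖) ^ 2) * ‖hat v ξ‖ₑ) ^ 2 := by gcongr; exact freqL1_le v
    _ ≤ _ := by
      rw [mul_pow]
      gcongr
      exact sobolev_L1_bound s v

theorem HasMoments.freqL1_lt_top {v : Sp N → Sp N} (hv : HasMoments 2 v) : freqL1 v < ⊤ := by
  refine (freqL1_le v).trans_lt (ENNReal.mul_lt_top ENNReal.ofReal_lt_top ?_)
  have := hv.integrable.2
  rw [HasFiniteIntegral] at this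
  refine lt_of_le_of_lt (le_of_eq (lintegral_congr fun ξ => ?_)) this
  rw [enorm_mul, enorm_norm, Real.enorm_of_nonneg (by positivity)]

/-- Each ∂ₖv is bounded by the L¹ norm of its transform; the factor N comes from replacing the
Euclidean norm of the N derivatives by their sum. -/
theorem HasMoments.gradNorm_le {v : Sp N → Sp N} (hv : HasMoments 2 v) (x : Sp N) :
    gradNorm v x ≤ N * (freqL1 v).toReal := by
  have h1 : ∀ k, ‖MHD.partialDeriv k v x‖ ≤ (freqL1 v).toReal := fun k => by
    refine ((hv.partialDeriv_fourier k).2.2 x).trans ?_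
    have hc : Continuous fun ξ : Sp N => ((2 * Real.pi * ξ k : ℝ) : ℂ) * Complex.I := by fun_prop
    refine (integral_norm_eq_lintegral_enorm
      (hc.aestronglyMeasurable.smul (hat_aestronglyMeasurable v))).trans_le ?_
    refine ENNReal.toReal_mono hv.freqL1_lt_top.ne (lintegral_mono fun ξ => ?_)
    rw [Pi.smul_apply', enorm_smul]
    refine mul_le_mul_left ?_ _
    rw [← ofReal_norm, ← ofReal_norm]
    refine ENNReal.ofReal_le_ofReal ?_
    have := PiLp.norm_apply_le ξ k
    rw [norm_smul]
    simpa [abs_of_pos Real.pi_pos] using mul_le_mul_of_nonneg_left this Real.two_pi_pos.le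
  calc gradNorm v x ≤ ∑ k, ‖MHD.partialDeriv k v x‖ := by
        refine Real.sqrt_le_iff.2 ⟨by positivity, ?_⟩
        exact Finset.sum_sq_le_sq_sum_of_nonneg fun i _ => norm_nonneg _
    _ ≤ ∑ _k : Fin N, (freqL1 v).toReal := Finset.sum_le_sum fun k _ => h1 k
    _ = _ := by simp

theorem lintegral_enorm_sq_fourier (f : Lp (CSp N) 2 (volume : Measure (Sp N))) :
    ∫⁻ ξ, ‖(𝓕 f : Lp (CSp N) 2 (volume : Measure (Sp N))) ξ‖ₑ ^ 2 = ∫⁻ x, ‖f x‖ₑ ^ 2 := by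
  have h : ∀ g : Lp (CSp N) 2 (volume : Measure (Sp N)),
      ∫⁻ x, ‖g x‖ₑ ^ 2 = eLpNorm g 2 volume ^ 2 := fun g => by
    have := eLpNorm_nnreal_pow_eq_lintegral (p := 2) (f := g) (μ := (volume : Measure (Sp N)))
      two_ne_zero
    simpa using this.symm
  rw [h, h, ← Lp.enorm_def, ← Lp.enorm_def, ← ofReal_norm, Lp.norm_fourier_eq,
    ofReal_norm]

theorem lintegral_enorm_sq_hat {v : Sp N → Sp N} (hv : IsL2 v) :
    ∫⁻ ξ, ‖hat v ξ‖ₑ ^ 2 = ∫⁻ x, ‖v x‖ₑ ^ 2 := by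
  rw [lintegral_enorm_sq_fourier]
  refine lintegral_congr_ae ?_
  filter_upwards [toL2_coe hv] with x hx
  rw [hx, complexify_apply, ← ofReal_norm, LinearIsometry.norm_map, ofReal_norm]

theorem sum_enorm_sq (ξ : Sp N) (z : CSp N) :
    ∑ j, ‖((2 * Real.pi * ξ j : ℝ) * Complex.I) • z‖ₑ ^ 2 = ‖(2 * Real.pi) • ξ‖ₑ ^ 2 * ‖z‖ₑ ^ 2 := by
  have h : ∀ {E : Type} [NormedAddCommGroup E] (w : E), ‖w‖ₑ ^ 2 = ENNReal.ofReal (‖w‖ ^ 2) :=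
    fun w => by rw [← ofReal_norm, ENNReal.ofReal_pow (norm_nonneg _)]
  simp only [h]
  rw [← ENNReal.ofReal_sum_of_nonneg fun _ _ => by positivity, ← ENNReal.ofReal_mul (by positivity)]
  congr 1
  simp only [norm_smul, mul_pow, ← Finset.sum_mul, EuclideanSpace.real_norm_sq_eq ξ,
    Finset.mul_sum]
  congr 1
  refine Finset.sum_congr rfl fun j _ => ?_
  simp [mul_pow]

theorem HasMoments.multGradNormSq_eq {k : ℕ} {v : Sp N → Sp N} (hv : HasMoments (k + 1) v)
    {m : Sp N → ℝ} (hm : Measurable m) : multGradNormSq m v =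
      ∫⁻ ξ, ‖m ((2 * Real.pi) • ξ)‖ₑ ^ 2 * (‖(2 * Real.pi) • ξ‖ₑ ^ 2 * ‖hat v ξ‖ₑ ^ 2) := by
  have hm' : Measurable fun ξ : Sp N => ‖m ((2 * Real.pi) • ξ)‖ₑ ^ 2 :=
    ((hm.comp (measurable_const_smul _)).enorm).pow_const 2
  have h1 : ∀ᵐ ξ, ∀ k, hat (MHD.partialDeriv k v) ξ = ((2 * Real.pi * ξ k : ℝ) * Complex.I) • hat v ξ :=
    ae_all_iff.2 fun k => (hv.partialDeriv_fourier k).2.1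
  rw [multGradNormSq, ← lintegral_finsetSum']
  · refine lintegral_congr_ae ?_
    filter_upwards [h1] with ξ h1
    rw [← sum_enorm_sq, Finset.mul_sum]
    refine Finset.sum_congr rfl fun j _ => ?_
    rw [enorm_smul, mul_pow, ← h1 j]
    congr 2
    simp [enorm]
  · intro j _
    simp only [enorm_smul, mul_pow]
    refine AEMeasurable.mul (?_ : AEMeasurable _ _) ((hat_enorm_aemeasurable _).pow_const 2)
    have := Complex.measurable_ofReal.comp (hm.comp (measurable_const_smul (2 * Real.pi)))
    exact (this.enorm.pow_const 2).aemeasurable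

theorem HasMoments.gradNormSq_eq {k : ℕ} {v : Sp N → Sp N} (hv : HasMoments (k + 1) v) :
    gradNormSq v = ENNReal.ofReal (gradSq v) := by
  rw [gradSq, ofReal_integral_eq_lintegral_ofReal hv.memLp_gradNorm.integrable_sq
    (.of_forall fun x => sq_nonneg _), gradNormSq, ← lintegral_finsetSum]
  · refine lintegral_congr fun x => ?_
    rw [gradNorm, Real.sq_sqrt (by positivity), ENNReal.ofReal_sum_of_nonneg fun _ _ => by positivity]
    refine Finset.sum_congr rfl fun j _ => ?_
    rw [ENNReal.ofReal_pow (norm_nonneg _), ofReal_norm]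
  · intro j _
    exact ((hv.partialDeriv j).contDiff.continuous.measurable.enorm).pow_const 2

theorem gradSq_nonneg (v : Sp N → Sp N) : 0 ≤ gradSq v := integral_nonneg fun _ => sq_nonneg _

theorem HasMoments.gradSq_le_sobolev {v : Sp N → Sp N} (hv : HasMoments 2 v) {s : ℝ} (hs : 1 ≤ s) :
    ENNReal.ofReal (gradSq v) ≤ sobolevNormSq s v := by
  have h1 : ∀ᵐ ξ, ∀ k, hat (MHD.partialDeriv k v) ξ = ((2 * Real.pi * ξ k : ℝ) * Complex.I) • hat v ξ :=
    ae_all_iff.2 fun k => (hv.partialDeriv_fourier k).2.1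
  rw [← hv.gradNormSq_eq, gradNormSq]
  simp only [← lintegral_enorm_sq_hat (hv.partialDeriv _).isL2]
  rw [← lintegral_finsetSum' _ fun j _ => (hat_enorm_aemeasurable _).pow_const 2]
  refine le_trans (le_of_eq (lintegral_congr_ae ?_)) (lintegral_le_sobolevNormSq
    (f := fun ξ => ‖(2 * Real.pi) • ξ‖ₑ ^ 2) fun ξ => ?_)
  · filter_upwards [h1] with ξ h1
    simp only [h1]
    exact sum_enorm_sq _ _
  · rw [← ofReal_norm, ← ENNReal.ofReal_pow (norm_nonneg _)]
    exact ENNReal.ofReal_le_ofReal (norm_sq_le_weight hs ξ)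

theorem HasMoments.inner_lap {v w : Sp N → Sp N} (hv : HasMoments 2 v) (hw : HasMoments 2 w) :
    (⟪toL2 v, toL2 (lap w)⟫_ℂ).re = -∫ x, ∑ k, ⟪MHD.partialDeriv k v x, MHD.partialDeriv k w x⟫_ℝ := by
  rw [inner_toL2 hv.isL2 hw.isL2_lap, Complex.ofReal_re, integral_inner_lap
    (hv.mono one_le_two).contDiff hv.memLp_two (fun k => (hv.partialDeriv k).memLp_two) hw]

/-- This form can be differentiated in time although ∂ₜv is only known in L²: the pairing with Δv
requires no spatial derivative of ∂ₜv. -/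
theorem HasMoments.gradSq_eq {v : Sp N → Sp N} (hv : HasMoments 2 v) :
    gradSq v = -(⟪toL2 v, toL2 (lap v)⟫_ℂ).re := by
  rw [hv.inner_lap hv, neg_neg, gradSq]
  refine integral_congr_ae (.of_forall fun x => ?_)
  simp only [gradNorm, real_inner_self_eq_norm_sq]
  exact Real.sq_sqrt (by positivity)

theorem re_inner_eq_integral (f g : Lp (CSp N) 2 (volume : Measure (Sp N))) :
    (⟪f, g⟫_ℂ).re = ∫ ξ, (⟪(𝓕 f : Lp (CSp N) 2 (volume : Measure (Sp N))) ξ,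
      (𝓕 g : Lp (CSp N) 2 (volume : Measure (Sp N))) ξ⟫_ℂ).re ∧
    Integrable fun ξ => (⟪(𝓕 f : Lp (CSp N) 2 (volume : Measure (Sp N))) ξ,
      (𝓕 g : Lp (CSp N) 2 (volume : Measure (Sp N))) ξ⟫_ℂ).re := by
  have hi := L2.integrable_inner (𝕜 := ℂ) (𝓕 f : Lp (CSp N) 2 (volume : Measure (Sp N)))
    (𝓕 g : Lp (CSp N) 2 (volume : Measure (Sp N)))
  refine ⟨?_, hi.re⟩
  rw [← Lp.inner_fourier_eq, L2.inner_def]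
  exact (integral_re hi).symm

theorem ofReal_re_inner_eq_lintegral {f g : Lp (CSp N) 2 (volume : Measure (Sp N))} {h : Sp N → ℝ}
    (h0 : ∀ ξ, 0 ≤ h ξ) (hh : ∀ᵐ ξ, (⟪(𝓕 f : Lp (CSp N) 2 (volume : Measure (Sp N))) ξ,
      (𝓕 g : Lp (CSp N) 2 (volume : Measure (Sp N))) ξ⟫_ℂ).re = h ξ) :
    0 ≤ (⟪f, g⟫_ℂ).re ∧ ENNReal.ofReal (⟪f, g⟫_ℂ).re = ∫⁻ ξ, ENNReal.ofReal (h ξ) := by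
  obtain ⟨h1, h2⟩ := re_inner_eq_integral f g
  rw [h1, integral_congr_ae hh]
  exact ⟨integral_nonneg h0, ofReal_integral_eq_lintegral_ofReal ((integrable_congr hh).1 h2)
    (.of_forall h0)⟩

/-- Plancherel. Since m(D)²u is in L², the dissipation rate is finite without further assumptions.
-/
theorem dissip_eq {m : Sp N → ℝ} {u : Sp N → Sp N} {Lu : Lp (CSp N) 2 (volume : Measure (Sp N))}
    (h : IsMultiplierImage (fun ξ => m ξ ^ 2) (toL2 u) Lu) :
    0 ≤ (⟪Lu, toL2 u⟫_ℂ).re ∧ ENNReal.ofReal (⟪Lu, toL2 u⟫_ℂ).re = dissip m u := by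
  obtain ⟨h1, h2⟩ := ofReal_re_inner_eq_lintegral (f := Lu) (g := toL2 u)
    (h := fun ξ => m ((2 * Real.pi) • ξ) ^ 2 * ‖hat u ξ‖ ^ 2) (fun ξ => by positivity) (by
      filter_upwards [h] with ξ hξ
      rw [hξ, inner_smul_left, Complex.conj_ofReal, Complex.re_ofReal_mul, inner_self_eq_norm_sq_to_K]
      norm_cast)
  refine ⟨h1, h2.trans (lintegral_congr fun ξ => ?_)⟩
  rw [ENNReal.ofReal_mul (by positivity), ← sq_abs, ENNReal.ofReal_pow (abs_nonneg _),
    ENNReal.ofReal_pow (norm_nonneg _), ofReal_norm, ← Real.norm_eq_abs, ofReal_norm]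

/-- The symbol of -Δ supplies the factor |ξ|². Finiteness follows because m(D)²u and Δu are both in
L². -/
theorem HasMoments.multGradNormSq_eq_inner {m : Sp N → ℝ} (hm : Measurable m) {u : Sp N → Sp N}
    (hu : HasMoments 2 u) {Lu : Lp (CSp N) 2 (volume : Measure (Sp N))}
    (h : IsMultiplierImage (fun ξ => m ξ ^ 2) (toL2 u) Lu) :
    0 ≤ -(⟪Lu, toL2 (lap u)⟫_ℂ).re ∧
      ENNReal.ofReal (-(⟪Lu, toL2 (lap u)⟫_ℂ).re) = multGradNormSq m u := by
  have e : -(⟪Lu, toL2 (lap u)⟫_ℂ).re = (⟪Lu, -toL2 (lap u)⟫_ℂ).re := by simp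
  have hneg : (𝓕 (-toL2 (lap u)) : Lp (CSp N) 2 (volume : Measure (Sp N))) = -𝓕 (toL2 (lap u)) :=
    map_neg (Lp.fourierTransformₗᵢ (Sp N) (CSp N)) _
  rw [e]
  obtain ⟨h1, h2⟩ := ofReal_re_inner_eq_lintegral (f := Lu) (g := -toL2 (lap u))
    (h := fun ξ => m ((2 * Real.pi) • ξ) ^ 2 * (‖(2 * Real.pi) • ξ‖ ^ 2 * ‖hat u ξ‖ ^ 2))
    (fun ξ => by positivity) (by
      rw [hneg]
      filter_upwards [h, hu.hat_lap, Lp.coeFn_neg (𝓕 (toL2 (lap u)) : Lp (CSp N) 2 (volume : Measure (Sp N)))]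
        with ξ h3 h4 h5
      simp only [hat] at h4 ⊢
      rw [h3, h5, Pi.neg_apply, h4, ← neg_smul, neg_neg, inner_smul_left, inner_smul_right,
        Complex.conj_ofReal, Complex.re_ofReal_mul, Complex.re_ofReal_mul, inner_self_eq_norm_sq_to_K]
      norm_cast)
  refine ⟨h1, h2.trans ?_⟩
  rw [hu.multGradNormSq_eq hm]
  refine lintegral_congr fun ξ => ?_
  rw [ENNReal.ofReal_mul (by positivity), ENNReal.ofReal_mul (by positivity), ← sq_abs (m _),
    ENNReal.ofReal_pow (abs_nonneg _), ENNReal.ofReal_pow (norm_nonneg _),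
    ENNReal.ofReal_pow (norm_nonneg _), ofReal_norm, ofReal_norm,
    ← Real.norm_eq_abs, ofReal_norm]

theorem inner_gradient_eq_zero (hN : N ≠ 0) {u : Sp N → Sp N} (hu : HasMoments 2 u)
    (hdiv : ∀ x, div u x = 0) {P : Sp N → ℝ} (hP : ContDiff ℝ 1 P) (hL : IsL2 (gradient P)) :
    (⟪toL2 (gradient P), toL2 u⟫_ℂ).re = 0 ∧ (⟪toL2 (gradient P), toL2 (lap u)⟫_ℂ).re = 0 := by
  have h := inner_hat_gradient (hu.mono one_le_two) hdiv hP hL hN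
  constructor
  · rw [(re_inner_eq_integral _ _).1]
    refine integral_eq_zero_of_ae ?_
    filter_upwards [h] with ξ hξ
    rw [← inner_conj_symm, hξ]; simp
  · rw [(re_inner_eq_integral _ _).1]
    refine integral_eq_zero_of_ae ?_
    filter_upwards [h, hu.hat_lap] with ξ hξ h2
    simp only [hat] at h2 hξ
    rw [h2, inner_smul_right, ← inner_conj_symm, hξ]; simp

end Energy
end MHD

namespace MHD
open scoped SchwartzMap InnerProductSpace ContDiff

/-! ### Balance laws for the kinetic and the H¹ energy. -/

section TimeDerivative
variable {N : ℕ}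

/-- `L` is only continuous at `t`. By symmetry the cross terms cancel in ⟨f τ - f t, L τ + L t⟩,
which is therefore the increment of ⟨f, L⟩; only `f` has to be divided by τ - t. It is used with L =
f and with L = Δf. -/
theorem hasDerivAt_re_inner {H : Type*} [NormedAddCommGroup H] [InnerProductSpace ℂ H]
    [NormedSpace ℝ H] [IsScalarTower ℝ ℂ H] {f L : ℝ → H} {f' : H} {t : ℝ} (hf : HasDerivAt f f' t)
    (hL : ContinuousAt L t) (sym : ∀ᶠ τ in 𝓝 t, (⟪f t, L τ⟫_ℂ).re = (⟪f τ, L t⟫_ℂ).re) :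
    HasDerivAt (fun τ => (⟪f τ, L τ⟫_ℂ).re) (2 * (⟪f', L t⟫_ℂ).re) t := by
  rw [hasDerivAt_iff_tendsto_slope] at hf ⊢
  have hL' : Tendsto (fun τ => L τ + L t) (𝓝[≠] t) (𝓝 (L t + L t)) :=
    (hL.tendsto.mono_left nhdsWithin_le_nhds).add_const _
  have h1 : Tendsto (fun τ => (⟪slope f t τ, L τ + L t⟫_ℂ).re) (𝓝[≠] t)
      (𝓝 (⟪f', L t + L t⟫_ℂ).re) :=
    (Complex.continuous_re.tendsto _).comp (hf.inner hL')
  have h2 : (⟪f', L t + L t⟫_ℂ).re = 2 * (⟪f', L t⟫_ℂ).re := by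
    rw [inner_add_right, Complex.add_re]; ring
  rw [h2] at h1
  refine h1.congr' ?_
  filter_upwards [nhdsWithin_le_nhds sym] with τ hτ
  rw [slope, slope, RCLike.real_smul_eq_coe_smul (K := ℂ), inner_smul_left, vsub_eq_sub, vsub_eq_sub]
  have : (⟪f τ - f t, L τ + L t⟫_ℂ).re = (⟪f τ, L τ⟫_ℂ).re - (⟪f t, L t⟫_ℂ).re := by
    simp only [inner_sub_left, inner_add_right, Complex.add_re, Complex.sub_re]
    linarith
  rw [← this, RCLike.conj_ofReal, smul_eq_mul]
  exact RCLike.re_ofReal_mul (K := ℂ) _ _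

theorem tendsto_of_enorm_sq_sub_le {H ι : Type*} [NormedAddCommGroup H] {l : Filter ι} {f : ι → H}
    {a : H} {φ : ι → ℝ≥0∞} (hφ : Tendsto φ l (𝓝 0)) (h : ∀ᶠ i in l, ‖f i - a‖ₑ ^ 2 ≤ φ i) :
    Tendsto f l (𝓝 a) := by
  have h0 : Tendsto (fun i => ‖f i - a‖ₑ ^ 2) l (𝓝 0) :=
    tendsto_of_tendsto_of_tendsto_of_le_of_le' tendsto_const_nhds hφ
      (.of_forall fun _ => zero_le) h
  rw [tendsto_iff_edist_tendsto_0]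
  have h1 := (ENNReal.continuous_rpow_const (y := 1 / 2)).tendsto 0 |>.comp h0
  rw [ENNReal.zero_rpow_of_pos (by norm_num)] at h1
  refine h1.congr fun i => ?_
  simp only [Function.comp]
  rw [edist_eq_enorm_sub, ← ENNReal.rpow_two, ← ENNReal.rpow_mul]
  norm_num

theorem enorm_sq_eq_lintegral (f : Lp (CSp N) 2 (volume : Measure (Sp N))) :
    ‖f‖ₑ ^ 2 = ∫⁻ ξ, ‖(𝓕 f : Lp (CSp N) 2 (volume : Measure (Sp N))) ξ‖ₑ ^ 2 := by
  rw [lintegral_enorm_sq_fourier, Lp.enorm_def]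
  have := eLpNorm_nnreal_pow_eq_lintegral (p := 2) (f := f) (μ := (volume : Measure (Sp N)))
      two_ne_zero
  simpa using this

theorem IsContinuousInSobolev.hasMoments {s : ℝ} (hs : 3 + (N : ℝ) ≤ s) {I : Set ℝ}
    {v : ℝ → Sp N → Sp N} (hv : IsContinuousInSobolev s I v) {t : ℝ} (ht : t ∈ I) :
    HasMoments 2 (v t) :=
  hasMoments_of_sobolev hs (hv.contDiff t ht) (hv.isL2 t ht) (hv.sobolev t ht)

theorem IsContinuousInSobolev.continuousOn_toL2 {s : ℝ} (hs : 3 + (N : ℝ) ≤ s) {I : Set ℝ}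
    {v : ℝ → Sp N → Sp N} (hv : IsContinuousInSobolev s I v) :
    ContinuousOn (fun t => toL2 (v t)) I := by
  have hN : (0 : ℝ) ≤ N := Nat.cast_nonneg N
  refine fun t ht => tendsto_of_enorm_sq_sub_le (hv.continuous t ht) ?_
  filter_upwards [self_mem_nhdsWithin] with τ hτ
  rw [← toL2_sub (hv.isL2 τ hτ) (hv.isL2 t ht), enorm_sq_eq_lintegral]
  refine le_trans (le_of_eq ?_) (lintegral_le_sobolevNormSq (f := fun _ => 1) fun ξ => ?_)
  · simp [hat]
  · rw [← ENNReal.ofReal_one]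
    exact ENNReal.ofReal_le_ofReal (one_le_weight (by linarith) ξ)

theorem IsContinuousInSobolev.continuousOn_lap {s : ℝ} (hs : 3 + (N : ℝ) ≤ s) {I : Set ℝ}
    {v : ℝ → Sp N → Sp N} (hv : IsContinuousInSobolev s I v) :
    ContinuousOn (fun t => toL2 (lap (v t))) I := by
  have hN : (0 : ℝ) ≤ N := Nat.cast_nonneg N
  refine fun t ht => tendsto_of_enorm_sq_sub_le (hv.continuous t ht) ?_
  filter_upwards [self_mem_nhdsWithin] with τ hτ
  have m1 := hv.hasMoments hs hτ
  have m2 := hv.hasMoments hs ht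
  rw [← toL2_sub m1.isL2_lap m2.isL2_lap, enorm_sq_eq_lintegral]
  refine le_trans (le_of_eq (lintegral_congr_ae ?_)) (lintegral_le_sobolevNormSq
    (f := fun ξ => ENNReal.ofReal ((‖(2 * Real.pi) • ξ‖ ^ 2) ^ 2)) fun ξ => ?_)
  · filter_upwards [hat_sub m1.isL2_lap m2.isL2_lap, hat_sub m1.isL2 m2.isL2, m1.hat_lap, m2.hat_lap]
      with ξ h1 h2 h3 h4
    refine (congrArg (fun z => ‖z‖ₑ ^ 2) h1).trans ?_
    rw [h2, h3, h4, ← smul_sub, enorm_smul, mul_pow]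
    congr 1
    rw [← ofReal_norm, ← ENNReal.ofReal_pow (norm_nonneg _), norm_neg, Complex.norm_real,
      Real.norm_of_nonneg (by positivity)]
  · exact ENNReal.ofReal_le_ofReal (norm_pow_four_le_weight (by linarith) ξ)

/-- `‖u‖² + ‖b‖²` in `L²`. -/
noncomputable def kinetic (u b : Sp N → Sp N) : ℝ :=
  (⟪toL2 u, toL2 u⟫_ℂ).re + (⟪toL2 b, toL2 b⟫_ℂ).re

theorem kinetic_nonneg (u b : Sp N → Sp N) : 0 ≤ kinetic u b :=
  add_nonneg (inner_self_nonneg (𝕜 := ℂ)) (inner_self_nonneg (𝕜 := ℂ))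

variable {ν s : ℝ} {m : Sp N → ℝ} {I : Set ℝ} {u b : ℝ → Sp N → Sp N}

theorem IsSolution.continuousOn_kinetic (hs : 3 + (N : ℝ) ≤ s) (h : IsSolution ν m s I u b) :
    ContinuousOn (fun t => kinetic (u t) (b t)) I := by
  have h1 := h.u_sobolev.continuousOn_toL2 hs
  have h2 := h.b_sobolev.continuousOn_toL2 hs
  exact (Complex.continuous_re.comp_continuousOn (h1.inner h1)).add
    (Complex.continuous_re.comp_continuousOn (h2.inner h2))

theorem IsSolution.continuousOn_gradSq (hs : 3 + (N : ℝ) ≤ s) (h : IsSolution ν m s I u b) :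
    ContinuousOn (fun t => gradSq (u t) + gradSq (b t)) I := by
  have h1 := h.u_sobolev.continuousOn_toL2 hs
  have h2 := h.b_sobolev.continuousOn_toL2 hs
  have h3 := h.u_sobolev.continuousOn_lap hs
  have h4 := h.b_sobolev.continuousOn_lap hs
  refine ((Complex.continuous_re.comp_continuousOn (h1.inner h3)).neg.add
    (Complex.continuous_re.comp_continuousOn (h2.inner h4)).neg).congr fun t ht => ?_
  rw [(h.u_sobolev.hasMoments hs ht).gradSq_eq, (h.b_sobolev.hasMoments hs ht).gradSq_eq]
  rfl

theorem re_inner_toL2 {v w : Sp N → Sp N} (hv : IsL2 v) (hw : IsL2 w) :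
    (⟪toL2 v, toL2 w⟫_ℂ).re = ∫ x, ⟪v x, w x⟫_ℝ := by
  rw [inner_toL2 hv hw, Complex.ofReal_re]

/-- The pressure and both advection terms drop out, and the two magnetic coupling terms cancel each
other, so that only the dissipation is left. -/
theorem IsSolution.hasDerivAt_kinetic (hN : N ≠ 0) (hs : 3 + (N : ℝ) ≤ s)
    (h : IsSolution ν m s I u b) {t : ℝ} (ht : t ∈ interior I) :
    dissip m (u t) < ⊤ ∧
    HasDerivAt (fun τ => kinetic (u τ) (b τ)) (-2 * ν * (dissip m (u t)).toReal) t := by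
  have htI := interior_subset ht
  have mu := h.u_sobolev.hasMoments hs htI
  have mb := h.b_sobolev.hasMoments hs htI
  have mu1 := mu.mono one_le_two
  have mb1 := mb.mono one_le_two
  obtain ⟨P, Lu, hP, hPL, hLu, hu'⟩ := h.momentum t ht
  have hb' := h.induction_eq t ht
  obtain ⟨d1, d2⟩ := dissip_eq hLu
  have d3 : (⟪Lu, toL2 (u t)⟫_ℂ).re = (dissip m (u t)).toReal := by
    rw [← d2, ENNReal.toReal_ofReal d1]
  have sym : ∀ f : ℝ → Lp (CSp N) 2 (volume : Measure (Sp N)),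
      ∀ᶠ τ in 𝓝 t, (⟪f t, f τ⟫_ℂ).re = (⟪f τ, f t⟫_ℂ).re :=
    fun f => .of_forall fun τ => inner_re_symm (𝕜 := ℂ) _ _
  have e1 := hasDerivAt_re_inner hu' hu'.continuousAt (sym _)
  have e2 := hasDerivAt_re_inner hb' hb'.continuousAt (sym _)
  refine ⟨d2 ▸ ENNReal.ofReal_lt_top, (e1.add e2).congr_deriv ?_⟩
  have c1 := integral_convect_add_eq_zero mu1 (h.u_div t htI) mu1 mu1
  have c2 := integral_convect_add_eq_zero mb1 (h.b_div t htI) mb1 mu1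
  have c3 := integral_convect_add_eq_zero mu1 (h.u_div t htI) mb1 mb1
  have hp := (inner_gradient_eq_zero hN mu (h.u_div t htI) hP hPL).1
  simp only [inner_sub_left, inner_add_left, inner_neg_left, inner_smul_left, Complex.sub_re,
    Complex.add_re, Complex.neg_re, Complex.conj_ofReal, Complex.re_ofReal_mul, hp, d3,
    re_inner_toL2 (mu.isL2_convect mu) mu.isL2, re_inner_toL2 (mb.isL2_convect mb) mu.isL2,
    re_inner_toL2 (mu.isL2_convect mb) mb.isL2, re_inner_toL2 (mb.isL2_convect mu) mb.isL2]
  simp only [real_inner_comm] at c1 c2 c3 ⊢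
  linarith

/-- Pair with the Laplacian. The factor 6 is the 3 of `abs_nonlinear_le` doubled by the derivative
of a quadratic quantity, and NΛ is the bound for sup |∇u|. -/
theorem IsSolution.hasDerivAt_gradSq (hN : N ≠ 0) (hs : 3 + (N : ℝ) ≤ s)
    (h : IsSolution ν m s I u b) (hm : Measurable m) {t : ℝ} (ht : t ∈ interior I) :
    multGradNormSq m (u t) < ⊤ ∧ ∃ X' : ℝ,
    HasDerivAt (fun τ => gradSq (u τ) + gradSq (b τ)) X' t ∧
    X' + 2 * ν * (multGradNormSq m (u t)).toReal ≤
      6 * (N * (freqL1 (u t)).toReal) * (gradSq (u t) + gradSq (b t)) := by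
  have htI := interior_subset ht
  have hI : ∀ᶠ τ in 𝓝 t, τ ∈ I := mem_interior_iff_mem_nhds.1 ht
  have mu := h.u_sobolev.hasMoments hs htI
  have mb := h.b_sobolev.hasMoments hs htI
  obtain ⟨P, Lu, hP, hPL, hLu, hu'⟩ := h.momentum t ht
  have hb' := h.induction_eq t ht
  obtain ⟨d1, d2⟩ := mu.multGradNormSq_eq_inner hm hLu
  have d3 : (⟪Lu, toL2 (lap (u t))⟫_ℂ).re = -(multGradNormSq m (u t)).toReal := by
    rw [← d2, ENNReal.toReal_ofReal d1, neg_neg]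
  have sym : ∀ {v : ℝ → Sp N → Sp N}, IsContinuousInSobolev s I v → ∀ᶠ τ in 𝓝 t,
      (⟪toL2 (v t), toL2 (lap (v τ))⟫_ℂ).re = (⟪toL2 (v τ), toL2 (lap (v t))⟫_ℂ).re := fun {v} hv => by
    filter_upwards [hI] with τ hτ
    rw [(hv.hasMoments hs htI).inner_lap (hv.hasMoments hs hτ),
      (hv.hasMoments hs hτ).inner_lap (hv.hasMoments hs htI)]
    simp only [real_inner_comm]
  have e1 := hasDerivAt_re_inner hu' ((h.u_sobolev.continuousOn_lap hs).continuousAt hI)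
    (sym h.u_sobolev)
  have e2 := hasDerivAt_re_inner hb' ((h.b_sobolev.continuousOn_lap hs).continuousAt hI)
    (sym h.b_sobolev)
  refine ⟨d2 ▸ ENNReal.ofReal_lt_top, _, (e1.neg.add e2.neg).congr_of_eventuallyEq ?_, ?_⟩
  · filter_upwards [hI] with τ hτ
    simp [(h.u_sobolev.hasMoments hs hτ).gradSq_eq, (h.b_sobolev.hasMoments hs hτ).gradSq_eq]
  have hp := (inner_gradient_eq_zero hN mu (h.u_div t htI) hP hPL).2
  have key := (abs_le.1 (abs_nonlinear_le mu mb (h.u_div t htI) (h.b_div t htI)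
    mu.gradNorm_le)).2
  simp only [inner_sub_left, inner_add_left, inner_neg_left, inner_smul_left, Complex.sub_re,
    Complex.add_re, Complex.neg_re, Complex.conj_ofReal, Complex.re_ofReal_mul, hp, d3,
    re_inner_toL2 (mu.isL2_convect mu) mu.isL2_lap, re_inner_toL2 (mb.isL2_convect mb) mu.isL2_lap,
    re_inner_toL2 (mu.isL2_convect mb) mb.isL2_lap, re_inner_toL2 (mb.isL2_convect mu) mb.isL2_lap]
  linarith

end TimeDerivative
end MHD

namespace MHD
open scoped SchwartzMap InnerProductSpace ContDiff

/-! ### Splitting the L¹ norm of the transform of the gradient by frequency. -/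

section Frequency
variable {N : ℕ}

/-- Logarithmic growth of the critical radial integral. -/
theorem exists_lintegral_annulus_le (hN : N ≠ 0) : ∃ C : ℝ, 0 ≤ C ∧ ∀ Y : ℝ, 1 ≤ Y →
    ∫⁻ ξ in {ξ : Sp N | 1 ≤ ‖(2 * Real.pi) • ξ‖ ∧ ‖(2 * Real.pi) • ξ‖ < Y},
      ENNReal.ofReal ((‖(2 * Real.pi) • ξ‖ ^ N)⁻¹) ≤ ENNReal.ofReal (C * Real.log Y) := by
  have : NeZero N := ⟨hN⟩
  have hpi := Real.two_pi_pos
  -- In polar coordinates the sphere contributes N times the volume of the unit ball, and the radial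
  -- density is (2π)^(-N)/r between 1/(2π) and Y/(2π).
  refine ⟨N * (volume.real (Metric.ball (0 : Sp N) 1) * ((2 * Real.pi) ^ N)⁻¹), by positivity,
    fun Y hY => ?_⟩
  have hY0 : 0 < Y := by linarith
  set a := 1 / (2 * Real.pi) with ha
  set c := Y / (2 * Real.pi) with hc
  have ha0 : 0 < a := by positivity
  have hac : a ≤ c := by rw [ha, hc]; gcongr
  set F : ℝ → ℝ := indicator (Ico a c) fun r => ((2 * Real.pi * r) ^ N)⁻¹ with hF
  have hmul : ∀ y ∈ Ioi (0 : ℝ), y ^ (N - 1) • F y =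
      indicator (Ico a c) (fun y => ((2 * Real.pi) ^ N)⁻¹ * y⁻¹) y := fun y hy => by
    by_cases h : y ∈ Ico a c
    · have hy0 : y ≠ 0 := (ne_of_gt hy)
      rw [hF, indicator_of_mem h, indicator_of_mem h, smul_eq_mul, mul_pow]
      have : y ^ N = y ^ (N - 1) * y := by rw [← pow_succ, Nat.sub_add_cancel (Nat.pos_of_ne_zero hN)]
      rw [this]
      field_simp
    · rw [hF, indicator_of_notMem h, indicator_of_notMem h, smul_zero]
  have hII : IntegrableOn (fun y : ℝ => ((2 * Real.pi) ^ N)⁻¹ * y⁻¹) (Icc a c) := by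
    refine ContinuousOn.integrableOn_compact isCompact_Icc ?_
    exact continuousOn_const.mul (continuousOn_inv₀.mono fun y hy => (ha0.trans_le hy.1).ne')
  have hsub : Ico a c ⊆ Ioi 0 := fun y hy => ha0.trans_le hy.1
  have hint : Integrable fun ξ : Sp N => F ‖ξ‖ := by
    rw [integrable_fun_norm_addHaar]
    simp only [finrank_euclideanSpace, Fintype.card_fin]
    rw [integrableOn_congr_fun hmul measurableSet_Ioi, ← integrable_indicator_iff measurableSet_Ioi,
      indicator_indicator, inter_eq_right.2 hsub, integrable_indicator_iff measurableSet_Ico]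
    exact hII.mono_set Ico_subset_Icc_self
  have hF0 : ∀ r, 0 ≤ F r := fun r => by
    rw [hF]
    refine indicator_nonneg (fun y hy => ?_) r
    have := ha0.trans_le hy.1
    positivity
  have hval : ∫ ξ : Sp N, F ‖ξ‖ =
      N * (volume.real (Metric.ball (0 : Sp N) 1) * ((2 * Real.pi) ^ N)⁻¹) * Real.log Y := by
    rw [integral_fun_norm_addHaar]
    simp only [finrank_euclideanSpace, Fintype.card_fin]
    rw [setIntegral_congr_fun measurableSet_Ioi hmul, setIntegral_indicator measurableSet_Ico,
      inter_eq_right.2 hsub, integral_const_mul, integral_Ico_eq_integral_Ioc,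
      ← intervalIntegral.integral_of_le hac, integral_inv_of_pos ha0 (ha0.trans_le hac)]
    have : c / a = Y := by rw [hc, ha]; field_simp
    rw [this, nsmul_eq_mul, smul_eq_mul]
    ring
  rw [← hval, ofReal_integral_eq_lintegral_ofReal hint (.of_forall fun ξ => hF0 _)]
  have hms : MeasurableSet {ξ : Sp N | 1 ≤ ‖(2 * Real.pi) • ξ‖ ∧ ‖(2 * Real.pi) • ξ‖ < Y} :=
    have hnm : Measurable fun ξ : Sp N => ‖(2 * Real.pi) • ξ‖ := by fun_prop
    (measurableSet_le measurable_const hnm).inter (measurableSet_lt hnm measurable_const)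
  rw [← lintegral_indicator hms]
  refine lintegral_mono (indicator_le fun ξ hξ => ?_)
  have e : ‖(2 * Real.pi) • ξ‖ = 2 * Real.pi * ‖ξ‖ := by
    rw [norm_smul, Real.norm_of_nonneg hpi.le]
  simp only [mem_ofPred_eq, e] at hξ
  have hm : ‖ξ‖ ∈ Ico a c := by
    constructor
    · rw [ha, div_le_iff₀ hpi]; linarith [hξ.1]
    · rw [hc, lt_div_iff₀ hpi]; linarith [hξ.2]
  rw [hF, indicator_of_mem hm, e]

/-- The radial tail integral with an integrable power. -/
theorem lintegral_tail_lt_top {q : ℝ} (hq : (N : ℝ) < q) :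
    ∫⁻ ξ in {ξ : Sp N | 1 ≤ ‖(2 * Real.pi) • ξ‖}, ENNReal.ofReal (‖(2 * Real.pi) • ξ‖ ^ (-q)) < ⊤ := by
  have hq0 : 0 < q := (Nat.cast_nonneg N).trans_lt hq
  have hi : Integrable (fun ξ : Sp N => (2 : ℝ) ^ q * (1 + ‖ξ‖) ^ (-q)) :=
    (integrable_one_add_norm (by simpa using hq)).const_mul _
  have hms : MeasurableSet {ξ : Sp N | 1 ≤ ‖(2 * Real.pi) • ξ‖} :=
    measurableSet_le measurable_const (by fun_prop)
  refine lt_of_le_of_lt ((setLIntegral_mono' hms fun ξ hξ => ?_).trans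
    (setLIntegral_le_lintegral _ _)) hi.lintegral_lt_top
  refine ENNReal.ofReal_le_ofReal ?_
  have h1 : (1 : ℝ) ≤ ‖(2 * Real.pi) • ξ‖ := hξ
  have e : ‖(2 * Real.pi) • ξ‖ = 2 * Real.pi * ‖ξ‖ := by
    rw [norm_smul, Real.norm_of_nonneg Real.two_pi_pos.le]
  have h2 : (1 + ‖ξ‖) / 2 ≤ ‖(2 * Real.pi) • ξ‖ := by
    nlinarith [Real.pi_gt_three, norm_nonneg ξ]
  have h3 : (0 : ℝ) < (1 + ‖ξ‖) / 2 := by positivity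
  calc ‖(2 * Real.pi) • ξ‖ ^ (-q) ≤ ((1 + ‖ξ‖) / 2) ^ (-q) :=
        Real.rpow_le_rpow_of_nonpos h3 h2 (by linarith)
    _ = _ := by
      rw [Real.div_rpow (by positivity) (by norm_num), Real.rpow_neg (by norm_num : (0 : ℝ) ≤ 2),
        div_inv_eq_mul, mul_comm]

theorem setLIntegral_sq_le {S : Set (Sp N)} {f h : Sp N → ℝ≥0∞} (hS : MeasurableSet S)
    (hf : Measurable f) (hh : AEMeasurable h volume) {k : Sp N → ℝ≥0∞} (hk : ∀ ξ ∈ S, k ξ ≤ f ξ * h ξ) :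
    (∫⁻ ξ in S, k ξ) ^ 2 ≤ (∫⁻ ξ in S, f ξ ^ 2) * ∫⁻ ξ, h ξ ^ 2 := by
  calc (∫⁻ ξ in S, k ξ) ^ 2 ≤ (∫⁻ ξ in S, f ξ * h ξ) ^ 2 := by
        gcongr ?_ ^ 2
        exact setLIntegral_mono' hS hk
    _ ≤ (∫⁻ ξ in S, f ξ ^ 2) * ∫⁻ ξ in S, h ξ ^ 2 :=
        lintegral_mul_sq_le hf.aemeasurable hh.restrict
    _ ≤ _ := mul_le_mul_right (setLIntegral_le_lintegral _ _) _

theorem enorm_eq_ofReal_norm (η : Sp N) : ‖η‖ₑ = ENNReal.ofReal ‖η‖ := (ofReal_norm η).symm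

/-- Cauchy-Schwarz on three frequency ranges, with ‖u‖², ‖m(D)u‖² and ‖m(D)∇u‖² as the respective
quadratic quantities. The constant is chosen before `m`, `u` and `Y`, so the cut-off can later
depend on the solution. -/
theorem freqL1_split {α : ℝ} (hα : 1 + (N : ℝ) / 2 ≤ α) {g : ℝ → ℝ} (hg_mono : MonotoneOn g (Ioi 0))
    (hg_one : ∀ r, 0 < r → 1 ≤ g r) (hN : N ≠ 0) {p G δ : ℝ} (hG : ∀ r, 1 ≤ r → g r ≤ G * r ^ p)
    (hδ : 0 < δ) (hpδ : 4 * δ = 2 * α - 2 * p - N) (R : ℝ) :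
    ∃ C : ℝ, 0 ≤ C ∧ ∀ m : Sp N → ℝ, Measurable m → LowerBoundFrom α g R m →
      ∀ u : Sp N → Sp N, HasMoments 2 u → dissip m u < ⊤ → multGradNormSq m u < ⊤ →
        ∀ Y : ℝ, 1 ≤ Y → ∃ a b c : ℝ, 0 ≤ a ∧ 0 ≤ b ∧ 0 ≤ c ∧ (freqL1 u).toReal ≤ a + b + c ∧
          a ^ 2 ≤ C * (⟪toL2 u, toL2 u⟫_ℂ).re ∧
          b ^ 2 ≤ C * (g Y ^ 2 * Real.log Y * (dissip m u).toReal) ∧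
          c ^ 2 ≤ C * (Y ^ (-2 * δ) * (multGradNormSq m u).toReal) := by
  obtain ⟨C₂, hC₂, hann⟩ := exists_lintegral_annulus_le hN
  -- The square of |ξ|^(p - α) is |ξ|^(-N - 4δ): half of the surplus 4δ makes the tail integrable,
  -- the other half gives the decay in `Y`.
  have htail := lintegral_tail_lt_top (N := N) (q := N + 2 * δ) (by linarith)
  set τ := ∫⁻ ξ in {ξ : Sp N | 1 ≤ ‖(2 * Real.pi) • ξ‖},
    ENNReal.ofReal (‖(2 * Real.pi) • ξ‖ ^ (-(N + 2 * δ))) with hτ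
  -- Beyond `R₁` the lower bound on `m` holds and powers of |ξ| increase with the exponent.
  set R₁ := max R 1 with hR₁
  have hR1 : 1 ≤ R₁ := le_max_right _ _
  have hlow : ∫⁻ ξ in {ξ : Sp N | ‖(2 * Real.pi) • ξ‖ < R₁}, ‖(2 * Real.pi) • ξ‖ₑ ^ 2 < ⊤ := by
    have hms : MeasurableSet {ξ : Sp N | ‖(2 * Real.pi) • ξ‖ < R₁} :=
      measurableSet_lt (by fun_prop) measurable_const
    have hsub : {ξ : Sp N | ‖(2 * Real.pi) • ξ‖ < R₁} ⊆ Metric.ball 0 R₁ := fun ξ hξ => by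
      have h1 : ‖(2 * Real.pi) • ξ‖ < R₁ := hξ
      rw [norm_smul, Real.norm_of_nonneg Real.two_pi_pos.le] at h1
      rw [mem_ball_zero_iff]
      nlinarith [Real.pi_gt_three, norm_nonneg ξ]
    calc _ ≤ ∫⁻ ξ in {ξ : Sp N | ‖(2 * Real.pi) • ξ‖ < R₁}, ENNReal.ofReal R₁ ^ 2 := by
          refine setLIntegral_mono' hms fun ξ hξ => ?_
          gcongr
          rw [← ofReal_norm]
          exact ENNReal.ofReal_le_ofReal (le_of_lt hξ)
      _ ≤ ENNReal.ofReal R₁ ^ 2 * volume (Metric.ball (0 : Sp N) R₁) := by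
          rw [setLIntegral_const]; gcongr
      _ < ⊤ := ENNReal.mul_lt_top (by simp) measure_ball_lt_top
  set lo := ∫⁻ ξ in {ξ : Sp N | ‖(2 * Real.pi) • ξ‖ < R₁}, ‖(2 * Real.pi) • ξ‖ₑ ^ 2 with hlo
  have hG0 : 0 < G := by
    have := (hg_one 1 one_pos).trans (hG 1 le_rfl)
    rw [Real.one_rpow, mul_one] at this
    linarith
  refine ⟨lo.toReal + C₂ + G ^ 2 * τ.toReal, by positivity, fun m hm hmb u hu hD hM Y hY => ?_⟩
  have hnm : Measurable fun ξ : Sp N => ‖(2 * Real.pi) • ξ‖ := by fun_prop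
  set A := {ξ : Sp N | ‖(2 * Real.pi) • ξ‖ < R₁}
  set B := {ξ : Sp N | R₁ ≤ ‖(2 * Real.pi) • ξ‖ ∧ ‖(2 * Real.pi) • ξ‖ < Y}
  -- Both conditions are kept because `Y` may be smaller than `R₁`; the middle range is then empty.
  set D := {ξ : Sp N | R₁ ≤ ‖(2 * Real.pi) • ξ‖ ∧ Y ≤ ‖(2 * Real.pi) • ξ‖}
  have hA : MeasurableSet A := measurableSet_lt hnm measurable_const
  have hB : MeasurableSet B :=
    (measurableSet_le measurable_const hnm).inter (measurableSet_lt hnm measurable_const)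
  have hDm : MeasurableSet D :=
    (measurableSet_le measurable_const hnm).inter (measurableSet_le measurable_const hnm)
  set k : Sp N → ℝ≥0∞ := fun ξ => ‖(2 * Real.pi) • ξ‖ₑ * ‖hat u ξ‖ₑ
  have hm' : Measurable fun ξ : Sp N => ‖m ((2 * Real.pi) • ξ)‖ₑ :=
    (hm.comp (measurable_const_smul _)).enorm
  have hcover : freqL1 u ≤ (∫⁻ ξ in A, k ξ) + (∫⁻ ξ in B, k ξ) + ∫⁻ ξ in D, k ξ := by
    calc freqL1 u = ∫⁻ ξ in A ∪ B ∪ D, k ξ := by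
          have : A ∪ B ∪ D = univ := by
            ext ξ
            simp only [A, B, D, mem_union, mem_ofPred_eq, mem_univ, iff_true]
            rcases lt_or_ge ‖(2 * Real.pi) • ξ‖ R₁ with h | h <;>
            rcases lt_or_ge ‖(2 * Real.pi) • ξ‖ Y with h' | h' <;> tauto
          rw [this, setLIntegral_univ, freqL1]
      _ ≤ (∫⁻ ξ in A ∪ B, k ξ) + ∫⁻ ξ in D, k ξ := lintegral_union_le _ _ _
      _ ≤ _ := by gcongr; exact lintegral_union_le _ _ _
  have hkin : ∫⁻ ξ, ‖hat u ξ‖ₑ ^ 2 = ENNReal.ofReal (⟪toL2 u, toL2 u⟫_ℂ).re := by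
    rw [← enorm_sq_eq_lintegral, ← ofReal_norm, ← ENNReal.ofReal_pow (norm_nonneg _)]
    congr 1
    exact (inner_self_eq_norm_sq (𝕜 := ℂ) _).symm
  have bA : (∫⁻ ξ in A, k ξ) ^ 2 ≤ lo * ENNReal.ofReal (⟪toL2 u, toL2 u⟫_ℂ).re := by
    rw [← hkin]
    exact setLIntegral_sq_le hA (by fun_prop) (hat_enorm_aemeasurable u) fun ξ _ => le_rfl
  have hme : ∀ ξ : Sp N, R₁ ≤ ‖(2 * Real.pi) • ξ‖ →
      0 ≤ m ((2 * Real.pi) • ξ) ∧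
      ‖(2 * Real.pi) • ξ‖ ^ α ≤ g ‖(2 * Real.pi) • ξ‖ * m ((2 * Real.pi) • ξ) := fun ξ h => by
    have hr : 0 < ‖(2 * Real.pi) • ξ‖ := by linarith
    have hg1 := hg_one _ hr
    have h1 := hmb ((2 * Real.pi) • ξ) ((le_max_left _ _).trans h)
    refine ⟨le_trans (by positivity) h1, ?_⟩
    rw [div_le_iff₀ (by linarith)] at h1
    linarith
  have bB : (∫⁻ ξ in B, k ξ) ^ 2 ≤ ENNReal.ofReal (g Y ^ 2 * (C₂ * Real.log Y)) * dissip m u := by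
    have hf : Measurable fun ξ : Sp N =>
      ENNReal.ofReal (‖(2 * Real.pi) • ξ‖ ^ (-((N : ℝ) / 2)) * g Y) := by fun_prop
    have h := setLIntegral_sq_le (h := fun ξ => ‖m ((2 * Real.pi) • ξ)‖ₑ * ‖hat u ξ‖ₑ) (k := k) hB hf
      (hm'.aemeasurable.mul (hat_enorm_aemeasurable u)) fun ξ hξ => ?_
    · simp only [mul_pow] at h
      refine h.trans ?_
      rw [dissip]
      gcongr
      rw [ENNReal.ofReal_mul (sq_nonneg _)]
      calc _ = ∫⁻ ξ in B, ENNReal.ofReal (g Y ^ 2) * ENNReal.ofReal ((‖(2 * Real.pi) • ξ‖ ^ N)⁻¹) := by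
            refine setLIntegral_congr_fun hB fun ξ hξ => ?_
            have hr : 0 < ‖(2 * Real.pi) • ξ‖ := by linarith [hξ.1]
            have hgY := hg_one Y (by linarith)
            rw [← ENNReal.ofReal_pow (by positivity), ← ENNReal.ofReal_mul (sq_nonneg _), mul_pow,
              ← Real.rpow_natCast (_ ^ _), ← Real.rpow_mul hr.le, ← Real.rpow_natCast _ N,
              ← Real.rpow_neg hr.le]
            congr 1
            rw [mul_comm]
            congr 2
            push_cast; ring
        _ = ENNReal.ofReal (g Y ^ 2) * ∫⁻ ξ in B, ENNReal.ofReal ((‖(2 * Real.pi) • ξ‖ ^ N)⁻¹) :=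
            lintegral_const_mul' _ _ ENNReal.ofReal_ne_top
        _ ≤ _ := by
            refine mul_le_mul_right ?_ _
            refine le_trans (lintegral_mono_set fun ξ hξ => ?_) (hann Y hY)
            exact ⟨hR1.trans hξ.1, hξ.2⟩
    · obtain ⟨h0, h1⟩ := hme ξ hξ.1
      simp only [k]
      rw [← mul_assoc]
      gcongr ?_ * _
      have hr1 : 1 ≤ ‖(2 * Real.pi) • ξ‖ := hR1.trans hξ.1
      set r := ‖(2 * Real.pi) • ξ‖
      have hr : 0 < r := by linarith
      have hgr : g r ≤ g Y := hg_mono hr (mem_Ioi.2 (by linarith)) hξ.2.le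
      rw [enorm_eq_ofReal_norm, Real.enorm_of_nonneg h0,
        ← ENNReal.ofReal_mul (by have := hg_one Y (by linarith); positivity)]
      refine ENNReal.ofReal_le_ofReal ?_
      -- The critical condition α ≥ 1 + N/2 enters here: r ≤ r^(-N/2) r^α.
      calc r = r ^ (1 : ℝ) := (Real.rpow_one r).symm
        _ ≤ r ^ (-((N : ℝ) / 2) + α) := Real.rpow_le_rpow_of_exponent_le hr1 (by linarith)
        _ = r ^ (-((N : ℝ) / 2)) * r ^ α := Real.rpow_add hr _ _
        _ ≤ r ^ (-((N : ℝ) / 2)) * (g Y * m ((2 * Real.pi) • ξ)) := by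
            gcongr
            exact h1.trans (by gcongr)
        _ = _ := by ring
  have bD : (∫⁻ ξ in D, k ξ) ^ 2 ≤
      ENNReal.ofReal (G ^ 2 * Y ^ (-2 * δ)) * τ * multGradNormSq m u := by
    have hf : Measurable fun ξ : Sp N =>
      ENNReal.ofReal (G * ‖(2 * Real.pi) • ξ‖ ^ (p - α)) := by fun_prop
    have h := setLIntegral_sq_le (h := fun ξ => ‖m ((2 * Real.pi) • ξ)‖ₑ *
      (‖(2 * Real.pi) • ξ‖ₑ * ‖hat u ξ‖ₑ)) (k := k) hDm hf
      (hm'.aemeasurable.mul ((by fun_prop : Measurable fun ξ : Sp N =>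
        ‖(2 * Real.pi) • ξ‖ₑ).aemeasurable.mul (hat_enorm_aemeasurable u))) fun ξ hξ => ?_
    · simp only [mul_pow] at h
      refine h.trans ?_
      rw [hu.multGradNormSq_eq hm]
      gcongr
      calc _ ≤ ∫⁻ ξ in D, ENNReal.ofReal (G ^ 2 * Y ^ (-2 * δ)) *
              ENNReal.ofReal (‖(2 * Real.pi) • ξ‖ ^ (-(N + 2 * δ))) := by
            refine setLIntegral_mono' hDm fun ξ hξ => ?_
            have hr1 : 1 ≤ ‖(2 * Real.pi) • ξ‖ := hR1.trans hξ.1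
            have hYr : Y ≤ ‖(2 * Real.pi) • ξ‖ := hξ.2
            set r := ‖(2 * Real.pi) • ξ‖
            have hr : 0 < r := by linarith
            rw [← ENNReal.ofReal_pow (by positivity), ← ENNReal.ofReal_mul (by positivity)]
            refine ENNReal.ofReal_le_ofReal ?_
            calc (G * r ^ (p - α)) ^ 2 = G ^ 2 * (r ^ (-2 * δ) * r ^ (-(N + 2 * δ))) := by
                  rw [mul_pow, ← Real.rpow_natCast (_ ^ _), ← Real.rpow_mul hr.le,
                    ← Real.rpow_add hr]
                  congr 2
                  push_cast; linarith
              _ ≤ G ^ 2 * (Y ^ (-2 * δ) * r ^ (-(N + 2 * δ))) := by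
                  have : r ^ (-2 * δ) ≤ Y ^ (-2 * δ) :=
                    Real.rpow_le_rpow_of_nonpos (by linarith) hYr (by linarith)
                  gcongr
              _ = _ := by ring
        _ = ENNReal.ofReal (G ^ 2 * Y ^ (-2 * δ)) *
              ∫⁻ ξ in D, ENNReal.ofReal (‖(2 * Real.pi) • ξ‖ ^ (-(N + 2 * δ))) :=
            lintegral_const_mul' _ _ ENNReal.ofReal_ne_top
        _ ≤ _ := by
            refine mul_le_mul_right ?_ _
            exact lintegral_mono_set fun ξ hξ => hR1.trans hξ.1
    · obtain ⟨h0, h1⟩ := hme ξ hξ.1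
      simp only [k]
      rw [← mul_assoc]
      refine le_mul_of_one_le_left zero_le ?_
      have hr1 : 1 ≤ ‖(2 * Real.pi) • ξ‖ := hR1.trans hξ.1
      set r := ‖(2 * Real.pi) • ξ‖
      have hr : 0 < r := by linarith
      have hg1 := hg_one r hr
      rw [Real.enorm_of_nonneg h0, ← ENNReal.ofReal_mul (by positivity), ENNReal.one_le_ofReal,
        Real.rpow_sub hr]
      have hra : 0 < r ^ α := by positivity
      have h2 : r ^ α ≤ G * r ^ p * m ((2 * Real.pi) • ξ) :=
        h1.trans (mul_le_mul_of_nonneg_right (hG r hr1) h0)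
      rw [show G * (r ^ p / r ^ α) * m ((2 * Real.pi) • ξ) =
        (G * r ^ p * m ((2 * Real.pi) • ξ)) / r ^ α by ring, le_div_iff₀ hra, one_mul]
      exact h2
  have fin : ∀ {x : ℝ≥0∞} {y : ℝ≥0∞}, x ^ 2 ≤ y → y < ⊤ → x < ⊤ := fun h h' =>
    (ENNReal.pow_lt_top_iff.1 (h.trans_lt h')).resolve_right two_ne_zero
  have tA : lo * ENNReal.ofReal (⟪toL2 u, toL2 u⟫_ℂ).re < ⊤ :=
    ENNReal.mul_lt_top hlow ENNReal.ofReal_lt_top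
  have tB : ENNReal.ofReal (g Y ^ 2 * (C₂ * Real.log Y)) * dissip m u < ⊤ :=
    ENNReal.mul_lt_top ENNReal.ofReal_lt_top hD
  have tD : ENNReal.ofReal (G ^ 2 * Y ^ (-2 * δ)) * τ * multGradNormSq m u < ⊤ :=
    ENNReal.mul_lt_top (ENNReal.mul_lt_top ENNReal.ofReal_lt_top htail) hM
  have fA := fin bA tA
  have fB := fin bB tB
  have fD := fin bD tD
  have hlog : 0 ≤ Real.log Y := Real.log_nonneg hY
  have hk0 : 0 ≤ (⟪toL2 u, toL2 u⟫_ℂ).re := inner_self_nonneg (𝕜 := ℂ)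
  refine ⟨(∫⁻ ξ in A, k ξ).toReal, (∫⁻ ξ in B, k ξ).toReal, (∫⁻ ξ in D, k ξ).toReal,
    ENNReal.toReal_nonneg, ENNReal.toReal_nonneg, ENNReal.toReal_nonneg, ?_, ?_, ?_, ?_⟩
  · rw [← ENNReal.toReal_add fA.ne fB.ne, ← ENNReal.toReal_add (ENNReal.add_lt_top.2 ⟨fA, fB⟩).ne fD.ne]
    exact ENNReal.toReal_mono (ENNReal.add_lt_top.2 ⟨ENNReal.add_lt_top.2 ⟨fA, fB⟩, fD⟩).ne hcover
  · have := ENNReal.toReal_mono tA.ne bA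
    rw [ENNReal.toReal_pow, ENNReal.toReal_mul, ENNReal.toReal_ofReal hk0] at this
    refine this.trans (mul_le_mul_of_nonneg_right ?_ hk0)
    have : 0 ≤ G ^ 2 * τ.toReal := by positivity
    linarith
  · have := ENNReal.toReal_mono tB.ne bB
    rw [ENNReal.toReal_pow, ENNReal.toReal_mul, ENNReal.toReal_ofReal (by positivity)] at this
    refine this.trans ?_
    calc _ = C₂ * (g Y ^ 2 * Real.log Y * (dissip m u).toReal) := by ring
      _ ≤ _ := by
        refine mul_le_mul_of_nonneg_right ?_ (by positivity)
        have : 0 ≤ G ^ 2 * τ.toReal := by positivity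
        have : 0 ≤ lo.toReal := ENNReal.toReal_nonneg
        linarith
  · have := ENNReal.toReal_mono tD.ne bD
    rw [ENNReal.toReal_pow, ENNReal.toReal_mul, ENNReal.toReal_mul,
      ENNReal.toReal_ofReal (by positivity)] at this
    refine this.trans ?_
    calc _ = G ^ 2 * τ.toReal * (Y ^ (-2 * δ) * (multGradNormSq m u).toReal) := by ring
      _ ≤ _ := by
        refine mul_le_mul_of_nonneg_right ?_ (by positivity)
        have : 0 ≤ lo.toReal := ENNReal.toReal_nonneg
        linarith

end Frequency
end MHD

namespace MHD
open scoped SchwartzMap InnerProductSpace ContDiff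

/-! ### Osgood's lemma and the absorption inequality. -/

section Osgood

/-- The integral of a nonnegative derivative over an open interval is at most the oscillation. -/
theorem lintegral_deriv_le {T C : ℝ} (hT : 0 < T) {f f' : ℝ → ℝ}
    (hf : ∀ t ∈ Ioo 0 T, HasDerivAt f (f' t) t) (hf' : ∀ t ∈ Ioo 0 T, 0 ≤ f' t)
    (hC : ∀ a ∈ Ioo 0 T, ∀ b ∈ Ioo 0 T, f b - f a ≤ C) :
    ∫⁻ t in Ioo 0 T, ENNReal.ofReal (f' t) ≤ ENNReal.ofReal C := by
  -- `deriv f` is measurable for any `f`, which is not known of `f'`.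
  have e : ∫⁻ t in Ioo 0 T, ENNReal.ofReal (f' t) = ∫⁻ t in Ioo 0 T, ENNReal.ofReal (deriv f t) :=
    setLIntegral_congr_fun measurableSet_Ioo fun t ht => by simp only [(hf t ht).deriv]
  rw [e]
  -- Nothing is assumed at the endpoints, so the interval is exhausted by [a, T - a] with a = T/(n +
  -- 3), small enough that a ≤ T - a.
  have ha : Tendsto (fun n : ℕ => T / (n + 3 : ℝ)) atTop (𝓝 0) := by
    refine Tendsto.div_atTop tendsto_const_nhds ?_
    exact tendsto_natCast_atTop_atTop.atTop_add tendsto_const_nhds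
  have hb : Tendsto (fun n : ℕ => T - T / (n + 3 : ℝ)) atTop (𝓝 T) := by
    simpa using ha.const_sub T
  have hcov := aecover_Ioo_of_Ioc (μ := volume) ha hb
  refine le_of_tendsto' (hcov.lintegral_tendsto_of_countably_generated
    ((measurable_deriv f).ennreal_ofReal.aemeasurable)) fun n => ?_
  have hn : (0 : ℝ) < n + 3 := by positivity
  have h3 : T / (n + 3 : ℝ) ≤ T / 3 := by gcongr; linarith [(Nat.cast_nonneg n : (0 : ℝ) ≤ n)]
  have h0 : 0 < T / (n + 3 : ℝ) := by positivity
  set a := T / (n + 3 : ℝ)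
  have hab : a ≤ T - a := by linarith
  have hsub : Icc a (T - a) ⊆ Ioo 0 T := fun t ht => ⟨h0.trans_le ht.1, by linarith [ht.2]⟩
  have hcont : ContinuousOn f (Icc a (T - a)) := fun t ht =>
    (hf t (hsub ht)).continuousAt.continuousWithinAt
  have hd : ∀ t ∈ Ioo a (T - a), HasDerivAt f (deriv f t) t := fun t ht =>
    (hf t (hsub (Ioo_subset_Icc_self ht))).differentiableAt.hasDerivAt
  have hd0 : ∀ t ∈ Ioc a (T - a), 0 ≤ deriv f t := fun t ht => by
    rw [(hf t (hsub (Ioc_subset_Icc_self ht))).deriv]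
    exact hf' t (hsub (Ioc_subset_Icc_self ht))
  have hint : IntegrableOn (deriv f) (Ioc a (T - a)) :=
    intervalIntegral.integrableOn_deriv_of_nonneg hcont hd
      fun t ht => hd0 t (Ioo_subset_Ioc_self ht)
  rw [Measure.restrict_restrict measurableSet_Ioc,
    inter_eq_left.2 (Ioc_subset_Icc_self.trans hsub),
    ← ofReal_integral_eq_lintegral_ofReal hint
      ((ae_restrict_iff' measurableSet_Ioc).2 (.of_forall hd0)),
    ← intervalIntegral.integral_of_le hab,
    intervalIntegral.integral_eq_sub_of_hasDerivAt_of_le hab hcont hd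
      ((intervalIntegrable_iff_integrableOn_Ioc_of_le hab).2 hint)]
  exact ENNReal.ofReal_le_ofReal (hC a (hsub ⟨le_rfl, hab⟩) _ (hsub ⟨hab, le_rfl⟩))

variable {φ : ℝ → ℝ} {e₀ : ℝ}

theorem intervalIntegrable_of_antitoneOn (hφ : AntitoneOn φ (Ici e₀)) {a b : ℝ} (ha : e₀ ≤ a)
    (hb : e₀ ≤ b) : IntervalIntegrable φ volume a b :=
  AntitoneOn.intervalIntegrable (hφ.mono fun _ hx => (le_min ha hb).trans hx.1)

/-- Tangent inequality for the concave primitive of an antitone function, valid for `b` on either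
side of `a`. It replaces the chain rule at points where `φ` jumps. -/
theorem primitive_sub_le (hφ : AntitoneOn φ (Ici e₀)) {a b : ℝ} (ha : e₀ ≤ a) (hb : e₀ ≤ b) :
    (∫ τ in e₀..b, φ τ) - ∫ τ in e₀..a, φ τ ≤ φ a * (b - a) := by
  rw [intervalIntegral.integral_interval_sub_left (intervalIntegrable_of_antitoneOn hφ le_rfl hb)
    (intervalIntegrable_of_antitoneOn hφ le_rfl ha)]
  rcases le_total a b with h | h
  · calc ∫ τ in a..b, φ τ ≤ ∫ _ in a..b, φ a :=
          intervalIntegral.integral_mono_on h (intervalIntegrable_of_antitoneOn hφ ha hb)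
            intervalIntegrable_const fun x hx => hφ ha (ha.trans hx.1) hx.1
      _ = _ := by rw [intervalIntegral.integral_const, smul_eq_mul, mul_comm]
  · rw [intervalIntegral.integral_symm]
    have : ∫ _ in b..a, φ a ≤ ∫ τ in b..a, φ τ :=
      intervalIntegral.integral_mono_on h intervalIntegrable_const
        (intervalIntegrable_of_antitoneOn hφ hb ha) fun x hx => hφ (hb.trans hx.1) ha hx.2
    rw [intervalIntegral.integral_const, smul_eq_mul] at this
    linarith

theorem primitive_mono (hφ : AntitoneOn φ (Ici e₀)) (h0 : ∀ τ ∈ Ici e₀, 0 ≤ φ τ) {a b : ℝ}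
    (ha : e₀ ≤ a) (hab : a ≤ b) : ∫ τ in e₀..a, φ τ ≤ ∫ τ in e₀..b, φ τ := by
  have := primitive_sub_le hφ (ha.trans hab) ha
  nlinarith [mul_nonneg (h0 b (ha.trans hab)) (sub_nonneg.2 hab)]

theorem continuousOn_primitive (hφ : AntitoneOn φ (Ici e₀)) (h0 : ∀ τ ∈ Ici e₀, 0 ≤ φ τ) :
    ContinuousOn (fun y => ∫ τ in e₀..y, φ τ) (Ici e₀) := by
  have key : ∀ a ∈ Ici e₀, ∀ b ∈ Ici e₀,
      (∫ τ in e₀..b, φ τ) - ∫ τ in e₀..a, φ τ ≤ φ e₀ * |b - a| := fun a ha b hb => by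
    refine (primitive_sub_le hφ ha hb).trans ?_
    calc φ a * (b - a) ≤ φ a * |b - a| := mul_le_mul_of_nonneg_left (le_abs_self _) (h0 a ha)
      _ ≤ _ := mul_le_mul_of_nonneg_right (hφ self_mem_Ici ha ha) (abs_nonneg _)
  refine (LipschitzOnWith.of_dist_le_mul (K := (φ e₀).toNNReal) fun x hx y hy => ?_).continuousOn
  rw [Real.coe_toNNReal _ (h0 e₀ self_mem_Ici), Real.dist_eq, Real.dist_eq, abs_le]
  have h1 := key y hy x hx
  have h2 := key x hx y hy
  rw [abs_sub_comm] at h2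
  constructor <;> linarith

/-- **Osgood's lemma**, for a modulus of continuity that may jump. -/
theorem osgood (hφ : AntitoneOn φ (Ici e₀)) (h0 : ∀ τ ∈ Ici e₀, 0 ≤ φ τ) {T : ℝ} {Y Y' A A' : ℝ → ℝ}
    (hYc : ContinuousOn Y (Ico 0 T)) (hAc : ContinuousOn A (Ico 0 T))
    (hY : ∀ t ∈ Ioo 0 T, HasDerivAt Y (Y' t) t) (hA : ∀ t ∈ Ioo 0 T, HasDerivAt A (A' t) t)
    (hYe : ∀ t ∈ Ico 0 T, e₀ ≤ Y t) (hle : ∀ t ∈ Ioo 0 T, φ (Y t) * Y' t ≤ A' t) {t : ℝ}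
    (ht : t ∈ Ico 0 T) :
    ∫ τ in e₀..Y t, φ τ ≤ (∫ τ in e₀..Y 0, φ τ) + (A t - A 0) := by
  set Φ : ℝ → ℝ := fun y => ∫ τ in e₀..y, φ τ
  have hΦc : ContinuousOn (fun t => Φ (Y t)) (Ico 0 T) := (continuousOn_primitive hφ h0).comp hYc hYe
  -- Derivatives exist only inside the interval, so the comparison starts at a > 0; continuity lets
  -- a tend to 0 afterwards.
  have step : ∀ a, 0 < a → a ≤ t → Φ (Y t) ≤ Φ (Y a) + (A t - A a) := fun a ha hat => by
    have hsub : Icc a t ⊆ Ioo 0 T := fun x hx => ⟨ha.trans_le hx.1, hx.2.trans_lt ht.2⟩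
    have hsub' : Icc a t ⊆ Ico 0 T := hsub.trans Ioo_subset_Ico_self
    refine image_le_of_liminf_slope_right_le_deriv_boundary (a := a) (b := t) (hΦc.mono hsub')
      (B := fun x => Φ (Y a) + (A x - A a)) (B' := A') (by simp)
      (continuousOn_const.add ((hAc.mono hsub').sub continuousOn_const)) (fun x hx => ?_)
      (fun x hx r hr => ?_) ⟨hat, le_rfl⟩
    · exact (((hA x (hsub (Ico_subset_Icc_self hx))).sub_const _).const_add _).hasDerivWithinAt
    · have hx' := hsub (Ico_subset_Icc_self hx)
      -- By `primitive_sub_le` the right slopes of Φ ∘ Y are at most φ(Y x) times those of `Y`,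
      -- which converge to a limit below A' x. No sign of Y' is required.
      have h1 : Tendsto (fun z => φ (Y x) * slope Y x z) (𝓝[>] x) (𝓝 (φ (Y x) * Y' x)) :=
        ((hasDerivAt_iff_tendsto_slope.1 (hY x hx')).mono_left
          (nhdsWithin_mono _ fun z hz => ne_of_gt hz)).const_mul _
      have h2 : ∀ᶠ z in 𝓝[>] x, φ (Y x) * slope Y x z < r :=
        h1.eventually_lt_const ((hle x hx').trans_lt hr)
      have h3 : ∀ᶠ z in 𝓝[>] x, z ∈ Ioo x T := Ioo_mem_nhdsGT hx'.2
      refine Eventually.frequently ?_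
      filter_upwards [h2, h3] with z hz hzT
      refine lt_of_le_of_lt ?_ hz
      have h4 := primitive_sub_le hφ (hYe x (Ioo_subset_Ico_self hx'))
        (hYe z ⟨(hx'.1.trans hzT.1).le, hzT.2⟩)
      rw [slope_def_field, slope_def_field, ← mul_div_assoc]
      exact div_le_div_of_nonneg_right h4 (sub_nonneg.2 hzT.1.le)
  rcases eq_or_lt_of_le ht.1 with h | h
  · rw [← h]; simp
  · have hc0 : Tendsto (fun a => Φ (Y a) + (A t - A a)) (𝓝[Ioo 0 T] 0) (𝓝 (Φ (Y 0) + (A t - A 0))) := by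
      have hm : (0 : ℝ) ∈ Ico 0 T := ⟨le_rfl, h.trans ht.2⟩
      exact (((hΦc 0 hm).mono Ioo_subset_Ico_self).tendsto).add
        (tendsto_const_nhds.sub (((hAc 0 hm).mono Ioo_subset_Ico_self).tendsto))
    have hne : (𝓝[Ioo 0 T] (0 : ℝ)).NeBot := by
      rw [nhdsWithin_Ioo_eq_nhdsGT (h.trans ht.2)]; infer_instance
    refine ge_of_tendsto hc0 ?_
    have : Iio t ∈ 𝓝[Ioo 0 T] (0 : ℝ) := nhdsWithin_le_nhds (Iio_mem_nhds h)
    filter_upwards [this, self_mem_nhdsWithin] with a ha1 ha2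
    exact step a ha2.1 (le_of_lt ha1)

/-- If the primitive never exceeded `B`, the nonnegative `φ` would be integrable up to infinity.
Beyond a point where it does exceed `B`, monotonicity excludes every `y`. -/
theorem exists_le_of_primitive_le (hφ : AntitoneOn φ (Ici e₀)) (h0 : ∀ τ ∈ Ici e₀, 0 ≤ φ τ)
    (hdiv : ∫⁻ τ in Ioi e₀, ENNReal.ofReal (φ τ) = ⊤) (B : ℝ) :
    ∃ Z, e₀ ≤ Z ∧ ∀ y, e₀ ≤ y → ∫ τ in e₀..y, φ τ ≤ B → y ≤ Z := by
  obtain ⟨Z, hZ, hBZ⟩ : ∃ Z, e₀ ≤ Z ∧ B < ∫ τ in e₀..Z, φ τ := by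
    by_contra! hcon
    have hi : IntegrableOn φ (Ioi e₀) := by
      refine integrableOn_Ioi_of_intervalIntegral_norm_bounded (l := atTop) (b := fun x : ℝ => x)
        B e₀ (fun x => ?_) tendsto_id ?_
      · rcases le_total e₀ x with h | h
        · exact (intervalIntegrable_iff_integrableOn_Ioc_of_le h).1
            (intervalIntegrable_of_antitoneOn hφ le_rfl h)
        · simp [Ioc_eq_empty_of_le h]
      · filter_upwards [eventually_ge_atTop e₀] with x hx
        refine le_trans (le_of_eq ?_) (hcon x hx)
        refine intervalIntegral.integral_congr fun τ hτ => ?_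
        rw [uIcc_of_le hx] at hτ
        exact Real.norm_of_nonneg (h0 τ hτ.1)
    exact hi.lintegral_lt_top.ne hdiv
  refine ⟨Z, hZ, fun y hy hyB => ?_⟩
  by_contra! h
  linarith [primitive_mono hφ h0 hZ h.le]

/-- Absorption of the nonlinear terms into the dissipation. -/
theorem absorb {ν n C₁ K a b c Λ H D M X X' : ℝ} (hν : 0 < ν) (hn : 0 ≤ n)
    (hC₁ : 0 ≤ C₁) (hK : 0 ≤ K) (hH : 1 ≤ H) (hD : 0 ≤ D) (hM : 0 ≤ M) (hX : 0 ≤ X)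
    (hΛ : Λ ≤ a + b + c) (ha : a ^ 2 ≤ C₁ * K) (hb : b ^ 2 ≤ C₁ * (H * D))
    (hc : c ^ 2 * (Real.exp 1 + X) ≤ C₁ * M) (hX' : X' + 2 * ν * M ≤ 6 * (n * Λ) * X) :
    X' + ν * M ≤ (3 * n * (C₁ * K + 1) + 3 * n * (C₁ + 1) + 9 * n ^ 2 * (C₁ + 1) / ν) *
      (1 + D) * H * (Real.exp 1 + X) := by
  have he : 0 < Real.exp 1 := Real.exp_pos 1
  set W := Real.exp 1 + X with hW
  have hW0 : 0 < W := by positivity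
  have hXW : X ≤ W := by linarith
  have hDH : 1 ≤ (1 + D) * H := by nlinarith
  have ta : 6 * (n * a) * X ≤ 3 * n * (C₁ * K + 1) * ((1 + D) * H * W) := by
    have h1 : 2 * a ≤ C₁ * K + 1 := by nlinarith [sq_nonneg (a - 1)]
    have h2 : 0 ≤ C₁ * K + 1 := by positivity
    calc 6 * (n * a) * X = 3 * n * (2 * a) * X := by ring
      _ ≤ 3 * n * (C₁ * K + 1) * X := by gcongr
      _ ≤ 3 * n * (C₁ * K + 1) * ((1 + D) * H * W) := by
        gcongr
        nlinarith
  have tb : 6 * (n * b) * X ≤ 3 * n * (C₁ + 1) * ((1 + D) * H * W) := by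
    -- Young's inequality 2bH ≤ b² + H², divided by H. This keeps the bound linear in `D`, whose
    -- time integral is the one that is controlled.
    have h1 : 2 * b ≤ C₁ * D + H := by
      have : 2 * b * H ≤ (C₁ * D + H) * H := by nlinarith [sq_nonneg (b - H)]
      exact le_of_mul_le_mul_right this (by linarith)
    have h2 : C₁ * D + H ≤ (C₁ + 1) * ((1 + D) * H) := by
      have h3 : D ≤ (1 + D) * H := by nlinarith
      have h4 : H ≤ (1 + D) * H := by nlinarith
      nlinarith [mul_le_mul_of_nonneg_left h3 hC₁]
    calc 6 * (n * b) * X = 3 * n * (2 * b) * X := by ring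
      _ ≤ 3 * n * ((C₁ + 1) * ((1 + D) * H)) * X :=
        mul_le_mul_of_nonneg_right (mul_le_mul_of_nonneg_left (h1.trans h2) (by positivity)) hX
      _ ≤ 3 * n * ((C₁ + 1) * ((1 + D) * H)) * W := by gcongr
      _ = _ := by ring
  have tc : 6 * (n * c) * X ≤ ν * M + 9 * n ^ 2 * (C₁ + 1) / ν * ((1 + D) * H * W) := by
    -- The weight in Young's inequality makes the c² term at most νM, half of the available
    -- dissipation. Using C₁ + 1 avoids a division by zero.
    have hl : 0 < ν / (C₁ + 1) := by positivity
    have h1 : 6 * n * c * W ≤ ν / (C₁ + 1) * (c ^ 2 * W) + 9 * n ^ 2 * (C₁ + 1) / ν * W := by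
      have h2 : 0 ≤ (ν / (C₁ + 1) * c - 3 * n) ^ 2 * ((C₁ + 1) / ν * W) := by positivity
      have h3 : (ν / (C₁ + 1) * c - 3 * n) ^ 2 * ((C₁ + 1) / ν * W) =
        ν / (C₁ + 1) * (c ^ 2 * W) + 9 * n ^ 2 * (C₁ + 1) / ν * W - 6 * n * c * W := by
        field_simp; ring
      linarith
    have h4 : ν / (C₁ + 1) * (c ^ 2 * W) ≤ ν * M := by
      calc _ ≤ ν / (C₁ + 1) * (C₁ * M) := by gcongr
        _ = ν * M * (C₁ / (C₁ + 1)) := by ring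
        _ ≤ ν * M * 1 := by
          gcongr
          rw [div_le_one (by positivity)]; linarith
        _ = _ := by ring
    have h5 : 9 * n ^ 2 * (C₁ + 1) / ν * W ≤ 9 * n ^ 2 * (C₁ + 1) / ν * ((1 + D) * H * W) := by
      gcongr
      nlinarith
    rcases le_total 0 c with h0 | h0
    · calc 6 * (n * c) * X ≤ 6 * (n * c) * W := by gcongr
        _ ≤ _ := by linarith
    · have h6 : 6 * (n * c) * X ≤ 0 := by
        have := mul_nonneg (mul_nonneg hn (neg_nonneg.2 h0)) hX
        linarith
      have : 0 ≤ ν * M + 9 * n ^ 2 * (C₁ + 1) / ν * ((1 + D) * H * W) := by positivity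
      linarith
  have hΛX : 6 * (n * Λ) * X ≤ 6 * (n * (a + b + c)) * X := by gcongr
  have e1 : 6 * (n * (a + b + c)) * X = 6 * (n * a) * X + 6 * (n * b) * X + 6 * (n * c) * X := by ring
  nlinarith

end Osgood
end MHD

namespace MHD
open scoped SchwartzMap InnerProductSpace ContDiff

/-! ### Finiteness on closed intervals and the a priori bound. -/

section Main
variable {N : ℕ} {ν s : ℝ} {m : Sp N → ℝ} {u b : ℝ → Sp N → Sp N}

theorem sobolevNormSq_le_add {s : ℝ} {v w : Sp N → Sp N} (hv : IsL2 v) (hw : IsL2 w) :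
    sobolevNormSq s v ≤ 2 * (sobolevNormSq s (v - w) + sobolevNormSq s w) := by
  have hm : Measurable fun ξ : Sp N => ENNReal.ofReal (weight s ξ) :=
    (continuous_weight s).measurable.ennreal_ofReal
  have hmw : AEMeasurable (fun ξ => ENNReal.ofReal (weight s ξ) * ‖hat w ξ‖ₑ ^ 2) volume :=
    hm.aemeasurable.mul ((hat_enorm_aemeasurable w).pow_const 2)
  simp only [sobolevNormSq_eq]
  rw [← lintegral_add_right' _ hmw,
    ← lintegral_const_mul' _ _ (by simp)]
  refine lintegral_mono_ae ?_
  filter_upwards [hat_sub hv hw] with ξ h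
  rw [h, ← mul_add, mul_left_comm]
  gcongr
  calc ‖hat v ξ‖ₑ ^ 2 ≤ (‖hat v ξ - hat w ξ‖ₑ + ‖hat w ξ‖ₑ) ^ 2 := by
        gcongr
        calc ‖hat v ξ‖ₑ = ‖(hat v ξ - hat w ξ) + hat w ξ‖ₑ := by rw [sub_add_cancel]
          _ ≤ _ := enorm_add_le _ _
    _ ≤ _ := by
      have h2 := ENNReal.rpow_add_le_mul_rpow_add_rpow ‖hat v ξ - hat w ξ‖ₑ ‖hat w ξ‖ₑ
        (p := 2) (by norm_num)
      norm_num at h2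
      exact h2

/-- Continuity is formulated through differences, so the norm is bounded near each time by
`sobolevNormSq_le_add`, and compactness patches the local bounds. -/
theorem IsContinuousInSobolev.exists_bound {I : Set ℝ} (hI : IsCompact I) {v : ℝ → Sp N → Sp N}
    (hv : IsContinuousInSobolev s I v) : ∃ C : ℝ≥0∞, C < ⊤ ∧ ∀ t ∈ I, sobolevNormSq s (v t) ≤ C := by
  refine hI.induction_on (p := fun S => ∃ C : ℝ≥0∞, C < ⊤ ∧ ∀ t ∈ S, sobolevNormSq s (v t) ≤ C)
    ⟨0, by simp, by simp⟩ (fun S S' h ⟨C, hC, h'⟩ => ⟨C, hC, fun t ht => h' t (h ht)⟩)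
    (fun S S' ⟨C, hC, h⟩ ⟨C', hC', h'⟩ => ⟨max C C', max_lt hC hC', fun t ht => ?_⟩) fun t₀ ht₀ => ?_
  · rcases ht with ht | ht
    · exact (h t ht).trans (le_max_left _ _)
    · exact (h' t ht).trans (le_max_right _ _)
  · have h1 := (hv.continuous t₀ ht₀).eventually_lt_const (zero_lt_one)
    refine ⟨_, Filter.inter_mem h1 self_mem_nhdsWithin, 2 * (1 + sobolevNormSq s (v t₀)), ?_, ?_⟩
    · exact ENNReal.mul_lt_top (by simp) (ENNReal.add_lt_top.2 ⟨by simp, hv.sobolev t₀ ht₀⟩)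
    · rintro t ⟨ht1, ht2⟩
      refine (sobolevNormSq_le_add (hv.isL2 t ht2) (hv.isL2 t₀ ht₀)).trans ?_
      have : sobolevNormSq s (v t - v t₀) ≤ 1 := le_of_lt ht1
      gcongr

theorem IsSolution.gradNormSq_eq {I : Set ℝ} (hs : 3 + (N : ℝ) ≤ s) (h : IsSolution ν m s I u b)
    {t : ℝ} (ht : t ∈ I) : gradNormSq (u t) + gradNormSq (b t) =
      ENNReal.ofReal (gradSq (u t) + gradSq (b t)) := by
  rw [((h.u_sobolev.hasMoments hs ht).mono le_rfl).gradNormSq_eq,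
    ((h.b_sobolev.hasMoments hs ht).mono le_rfl).gradNormSq_eq,
    ENNReal.ofReal_add (gradSq_nonneg _) (gradSq_nonneg _)]

/-- If `G - X` grows at least as fast as the dissipation, then the dissipation is integrable. -/
theorem IsSolution.lintegral_mult_le {T : ℝ} (hT : 0 < T) (hν : 0 < ν) {I : Set ℝ}
    (hI : I =ᵐ[volume] Ioo 0 T) {G G' X X' : ℝ → ℝ} {C : ℝ}
    (hfin : ∀ t ∈ Ioo 0 T, multGradNormSq m (u t) < ⊤)
    (hG : ∀ t ∈ Ioo 0 T, HasDerivAt G (G' t) t) (hX : ∀ t ∈ Ioo 0 T, HasDerivAt X (X' t) t)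
    (hle : ∀ t ∈ Ioo 0 T, X' t + ν * (multGradNormSq m (u t)).toReal ≤ G' t)
    (hC : ∀ t ∈ Ioo 0 T, ∀ r ∈ Ioo 0 T, (G r - X r) - (G t - X t) ≤ C) :
    ∫⁻ t in I, multGradNormSq m (u t) ≤ ENNReal.ofReal (C / ν) := by
  rw [Measure.restrict_congr_set hI]
  have h1 := lintegral_deriv_le hT (f := fun t => ν⁻¹ * (G t - X t))
    (f' := fun t => ν⁻¹ * (G' t - X' t)) (C := C / ν)
    (fun t ht => ((hG t ht).sub (hX t ht)).const_mul _) (fun t ht => ?_) fun t ht r hr => ?_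
  · refine le_trans (setLIntegral_mono' measurableSet_Ioo fun t ht => ?_) h1
    rw [← ENNReal.ofReal_toReal (hfin t ht).ne]
    refine ENNReal.ofReal_le_ofReal ?_
    rw [le_inv_mul_iff₀ hν]
    linarith [hle t ht]
  · have : 0 ≤ (multGradNormSq m (u t)).toReal := ENNReal.toReal_nonneg
    have := hle t ht
    have : 0 ≤ G' t - X' t := by nlinarith
    positivity
  · have := hC t ht r hr
    calc _ = ν⁻¹ * ((G r - X r) - (G t - X t)) := by ring
      _ ≤ ν⁻¹ * C := by gcongr
      _ = C / ν := by ring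

/-- By compactness the Hˢ norm of `u`, hence Λ, and X are bounded on the whole interval. Then X' +
2νM is at most a constant, and integration bounds the integral of M. -/
theorem IsSolution.energyH1_lt_top (hN : N ≠ 0) (hν : 0 < ν) (hs : 3 + (N : ℝ) ≤ s) {T : ℝ}
    (hT : 0 < T) (hm : Measurable m) (h : IsSolution ν m s (Icc 0 T) u b) :
    energyH1 m (Icc 0 T) u b < ⊤ := by
  have hXc := h.continuousOn_gradSq hs
  obtain ⟨B, hB⟩ := isCompact_Icc.exists_bound_of_continuousOn hXc
  have hX0 : ∀ t, 0 ≤ gradSq (u t) + gradSq (b t) := fun t =>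
    add_nonneg (gradSq_nonneg _) (gradSq_nonneg _)
  have hBle : ∀ t ∈ Icc 0 T, gradSq (u t) + gradSq (b t) ≤ B := fun t ht =>
    (le_abs_self _).trans (hB t ht)
  have hB0 : 0 ≤ B := (hX0 0).trans (hBle 0 ⟨le_rfl, hT.le⟩)
  obtain ⟨S, hS, hSu⟩ := h.u_sobolev.exists_bound isCompact_Icc
  set L : ℝ≥0∞ := ENNReal.ofReal (2 * Real.pi) ^ 2 *
    ((∫⁻ ξ : Sp N, ENNReal.ofReal ((1 + ‖ξ‖) ^ 4 / weight s ξ)) * S) with hL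
  have hLt : L < ⊤ := ENNReal.mul_lt_top (ENNReal.pow_lt_top ENNReal.ofReal_lt_top)
    (ENNReal.mul_lt_top (lintegral_pow_div_weight_lt_top hs) hS)
  have hΛ : ∀ t ∈ Icc 0 T, (freqL1 (u t)).toReal ≤ 1 + L.toReal := fun t ht => by
    have h1 : freqL1 (u t) ^ 2 ≤ L := (freqL1_sq_le s (u t)).trans (by
      rw [hL]; gcongr; exact hSu t ht)
    have h2 := ENNReal.toReal_mono hLt.ne h1
    rw [ENNReal.toReal_pow] at h2
    nlinarith [sq_nonneg ((freqL1 (u t)).toReal - 1)]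
  have hint : interior (Icc 0 T) = Ioo 0 T := interior_Icc
  have hd := fun t (ht : t ∈ Ioo 0 T) => h.hasDerivAt_gradSq hN hs hm (hint ▸ ht)
  choose! hfin X' hX' hle using hd
  set C₁ := 6 * (N * (1 + L.toReal)) * B
  have hC₁ : 0 ≤ C₁ := by positivity
  have key := lintegral_mult_le (u := u) (m := m) hT hν (I := Icc 0 T) Ioo_ae_eq_Icc.symm
    (G := fun t => C₁ * t) (G' := fun _ => C₁)
    (X := fun t => gradSq (u t) + gradSq (b t)) (X' := X') (C := C₁ * T + B) hfin
    (fun t _ => by simpa using (hasDerivAt_id t).const_mul C₁) hX' (fun t ht => ?_)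
    fun t ht r hr => ?_
  · rw [energyH1]
    refine ENNReal.add_lt_top.2 ⟨lt_of_le_of_lt (b := ENNReal.ofReal B) (iSup₂_le fun t ht => ?_)
      ENNReal.ofReal_lt_top, key.trans_lt ENNReal.ofReal_lt_top⟩
    rw [h.gradNormSq_eq hs ht]
    exact ENNReal.ofReal_le_ofReal (hBle t ht)
  · have h1 := hle t ht
    have ht' := Ioo_subset_Icc_self ht
    have h2 : 6 * (N * (freqL1 (u t)).toReal) * (gradSq (u t) + gradSq (b t)) ≤ C₁ := by
      refine mul_le_mul ?_ (hBle t ht') (hX0 t) (by positivity)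
      have := hΛ t ht'
      gcongr
    have : 0 ≤ ν * (multGradNormSq m (u t)).toReal := mul_nonneg hν.le ENNReal.toReal_nonneg
    linarith
  · have h1 := hBle t (Ioo_subset_Icc_self ht)
    have h2 := hX0 r
    have h3 : C₁ * r ≤ C₁ * T := by gcongr; exact hr.2.le
    have h4 : 0 ≤ C₁ * t := mul_nonneg hC₁ ht.1.le
    linarith

theorem kinetic_le_sobolev (hs : 0 ≤ s) (v w : Sp N → Sp N) :
    ENNReal.ofReal (kinetic v w) ≤ sobolevNormSq s v + sobolevNormSq s w := by
  have h : ∀ v : Sp N → Sp N, ENNReal.ofReal (⟪toL2 v, toL2 v⟫_ℂ).re ≤ sobolevNormSq s v := fun v => by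
    have e : (⟪toL2 v, toL2 v⟫_ℂ).re = ‖toL2 v‖ ^ 2 := inner_self_eq_norm_sq (𝕜 := ℂ) _
    rw [e, ENNReal.ofReal_pow (norm_nonneg _), ofReal_norm, enorm_sq_eq_lintegral]
    refine le_trans (le_of_eq ?_) (lintegral_le_sobolevNormSq (f := fun _ => 1) fun ξ => ?_)
    · simp [hat]
    · rw [← ENNReal.ofReal_one]
      exact ENNReal.ofReal_le_ofReal (one_le_weight hs ξ)
  have h0 : ∀ v : Sp N → Sp N, 0 ≤ (⟪toL2 v, toL2 v⟫_ℂ).re := fun v => inner_self_nonneg (𝕜 := ℂ)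
  rw [kinetic, ENNReal.ofReal_add (h0 v) (h0 w)]
  exact add_le_add (h v) (h w)

theorem antitoneOn_osgood_density {g : ℝ → ℝ} (hg_mono : MonotoneOn g (Ioi 0))
    (hg_one : ∀ r, 0 < r → 1 ≤ g r) :
    AntitoneOn (fun τ => 1 / (g τ ^ 2 * Real.log τ * τ)) (Ici (Real.exp 1)) := by
  intro x hx y hy hxy
  have hx0 : 0 < x := (Real.exp_pos 1).trans_le hx
  have hy0 : 0 < y := hx0.trans_le hxy
  have hlx : 1 ≤ Real.log x := (Real.le_log_iff_exp_le hx0).2 hx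
  have hll : Real.log x ≤ Real.log y := Real.log_le_log hx0 hxy
  have h1 := hg_one x hx0
  have h2 : g x ≤ g y := hg_mono hx0 hy0 hxy
  have hly : 0 ≤ Real.log y := by linarith
  simp only
  gcongr

/-- The exponent is made nonnegative so that the power is at least 1 on [1, ∞); a multiple of it
then also dominates `g` on the bounded range not covered by the asymptotic bound. -/
theorem exists_power_bound {g : ℝ → ℝ} (hg_mono : MonotoneOn g (Ioi 0))
    (hg_one : ∀ r, 0 < r → 1 ≤ g r) {p : ℝ} (hp : g =O[atTop] fun r : ℝ => r ^ p) :
    ∃ G, ∀ r, 1 ≤ r → g r ≤ G * r ^ (max p 0) := by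
  obtain ⟨c, hc⟩ := hp.bound
  obtain ⟨r₁, hr₁⟩ := eventually_atTop.1 hc
  have hr0 : 0 < max r₁ 1 := lt_max_of_lt_right one_pos
  refine ⟨|c| + g (max r₁ 1), fun r hr => ?_⟩
  have h1 : 1 ≤ r ^ (max p 0) := Real.one_le_rpow hr (le_max_right _ _)
  have hg1 := hg_one _ hr0
  have hrp : (0 : ℝ) < r := by linarith
  rcases le_total (max r₁ 1) r with h | h
  · have h2 := hr₁ r ((le_max_left _ _).trans h)
    have h3 : r ^ p ≤ r ^ (max p 0) := Real.rpow_le_rpow_of_exponent_le hr (le_max_left _ _)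
    rw [Real.norm_of_nonneg (Real.rpow_nonneg hrp.le p)] at h2
    calc g r ≤ c * r ^ p := (le_abs_self _).trans h2
      _ ≤ |c| * r ^ (max p 0) :=
        mul_le_mul (le_abs_self c) h3 (Real.rpow_nonneg hrp.le p) (abs_nonneg c)
      _ ≤ _ := by
        have : 0 ≤ g (max r₁ 1) * r ^ (max p 0) := by positivity
        linarith
  · calc g r ≤ g (max r₁ 1) := hg_mono hrp hr0 h
      _ ≤ g (max r₁ 1) * r ^ (max p 0) := le_mul_of_one_le_right (by linarith) h1
      _ ≤ _ := by
        have : 0 ≤ |c| * r ^ (max p 0) := by positivity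
        linarith

/-- The differential inequality for the `H¹` energy, with a dissipation rate in place of the
supremum of `∇u`. -/
theorem IsSolution.exists_deriv_gradSq_le {α : ℝ} (hN : N ≠ 0) (hν : 0 < ν)
    (hα : 1 + (N : ℝ) / 2 ≤ α) (hs : 3 + (N : ℝ) ≤ s) {g : ℝ → ℝ} (hg_mono : MonotoneOn g (Ioi 0))
    (hg_one : ∀ r, 0 < r → 1 ≤ g r) {p G δ κ : ℝ} (hG : ∀ r, 1 ≤ r → g r ≤ G * r ^ p)
    (hδ : 0 < δ) (hpδ : 4 * δ = 2 * α - 2 * p - N) (hκ : 1 ≤ κ) (hκδ : 1 ≤ 2 * δ * κ)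
    (R K : ℝ) (hK : 0 ≤ K) :
    ∃ C : ℝ, 0 ≤ C ∧ ∀ m : Sp N → ℝ, Measurable m → LowerBoundFrom α g R m →
      ∀ (I : Set ℝ) (u b : ℝ → Sp N → Sp N), IsSolution ν m s I u b → ∀ t ∈ interior I,
        kinetic (u t) (b t) ≤ K → multGradNormSq m (u t) < ⊤ ∧ ∃ X' : ℝ,
          HasDerivAt (fun τ => gradSq (u τ) + gradSq (b τ)) X' t ∧
          X' + ν * (multGradNormSq m (u t)).toReal ≤ C * (1 + (dissip m (u t)).toReal) *
            (g ((Real.exp 1 + (gradSq (u t) + gradSq (b t))) ^ κ) ^ 2 *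
              Real.log ((Real.exp 1 + (gradSq (u t) + gradSq (b t))) ^ κ)) *
            (Real.exp 1 + (gradSq (u t) + gradSq (b t))) := by
  obtain ⟨C₁, hC₁, hsplit⟩ := freqL1_split hα hg_mono hg_one hN hG hδ hpδ R
  refine ⟨3 * N * (C₁ * K + 1) + 3 * N * (C₁ + 1) + 9 * (N : ℝ) ^ 2 * (C₁ + 1) / ν, by positivity,
    fun m hm hlow I u b h t ht hE => ?_⟩
  obtain ⟨hM, X', hX', hle⟩ := h.hasDerivAt_gradSq hN hs hm ht
  refine ⟨hM, X', hX', ?_⟩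
  have hD := (h.hasDerivAt_kinetic hN hs ht).1
  set X := gradSq (u t) + gradSq (b t) with hX
  have hX0 : 0 ≤ X := add_nonneg (gradSq_nonneg _) (gradSq_nonneg _)
  have he : 1 ≤ Real.exp 1 := Real.one_le_exp zero_le_one
  set W := Real.exp 1 + X with hW
  have hWe : Real.exp 1 ≤ W := by linarith
  have hW1 : 1 ≤ W := by linarith
  have hW0 : 0 < W := by linarith
  have hWY : W ≤ W ^ κ := Real.self_le_rpow_of_one_le hW1 hκ
  -- The cut-off depends on the solution. From κ ≥ 1 one has Y ≥ W ≥ e, hence log Y ≥ 1; from 2δκ ≥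
  -- 1 one has Y^(-2δ) W ≤ 1, which is what lets the high frequencies be absorbed.
  set Y := W ^ κ with hY
  have hY0 : 0 < Y := by linarith
  obtain ⟨a, β, c, -, -, -, hΛ, ha, hb, hc⟩ := hsplit m hm hlow (u t)
    ((h.u_sobolev.hasMoments hs (interior_subset ht)).mono le_rfl) hD hM Y (by linarith)
  have hlog : 1 ≤ Real.log Y := (Real.le_log_iff_exp_le hY0).2 (hWe.trans hWY)
  have hg1 := hg_one Y hY0
  have hH : 1 ≤ g Y ^ 2 * Real.log Y := one_le_mul_of_one_le_of_one_le (one_le_pow₀ hg1) hlog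
  have hu : (⟪toL2 (u t), toL2 (u t)⟫_ℂ).re ≤ K := by
    have : 0 ≤ (⟪toL2 (b t), toL2 (b t)⟫_ℂ).re := inner_self_nonneg (𝕜 := ℂ)
    rw [kinetic] at hE
    linarith
  have hYW : Y ^ (-2 * δ) * W ≤ 1 := by
    rw [hY, ← Real.rpow_mul hW0.le]
    calc W ^ (κ * (-2 * δ)) * W ≤ W ^ (-1 : ℝ) * W := by
          gcongr
          linarith
      _ = 1 := by rw [Real.rpow_neg_one, inv_mul_cancel₀ hW0.ne']
  have hM0 : 0 ≤ (multGradNormSq m (u t)).toReal := ENNReal.toReal_nonneg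
  refine absorb hν (Nat.cast_nonneg N) hC₁ hK hH ENNReal.toReal_nonneg hM0 hX0 hΛ
    (ha.trans (by gcongr)) hb ?_ hle
  calc c ^ 2 * W ≤ C₁ * (Y ^ (-2 * δ) * (multGradNormSq m (u t)).toReal) * W := by gcongr
    _ = C₁ * (multGradNormSq m (u t)).toReal * (Y ^ (-2 * δ) * W) := by ring
    _ ≤ C₁ * (multGradNormSq m (u t)).toReal * 1 := by gcongr
    _ = _ := mul_one _

/-- The kinetic energy does not increase. -/
theorem IsSolution.antitoneOn_kinetic (hN : N ≠ 0) (hν : 0 < ν) (hs : 3 + (N : ℝ) ≤ s) {T : ℝ}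
    (h : IsSolution ν m s (Ico 0 T) u b) :
    AntitoneOn (fun t => kinetic (u t) (b t)) (Ico 0 T) := by
  refine antitoneOn_of_deriv_nonpos (convex_Ico 0 T) (h.continuousOn_kinetic hs)
    (fun t ht => (h.hasDerivAt_kinetic hN hs ht).2.differentiableAt.differentiableWithinAt)
    fun t ht => ?_
  rw [(h.hasDerivAt_kinetic hN hs ht).2.deriv]
  have : 0 ≤ ν * (dissip m (u t)).toReal := mul_nonneg hν.le ENNReal.toReal_nonneg
  linarith

/-- Osgood's argument: a differential inequality whose right hand side is linear in the dissipation
of the kinetic energy bounds the `H¹` energy, by a constant that depends only on the data. -/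
theorem IsSolution.exists_energyH1_le {g : ℝ → ℝ} (hg_mono : MonotoneOn g (Ioi 0))
    (hg_one : ∀ r, 0 < r → 1 ≤ g r)
    (hg_div : ∫⁻ τ in Ioi (Real.exp 1), ENNReal.ofReal (1 / (g τ ^ 2 * Real.log τ * τ)) = ⊤)
    (hN : N ≠ 0) (hν : 0 < ν) (hs : 3 + (N : ℝ) ≤ s) {T K κ C₃ : ℝ}
    (hκ : 1 ≤ κ) (hC₃ : 0 ≤ C₃) :
    ∃ C : ℝ≥0, ∀ (m : Sp N → ℝ) (T' : ℝ), 0 < T' → T' ≤ T → ∀ u b : ℝ → Sp N → Sp N,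
      IsSolution ν m s (Ico 0 T') u b →
      kinetic (u 0) (b 0) ≤ K → gradSq (u 0) + gradSq (b 0) ≤ K →
      (∀ t ∈ Ioo 0 T', multGradNormSq m (u t) < ⊤ ∧ ∃ X' : ℝ,
          HasDerivAt (fun τ => gradSq (u τ) + gradSq (b τ)) X' t ∧
          X' + ν * (multGradNormSq m (u t)).toReal ≤ C₃ * (1 + (dissip m (u t)).toReal) *
            (g ((Real.exp 1 + (gradSq (u t) + gradSq (b t))) ^ κ) ^ 2 *
              Real.log ((Real.exp 1 + (gradSq (u t) + gradSq (b t))) ^ κ)) *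
            (Real.exp 1 + (gradSq (u t) + gradSq (b t)))) →
      energyH1 m (Ico 0 T') u b ≤ C := by
  set φ : ℝ → ℝ := fun τ => 1 / (g τ ^ 2 * Real.log τ * τ) with hφdef
  have hφ : AntitoneOn φ (Ici (Real.exp 1)) := antitoneOn_osgood_density hg_mono hg_one
  have he : 1 ≤ Real.exp 1 := Real.one_le_exp zero_le_one
  have hφ0 : ∀ τ ∈ Ici (Real.exp 1), 0 ≤ φ τ := fun τ hτ => by
    have h1 : 1 ≤ τ := he.trans hτ
    have := Real.log_nonneg h1
    have : 0 ≤ τ := by linarith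
    simp only [hφdef]
    positivity
  -- The threshold is the right side of Osgood's inequality in the worst case: Y(0) ≤ (e + K)^κ, and
  -- the integral of 1 + D is at most T + K/(2ν).
  obtain ⟨Z, hZe, hZ⟩ := exists_le_of_primitive_le hφ hφ0 hg_div
    ((∫ τ in Real.exp 1..(Real.exp 1 + K) ^ κ, φ τ) + κ * C₃ * (T + K / (2 * ν)))
  have hZ0 : 0 < Z := by linarith
  set C₄ := C₃ * (g Z ^ 2 * Real.log Z) * Z with hC₄
  have hlogZ : 0 ≤ Real.log Z := Real.log_nonneg (by linarith)
  have hC₄0 : 0 ≤ C₄ := by positivity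
  refine ⟨Z.toNNReal + ((C₄ * (T + K / (2 * ν)) + Z) / ν).toNNReal,
    fun m T' hT' hTT u b h hE0 hX0K hineq => ?_⟩
  choose! hfin X' hX' hle using hineq
  have hanti := h.antitoneOn_kinetic hN hν hs
  have hE : ∀ t, 0 ≤ kinetic (u t) (b t) := fun t => kinetic_nonneg _ _
  have h0mem : (0 : ℝ) ∈ Ico 0 T' := ⟨le_rfl, hT'⟩
  have hEK : ∀ t ∈ Ico 0 T', kinetic (u t) (b t) ≤ K := fun t ht =>
    (hanti h0mem ht ht.1).trans hE0
  set X : ℝ → ℝ := fun t => gradSq (u t) + gradSq (b t) with hX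
  have hX0 : ∀ t, 0 ≤ X t := fun t => add_nonneg (gradSq_nonneg _) (gradSq_nonneg _)
  set D : ℝ → ℝ := fun t => (dissip m (u t)).toReal with hD
  set M : ℝ → ℝ := fun t => (multGradNormSq m (u t)).toReal with hM
  have hD0 : ∀ t, 0 ≤ D t := fun t => ENNReal.toReal_nonneg
  have hM0 : ∀ t, 0 ≤ M t := fun t => ENNReal.toReal_nonneg
  have hEd : ∀ t ∈ Ioo 0 T', HasDerivAt (fun τ => kinetic (u τ) (b τ)) (-2 * ν * D t) t :=
    fun t ht => (h.hasDerivAt_kinetic hN hs (by rwa [interior_Ico])).2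
  -- A primitive of 1 + D, by the kinetic energy balance. It stands in for the time integral of `D`,
  -- so no integrability of `D` has to be discussed.
  set S : ℝ → ℝ := fun t => t - kinetic (u t) (b t) / (2 * ν) with hS
  have hSc : ContinuousOn S (Ico 0 T') :=
    continuousOn_id.sub ((h.continuousOn_kinetic hs).div_const _)
  have hSd : ∀ t ∈ Ioo 0 T', HasDerivAt S (1 + D t) t := fun t ht => by
    refine ((hasDerivAt_id t).sub ((hEd t ht).div_const (2 * ν))).congr_deriv ?_
    field_simp
    ring
  have hSle : ∀ t ∈ Ico 0 T', ∀ r ∈ Ico 0 T', S r - S t ≤ T + K / (2 * ν) := fun t ht r hr => by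
    have h1 : kinetic (u t) (b t) / (2 * ν) ≤ K / (2 * ν) := by gcongr; exact hEK t ht
    have h2 : 0 ≤ kinetic (u r) (b r) / (2 * ν) := div_nonneg (hE r) (by positivity)
    have h3 := hr.2
    have h4 := ht.1
    simp only [hS]
    linarith
  set W : ℝ → ℝ := fun t => Real.exp 1 + X t with hW
  have hWe : ∀ t, Real.exp 1 ≤ W t := fun t => le_add_of_nonneg_right (hX0 t)
  have hW0 : ∀ t, 0 < W t := fun t => (Real.exp_pos 1).trans_le (hWe t)
  have hWY : ∀ t, W t ≤ W t ^ κ := fun t => Real.self_le_rpow_of_one_le (he.trans (hWe t)) hκ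
  have hYe : ∀ t, Real.exp 1 ≤ W t ^ κ := fun t => (hWe t).trans (hWY t)
  have hY0 : ∀ t, 0 < W t ^ κ := fun t => (hW0 t).trans_le (hWY t)
  have hlog : ∀ t, 1 ≤ Real.log (W t ^ κ) := fun t =>
    (Real.le_log_iff_exp_le (hY0 t)).2 (hYe t)
  have hYc : ContinuousOn (fun t => W t ^ κ) (Ico 0 T') :=
    (continuousOn_const.add (h.continuousOn_gradSq hs)).rpow_const fun t _ => Or.inl (hW0 t).ne'
  have hYd : ∀ t ∈ Ioo 0 T', HasDerivAt (fun t => W t ^ κ) (X' t * κ * W t ^ (κ - 1)) t :=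
    fun t ht => ((hX' t ht).const_add _).rpow_const (Or.inl (hW0 t).ne')
  have hYZ : ∀ t ∈ Ico 0 T', W t ^ κ ≤ Z := fun t ht => by
    refine hZ _ (hYe t) ((osgood hφ hφ0 hYc (A := fun t => κ * C₃ * S t)
      (continuousOn_const.mul hSc) hYd
      (fun t ht => (hSd t ht).const_mul (κ * C₃)) (fun t _ => hYe t) (fun t ht => ?_) ht).trans ?_)
    · have hg1 := hg_one _ (hY0 t)
      have hl := hlog t
      have hw := hW0 t
      have hH0 : 0 < g (W t ^ κ) ^ 2 * Real.log (W t ^ κ) := by positivity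
      have hsplit : W t ^ κ = W t ^ (κ - 1) * W t := by
        rw [← Real.rpow_add_one hw.ne', sub_add_cancel]
      have hwp : 0 < W t ^ (κ - 1) := Real.rpow_pos_of_pos hw _
      -- Since Y'/Y = κW'/W, the power of W cancels against the factor τ in the density and only the
      -- constant κ remains.
      have e : φ (W t ^ κ) * (X' t * κ * W t ^ (κ - 1)) =
          κ * (X' t / (g (W t ^ κ) ^ 2 * Real.log (W t ^ κ) * W t)) := by
        have : φ (W t ^ κ) =
            1 / (g (W t ^ κ) ^ 2 * Real.log (W t ^ κ) * (W t ^ (κ - 1) * W t)) := by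
          rw [← hsplit]
        rw [this]
        field_simp
      rw [e, mul_assoc κ]
      refine mul_le_mul_of_nonneg_left ?_ (by linarith)
      rw [div_le_iff₀ (by positivity), ← mul_assoc]
      have := mul_nonneg hν.le (hM0 t)
      linarith [hle t ht]
    · have h1 : ∫ τ in Real.exp 1..W 0 ^ κ, φ τ ≤
          ∫ τ in Real.exp 1..(Real.exp 1 + K) ^ κ, φ τ := by
        refine primitive_mono hφ hφ0 (hYe 0) (Real.rpow_le_rpow (hW0 0).le ?_ (by linarith))
        exact add_le_add_right hX0K _
      have h2 : κ * C₃ * (S t - S 0) ≤ κ * C₃ * (T + K / (2 * ν)) :=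
        mul_le_mul_of_nonneg_left (hSle 0 h0mem t ht) (by positivity)
      linarith
  have hXZ : ∀ t ∈ Ico 0 T', X t ≤ Z := fun t ht => by
    have h1 := (hWY t).trans (hYZ t ht)
    simp only [hW] at h1
    linarith
  rw [energyH1, ENNReal.coe_add]
  refine add_le_add (iSup₂_le fun t ht => ?_) ?_
  · rw [h.gradNormSq_eq hs ht]
    exact ENNReal.ofReal_le_ofReal (hXZ t ht)
  · refine lintegral_mult_le hT' hν Ioo_ae_eq_Ico.symm (G := fun t => C₄ * S t) (X := X) hfin
      (fun t ht => (hSd t ht).const_mul C₄) hX' (fun t ht => (hle t ht).trans ?_)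
      fun t ht r hr => ?_
    · have hi := Ioo_subset_Ico_self ht
      have h1 : W t ≤ Z := (hWY t).trans (hYZ t hi)
      have h2 : g (W t ^ κ) ≤ g Z := hg_mono (hY0 t) hZ0 (hYZ t hi)
      have h3 : Real.log (W t ^ κ) ≤ Real.log Z := Real.log_le_log (hY0 t) (hYZ t hi)
      have h4 := hD0 t
      have h5 := hg_one _ (hY0 t)
      have h6 := hlog t
      have h7 := hW0 t
      calc C₃ * (1 + D t) * (g (W t ^ κ) ^ 2 * Real.log (W t ^ κ)) * W t
          ≤ C₃ * (1 + D t) * (g Z ^ 2 * Real.log Z) * Z := by gcongr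
        _ = C₄ * (1 + D t) := by rw [hC₄]; ring
    · have h1 := mul_le_mul_of_nonneg_left
        (hSle t (Ioo_subset_Ico_self ht) r (Ioo_subset_Ico_self hr)) hC₄0
      have h2 := hXZ t (Ioo_subset_Ico_self ht)
      have h3 := hX0 r
      linarith

theorem IsSolution.exists_apriori_bound {α : ℝ} (hN : N ≠ 0) (hν : 0 < ν)
    (hα : 1 + (N : ℝ) / 2 ≤ α) {g : ℝ → ℝ} (hg_mono : MonotoneOn g (Ioi 0))
    (hg_one : ∀ r, 0 < r → 1 ≤ g r)
    (hg_div : ∫⁻ τ in Ioi (Real.exp 1), ENNReal.ofReal (1 / (g τ ^ 2 * Real.log τ * τ)) = ⊤)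
    (hs : 3 + (N : ℝ) ≤ s) (T : ℝ) {p : ℝ} (hp : p < α - (N : ℝ) / 2)
    (hgp : g =O[atTop] fun r : ℝ => r ^ p) (R : ℝ) (K : ℝ≥0) :
    ∃ C : ℝ≥0, ∀ m : Sp N → ℝ, Measurable m → LowerBoundFrom α g R m → ∀ T', 0 < T' → T' ≤ T →
      ∀ u b : ℝ → Sp N → Sp N, IsSolution ν m s (Ico 0 T') u b →
        sobolevNormSq s (u 0) + sobolevNormSq s (b 0) ≤ K →
          energyH1 m (Ico 0 T') u b ≤ C := by
  obtain ⟨G, hG⟩ := exists_power_bound hg_mono hg_one hgp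
  have hp' : max p 0 < α - (N : ℝ) / 2 := max_lt hp (by linarith)
  -- Positivity of δ is the growth condition p < α - N/2, which also holds for the exponent 0 since
  -- α ≥ 1 + N/2.
  set δ := (2 * α - 2 * max p 0 - N) / 4 with hδdef
  have hδ : 0 < δ := by rw [hδdef]; linarith
  -- The smallest κ with κ ≥ 1 and 2δκ ≥ 1.
  set κ := max 1 (1 / (2 * δ)) with hκdef
  have hκ : 1 ≤ κ := le_max_left _ _
  have hκδ : 1 ≤ 2 * δ * κ := by
    have : 1 / (2 * δ) ≤ κ := le_max_right _ _
    rwa [div_le_iff₀' (by positivity)] at this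
  obtain ⟨C₃, hC₃, hineq⟩ := IsSolution.exists_deriv_gradSq_le (N := N) (ν := ν) (s := s) hN hν hα
    hs hg_mono hg_one hG hδ (by rw [hδdef]; ring) hκ hκδ R K K.2
  obtain ⟨C, hC⟩ := IsSolution.exists_energyH1_le (N := N) (ν := ν) (s := s) hg_mono hg_one hg_div
    hN hν hs (T := T) (K := K) hκ hC₃
  refine ⟨C, fun m hm hlow T' hT' hTT u b h hK => ?_⟩
  have hs1 : 1 ≤ s := by
    have : (0 : ℝ) ≤ N := Nat.cast_nonneg N
    linarith
  have h0mem : (0 : ℝ) ∈ Ico 0 T' := ⟨le_rfl, hT'⟩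
  have hE0 : kinetic (u 0) (b 0) ≤ K := by
    have := (kinetic_le_sobolev (by linarith) (u 0) (b 0)).trans hK
    rwa [ENNReal.ofReal_le_coe] at this
  have hX0 : gradSq (u 0) + gradSq (b 0) ≤ K := by
    have := (add_le_add
      (((h.u_sobolev.hasMoments hs h0mem).mono le_rfl).gradSq_le_sobolev hs1)
      (((h.b_sobolev.hasMoments hs h0mem).mono le_rfl).gradSq_le_sobolev hs1)).trans hK
    rwa [← ENNReal.ofReal_add (gradSq_nonneg _) (gradSq_nonneg _), ENNReal.ofReal_le_coe] at this
  refine hC m T' hT' hTT u b h hE0 hX0 fun t ht => ?_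
  have hmem : t ∈ interior (Ico 0 T') := by rwa [interior_Ico]
  exact hineq m hm hlow _ u b h t hmem
    ((h.antitoneOn_kinetic hN hν hs h0mem (Ioo_subset_Ico_self ht) ht.1.le).trans hE0)

end Main
end MHD

theorem proposition3p1 (N : ℕ) (hN : 2 ≤ N) (ν : ℝ) (hν : 0 < ν) (α : ℝ)
    (hα : 1 + (N : ℝ) / 2 ≤ α) (g : ℝ → ℝ) (hg_mono : MonotoneOn g (Ioi 0))
    (hg_one : ∀ r, 0 < r → 1 ≤ g r)
    (hg_div : ∫⁻ τ in Ioi (Real.exp 1), ENNReal.ofReal (1 / (g τ ^ 2 * Real.log τ * τ)) = ⊤)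
    (s : ℝ) (hs : 3 + (N : ℝ) ≤ s) (T : ℝ) (hT : 0 < T) :
    -- finiteness for every solution on the closed interval
    (∀ m : MHD.Sp N → ℝ, Measurable m → (∃ R, MHD.LowerBoundFrom α g R m) →
      ∀ u b : ℝ → MHD.Sp N → MHD.Sp N, MHD.IsSolution ν m s (Icc 0 T) u b →
        MHD.energyH1 m (Icc 0 T) u b < ⊤) ∧
    -- the a priori bound, for solutions that need not extend to the end of their interval
    ((∃ p : ℝ, p < α - (N : ℝ) / 2 ∧ g =O[atTop] fun r : ℝ => r ^ p) →
      ∀ (R : ℝ) (K : ℝ≥0), 0 < R → ∃ C : ℝ≥0,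
        ∀ m : MHD.Sp N → ℝ, Measurable m → MHD.LowerBoundFrom α g R m →
          ∀ T', 0 < T' → T' ≤ T →
            ∀ u b : ℝ → MHD.Sp N → MHD.Sp N, MHD.IsSolution ν m s (Ico 0 T') u b →
              MHD.sobolevNormSq s (u 0) + MHD.sobolevNormSq s (b 0) ≤ K →
                MHD.energyH1 m (Ico 0 T') u b ≤ C) := by
  have hN0 : N ≠ 0 := by omega
  refine ⟨fun m hm _ u b h => h.energyH1_lt_top hN0 hν hs hT hm, ?_⟩
  rintro ⟨p, hp, hgp⟩ R K -
  exact MHD.IsSolution.exists_apriori_bound hN0 hν hα hg_mono hg_one hg_div hs T hp hgp R K
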